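/- **Setting.** Let $(Z_i, D_{i,0}, D_{i,1}, \{Y_{i,t}(d_0,d_1)\}_{t,d_0,d_1\in\{0,1\}})$, $i=1,2,\dots$, be i.i.d.; $Z_i$ is a running variable with cutoff $0$, $D_{i,0}$ the confounding policy, $D_{i,1}$ the treatment. Observed outcomes are $Y_{i,1}=Y_{i,1}(D_{i,0},D_{i,1})$ and $Y_{i,0}=Y_{i,0}(D_{i,0},0)$, and $\Delta Y_i=Y_{i,1}-Y_{i,0}$. Write $\Delta Y_i(1)=Y_{i,1}(1,1)-Y_{i,0}(1,0)$ and $\Delta Y_i(0)=Y_{i,1}(0,0)-Y_{i,0}(0,0)$. Let $\tau_c=E[Y_{i,1}(1,1)-Y_{i,1}(1,0)\mid Z_i=0]$ and $\Delta\mu_\pm=\lim_{z\to0^\pm}E[\Delta Y_i\mid Z_i=z]$, $\theta_0=(\Delta\mu_+,\Delta\mu_-)$. **Assumptions.** For some $\kappa_0>0$: 1. (Assumption 1, continuity) for all $t,d_0,d_1$, $z\mapsto E[Y_{i,t}(d_0,d_1)\mid Z_i=z]$ is continuous at $0$; 2. (Assumption 3, sharp discontinuities) $D_{i,0}=D_{i,1}=\mathbf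 1\{Z_i\ge0\}$ almost surely when $|Z_i|<\kappa_0$; 3. (regularity) on $(-\kappa_0,\kappa_0)$: $E[\Delta Y_i^4\mid Z_i=z]$ is bounded; $Z_i$ has a density $f$ that is continuous and bounded away from zero; $E[\Delta Y_i(1)\mid Z_i=z]$ and $E[\Delta Y_i(0)\mid Z_i=z]$ are $q+1$ times continuously differentiable; $\sigma_+^2(z)=V[\Delta Y_i(1)\mid Z_i=z]$ and $\sigma_-^2(z)=V[\Delta Y_i(0)\mid Z_i=z]$ are continuous and bounded away from zero; 4. (kernel) $K:\mathbb R\to[0,\infty)$ is bounded, symmetric, zero outside $[-\kappa,\kappa]$, and positive and continuous on $(0,\kappa)$, for some $\kappa>0$; 5. (bandwidths) $p<q$ are natural numbers, $h_n,b_n>0$, $\max\{h_n,b_n\}\to0$, $n\min\{h_n,b_n\}\to\infty$, $n\min\{h_n^{2p+3},b_n^{2p+3}\}\max\{h_n^2,b_n^{2(q-p)}\}\to0$, and $h_n/b_n\to\rho\in[0,\infty)$. **Estimators.** On the right (weights $w_h(z)=\mathbf 1\{z\ge0\}K(z/h)/h$) and on the left ($w_h(z)=\mathbf 1\{z<0\}K(z/h)/h$)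 let $\hat\delta_{\pm,p}(h)$ be the least squares coefficients of $\Delta Y_i$ on $(1,Z_i,\dots,Z_i^p)$ with weights $w_h(Z_i)$, $i\le n$, computed by the usual closed formula, and put $\Delta\hat\mu^{(\nu)}_{\pm,p}(h)=\nu!\,e_\nu'\hat\delta_{\pm,p}(h)$. With $r_p(u)=(1,u,\dots,u^p)'$, $\Gamma_{\pm,p}(h)=\frac1n\sum_{i\le n} w_h(Z_i)\,r_p(Z_i/h)r_p(Z_i/h)'$, $\vartheta_{\pm,p}(h)=\frac1n\sum_{i\le n} w_h(Z_i)\,r_p(Z_i/h)(Z_i/h)^{p+1}$ and $\mathcal B_{\pm,p}(h)=e_0'\Gamma_{\pm,p}(h)^{-1}\vartheta_{\pm,p}(h)$, the bias-corrected one-sided estimators are $$\Delta\hat\mu_{\pm}=\Delta\hat\mu^{(0)}_{\pm,p}(h_n)-h_n^{p+1}\,\frac{\Delta\hat\mu^{(p+1)}_{\pm,q}(b_n)}{(p+1)!}\,\mathcal B_{\pm,p}(h_n),\qquad \hat\theta=(\Delta\hat\mu_+,\Delta\hat\mu_-).$$ **Bounds.** Let $\mathcal C\subset\mathbb R^2$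 be a finite grid of sensitivity parameters $c=(c_1,c_2)$. For $\theta\in\mathbb R^2$ and $c\in\mathcal C$ let $$\phi(\theta)(c)=\begin{pmatrix}\max\{\theta_1-c_1,\ \theta_1-\theta_2-c_2\}\\ \min\{\theta_1+c_1,\ \theta_1-\theta_2+c_2\}\end{pmatrix},\qquad \phi:\mathbb R^2\to\ell^\infty(\mathcal C,\mathbb R^2),$$ $(\tau_c^{LB},\tau_c^{UB})=\phi(\theta_0)$ and $(\hat\tau_c^{LB},\hat\tau_c^{UB})=\phi(\hat\theta)$. **Theorem 2.** (0) For every $c\in\mathcal C$ for which bounded variations (Assumption 5) holds, that is, $|E[Y_{i,1}(1,0)-Y_{i,0}(1,0)\mid Z_i=0]|\le c_1$ and $|E[Y_{i,1}(1,0)-Y_{i,1}(0,0)\mid Z_i=0]-E[Y_{i,0}(1,0)-Y_{i,0}(0,0)\mid Z_i=0]|\le c_2$, one has $\tau_c\in[\tau_c^{LB},\tau_c^{UB}]$. (i) $\sqrt{n\min\{h_n,b_n\}}\,(\hat\theta-\theta_0)\to_d\mathbf G=(\mathbf G_+,\mathbf G_-)$ with $\mathbf G_+$, $\mathbf G_-$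 independent centred Gaussian variables with variances $$\frac{\sigma_\pm^2(0)}{f(0)}\,\frac1{\max\{1,\rho\}}\int_0^\infty\Big(k_{p,0}(u)-\rho^{p+2}\,e_0'\Gamma_p^{-1}\vartheta_{p}\;k_{q,p+1}(\rho u)\Big)^2du,\qquad k_{p,j}(u)=K(u)\,e_j'\Gamma_p^{-1}r_p(u),$$ where $\Gamma_p=\int_0^\infty K(u)r_p(u)r_p(u)'du$ and $\vartheta_{p}=\int_0^\infty K(u)r_p(u)u^{p+1}du$. (ii) $\phi$ is Hadamard directionally differentiable at $\theta_0$, with derivative $\phi'_{\theta_0}(k)(c)=(a,b)$, where $a$ equals $k_1$, $k_1-k_2$ or $\max\{k_1,k_1-k_2\}$ according as $\Delta\mu_+-c_1$ is greater than, less than or equal to $\Delta\mu_+-\Delta\mu_--c_2$, and $b$ equals $k_1$, $k_1-k_2$ or $\min\{k_1,k_1-k_2\}$ according as $\Delta\mu_++c_1$ is less than, greater than or equal to $\Delta\mu_+-\Delta\mu_-+c_2$. (iii) In $\ell^\infty(\mathcal C,\mathbb R^2)$, $$\sqrt{n\min\{h_n,b_n\}}\begin{pmatrix}\hat\tau_c^{LB}-\tau_c^{LB}\\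 \hat\tau_c^{UB}-\tau_c^{UB}\end{pmatrix}_{c\in\mathcal C}\to_d\ \phi'_{\theta_0}(\mathbf G).$$ (iv) The limit $\phi'_{\theta_0}(\mathbf G)$ is tight. It is Gaussian if and only if, for every $c\in\mathcal C$, the two entries of the maximum differ and the two entries of the minimum differ, that is, $c_1-c_2\ne\Delta\mu_-$ and $c_2-c_1\ne\Delta\mu_-$. -/

import Mathlib

open MeasureTheory ProbabilityTheory Filter Topology Set
open scoped Matrix NNReal

noncomputable section

/-! ### Two-period panel with a confounding policy -/

/-- Two-period panel data on units `i = 0, 1, 2, …`: time-invariant running variable `Z i`,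
confounding policy `D0 i`, treatment of interest `D1 i`, and potential outcomes
`Y i t d₀ d₁` in period `t ∈ {0, 1}` when the confounder is set to `d₀` and the treatment to `d₁`. -/
structure Panel (Ω : Type*) where
  Z : ℕ → Ω → ℝ
  D0 : ℕ → Ω → Bool
  D1 : ℕ → Ω → Bool
  Y : ℕ → Fin 2 → Bool → Bool → Ω → ℝ

namespace Panel

variable {Ω : Type*} (S : Panel Ω)

/-- All variables attached to unit `i`, as one random vector. -/
def unit (i : ℕ) (ω : Ω) : ℝ × (Bool × Bool) × (Fin 2 → Bool → Bool → ℝ) :=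
  (S.Z i ω, (S.D0 i ω, S.D1 i ω), fun t d0 d1 => S.Y i t d0 d1 ω)

/-- Observed outcome in period 1. -/
def obs1 (i : ℕ) (ω : Ω) : ℝ := S.Y i 1 (S.D0 i ω) (S.D1 i ω) ω

/-- Observed outcome in period 0, when the treatment of interest does not exist yet. -/
def obs0 (i : ℕ) (ω : Ω) : ℝ := S.Y i 0 (S.D0 i ω) false ω

/-- Observed change of the outcome over time, `ΔY_i`. -/
def deltaY (i : ℕ) (ω : Ω) : ℝ := S.obs1 i ω - S.obs0 i ω

/-- `ΔY_i(1) = Y_{i,1}(1,1) - Y_{i,0}(1,0)`. -/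
def deltaY1 (i : ℕ) (ω : Ω) : ℝ := S.Y i 1 true true ω - S.Y i 0 true false ω

/-- `ΔY_i(0) = Y_{i,1}(0,0) - Y_{i,0}(0,0)`. -/
def deltaY0 (i : ℕ) (ω : Ω) : ℝ := S.Y i 1 false false ω - S.Y i 0 false false ω

end Panel

/-- The units are an i.i.d. sample. -/
structure IsRandomSample {Ω : Type*} [MeasurableSpace Ω] (P : Measure Ω) (S : Panel Ω) :
    Prop where
  measurable : ∀ i, Measurable (S.unit i)
  indep : iIndepFun S.unit P
  ident : ∀ i, IdentDistrib (S.unit i) (S.unit 0) P P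

/-- The open neighbourhood `(-κ₀, κ₀)` of the cutoff `0`. -/
def nbhd (κ₀ : ℝ) : Set ℝ := Ioo (-κ₀) κ₀

/-- `g` is a version of the regression function `z ↦ E[X | Z = z]` on the set `U`: the random
variable `X` is integrable on `{Z ∈ U}` and, there, `E[X | σ(Z)] = g(Z)` almost surely. -/
structure IsRegressionOn {Ω : Type*} [MeasurableSpace Ω] (P : Measure Ω) (Z X : Ω → ℝ)
    (g : ℝ → ℝ) (U : Set ℝ) : Prop where
  measurable : Measurable g
  integrableOn : IntegrableOn X (Z ⁻¹' U) P
  condExp_eq : (P.restrict (Z ⁻¹' U))[X | MeasurableSpace.comap Z inferInstance]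
    =ᵐ[P.restrict (Z ⁻¹' U)] fun ω => g (Z ω)

/-! ### Identification assumptions -/

/-- Continuity: for all `t, d₀, d₁`, the function `m t d₀ d₁` is a version of
`z ↦ E[Y_{i,t}(d₀,d₁) | Z_i = z]` near the cutoff, and it is continuous at the cutoff. -/
structure ContinuityAtCutoff {Ω : Type*} [MeasurableSpace Ω] (P : Measure Ω) (S : Panel Ω)
    (κ₀ : ℝ) (m : Fin 2 → Bool → Bool → ℝ → ℝ) : Prop where
  regression : ∀ t d0 d1, IsRegressionOn P (S.Z 0) (S.Y 0 t d0 d1) (m t d0 d1) (nbhd κ₀)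
  continuousAt : ∀ t d0 d1, ContinuousAt (m t d0 d1) 0

/-- Sharp discontinuities: around the cutoff there is perfect compliance with the assignment rule
`D_{i,0} = D_{i,1} = 1{Z_i ≥ 0}`. -/
def SharpDiscontinuity {Ω : Type*} [MeasurableSpace Ω] (P : Measure Ω) (S : Panel Ω)
    (κ₀ : ℝ) : Prop :=
  ∀ i, ∀ᵐ ω ∂P, S.Z i ω ∈ nbhd κ₀ →
    (S.D0 i ω = true ↔ 0 ≤ S.Z i ω) ∧ (S.D1 i ω = true ↔ 0 ≤ S.Z i ω)

/-- Bounded variations, with sensitivity parameters `c = (c₁, c₂)`. -/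
def BoundedVariations (m : Fin 2 → Bool → Bool → ℝ → ℝ) (c : ℝ × ℝ) : Prop :=
  |m 1 true false 0 - m 0 true false 0| ≤ c.1 ∧
  |(m 1 true false 0 - m 1 false false 0) - (m 0 true false 0 - m 0 false false 0)| ≤ c.2

/-- `τ_c = E[Y_{i,1}(1,1) - Y_{i,1}(1,0) | Z_i = 0]`. -/
def tauC (m : Fin 2 → Bool → Bool → ℝ → ℝ) : ℝ := m 1 true true 0 - m 1 true false 0

/-! ### Assumptions for local polynomial estimation -/

/-- Regularity of the model on `(-κ₀, κ₀)`: bounded conditional fourth moment of `ΔY`, density `f`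
of the running variable, `N`-fold continuous differentiability of
`Δμ₊(z) = E[ΔY(1) | Z = z]` and `Δμ₋(z) = E[ΔY(0) | Z = z]`, and conditional variances `vp` of
`ΔY(1)` and `vm` of `ΔY(0)` given `Z = z`. -/
structure SharpModel {Ω : Type*} [MeasurableSpace Ω] (P : Measure Ω) (S : Panel Ω)
    (κ₀ : ℝ) (N : ℕ) (m : Fin 2 → Bool → Bool → ℝ → ℝ) (f vp vm : ℝ → ℝ) : Prop where
  fourth_moment : ∃ g : ℝ → ℝ,
    IsRegressionOn P (S.Z 0) (fun ω => S.deltaY 0 ω ^ 4) g (nbhd κ₀) ∧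
    ∃ M : ℝ, ∀ z ∈ nbhd κ₀, g z ≤ M
  density : (P.map (S.Z 0)).restrict (nbhd κ₀) =
    (volume.restrict (nbhd κ₀)).withDensity (fun z => ENNReal.ofReal (f z))
  density_continuous : ContinuousOn f (nbhd κ₀)
  density_pos : ∃ a > 0, ∀ z ∈ nbhd κ₀, a ≤ f z
  smooth_right : ContDiffOn ℝ N (fun z => m 1 true true z - m 0 true false z) (nbhd κ₀)
  smooth_left : ContDiffOn ℝ N (fun z => m 1 false false z - m 0 false false z) (nbhd κ₀)
  variance_right : IsRegressionOn P (S.Z 0)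
    (fun ω => (S.deltaY1 0 ω - (m 1 true true (S.Z 0 ω) - m 0 true false (S.Z 0 ω))) ^ 2)
    vp (nbhd κ₀)
  variance_left : IsRegressionOn P (S.Z 0)
    (fun ω => (S.deltaY0 0 ω - (m 1 false false (S.Z 0 ω) - m 0 false false (S.Z 0 ω))) ^ 2)
    vm (nbhd κ₀)
  variance_right_continuous : ContinuousOn vp (nbhd κ₀)
  variance_left_continuous : ContinuousOn vm (nbhd κ₀)
  variance_right_pos : ∃ a > 0, ∀ z ∈ nbhd κ₀, a ≤ vp z
  variance_left_pos : ∃ a > 0, ∀ z ∈ nbhd κ₀, a ≤ vm z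

/-- The kernel is bounded, nonnegative, symmetric, zero outside `[-κ, κ]`, and positive and
continuous on `(0, κ)`. -/
structure IsRDKernel (K : ℝ → ℝ) (κ : ℝ) : Prop where
  pos : 0 < κ
  nonneg : ∀ u, 0 ≤ K u
  bounded : ∃ M, ∀ u, K u ≤ M
  support : ∀ u, κ < |u| → K u = 0
  symmetric : ∀ u, K (-u) = K u
  positive : ∀ u ∈ Ioo 0 κ, 0 < K u
  continuous : ContinuousOn K (Ioo 0 κ)

/-- Conditions on the main bandwidth `h` (polynomial order `p`) and the bias bandwidth `b`
(polynomial order `q`), with limiting ratio `h / b → ρ ∈ [0, ∞)`. -/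
structure BandwidthConditions (p q : ℕ) (h b : ℕ → ℝ) (ρ : ℝ) : Prop where
  h_pos : ∀ n, 0 < h n
  b_pos : ∀ n, 0 < b n
  max_tendsto : Tendsto (fun n => max (h n) (b n)) atTop (𝓝 0)
  min_tendsto : Tendsto (fun n : ℕ => (n : ℝ) * min (h n) (b n)) atTop atTop
  bias_tendsto : Tendsto (fun n : ℕ =>
    (n : ℝ) * min (h n ^ (2 * p + 3)) (b n ^ (2 * p + 3)) *
      max (h n ^ 2) (b n ^ (2 * (q - p)))) atTop (𝓝 0)
  ratio_tendsto : Tendsto (fun n => h n / b n) atTop (𝓝 ρ)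

/-! ### One-sided local polynomial estimators

The side of the cutoff is a set `s`: `Ici 0` (right) or `Iio 0` (left). Data are sequences
`z, y : ℕ → ℝ`, of which the first `n` terms are used. -/

/-- `1(u ∈ s) K_h(u)` with `K_h(u) = K(u/h)/h`. -/
def weight (s : Set ℝ) (K : ℝ → ℝ) (h u : ℝ) : ℝ := s.indicator (fun v => K (v / h) / h) u

/-- `r_p(u) = (1, u, …, u^p)`. -/
def rvec (p : ℕ) (u : ℝ) : Fin (p + 1) → ℝ := fun i => u ^ (i : ℕ)

/-- The unit vector `e_j` of `ℝ^(p+1)`. -/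
def evec (p j : ℕ) : Fin (p + 1) → ℝ := fun i => if (i : ℕ) = j then 1 else 0

/-- `Γ_p(h) = Z_p(h)' W(h) Z_p(h) / n`. -/
def gram (s : Set ℝ) (K : ℝ → ℝ) (p : ℕ) (h : ℝ) (n : ℕ) (z : ℕ → ℝ) :
    Matrix (Fin (p + 1)) (Fin (p + 1)) ℝ :=
  Matrix.of fun i j =>
    (∑ k ∈ Finset.range n, weight s K h (z k) * (rvec p (z k / h) i * rvec p (z k / h) j)) / n

/-- `Z_p(h)' W(h) x / n`. -/
def wmoment (s : Set ℝ) (K : ℝ → ℝ) (p : ℕ) (h : ℝ) (n : ℕ) (z x : ℕ → ℝ) : Fin (p + 1) → ℝ :=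
  fun i => (∑ k ∈ Finset.range n, weight s K h (z k) * (rvec p (z k / h) i * x k)) / n

/-- Local polynomial coefficients `δ̂_p(h) = H_p(h) Γ_p(h)⁻¹ Z_p(h)' W(h) y / n`, where
`H_p(h) = diag(1, h⁻¹, …, h⁻ᵖ)`. -/
def localPolyCoef (s : Set ℝ) (K : ℝ → ℝ) (p : ℕ) (h : ℝ) (n : ℕ) (z y : ℕ → ℝ) :
    Fin (p + 1) → ℝ :=
  fun i => (h⁻¹) ^ (i : ℕ) * ((gram s K p h n z)⁻¹ *ᵥ wmoment s K p h n z y) i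

/-- The kernel-weighted sum of squares minimised by a local polynomial fit. -/
def localPolyLoss (s : Set ℝ) (K : ℝ → ℝ) (p : ℕ) (h : ℝ) (n : ℕ) (z y : ℕ → ℝ)
    (δ : Fin (p + 1) → ℝ) : ℝ :=
  ∑ k ∈ Finset.range n, (y k - rvec p (z k) ⬝ᵥ δ) ^ 2 * weight s K h (z k)

/-- The closed form `localPolyCoef` is the weighted least squares estimator. -/
theorem localPolyCoef_isMin (s : Set ℝ) (K : ℝ → ℝ) (hK : ∀ u, 0 ≤ K u) (p : ℕ) (h : ℝ)
    (hh : 0 < h) (n : ℕ) (z y : ℕ → ℝ) (hdet : IsUnit (gram s K p h n z).det)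
    (δ : Fin (p + 1) → ℝ) :
    localPolyLoss s K p h n z y (localPolyCoef s K p h n z y) ≤ localPolyLoss s K p h n z y δ := by
  have hw : ∀ u, 0 ≤ weight s K h u := fun u =>
    Set.indicator_nonneg (fun v _ => div_nonneg (hK _) hh.le) u
  rcases Nat.eq_zero_or_pos n with hn | hn
  · subst hn; simp [localPolyLoss]
  have hn' : (n : ℝ) ≠ 0 := by positivity
  have hh' : h ≠ 0 := hh.ne'
  set g := (gram s K p h n z)⁻¹ *ᵥ wmoment s K p h n z y with hg
  set c := localPolyCoef s K p h n z y with hc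
  have hfit : ∀ u, rvec p u ⬝ᵥ c = rvec p (u / h) ⬝ᵥ g := by
    intro u
    simp only [dotProduct, rvec, hc, localPolyCoef]
    refine Finset.sum_congr rfl fun i _ => ?_
    rw [div_pow, ← hg, inv_pow]; field_simp
  have hgram : gram s K p h n z *ᵥ g = wmoment s K p h n z y := by
    rw [hg, Matrix.mulVec_mulVec, Matrix.mul_nonsing_inv _ hdet, Matrix.one_mulVec]
  have hnormal : ∀ i, ∑ k ∈ Finset.range n,
      weight s K h (z k) * (rvec p (z k / h) i * (y k - rvec p (z k / h) ⬝ᵥ g)) = 0 := by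
    intro i
    have h1 := congrFun hgram i
    simp only [Matrix.mulVec, dotProduct, gram, wmoment, Matrix.of_apply] at h1
    have h2 : ∑ j, (∑ k ∈ Finset.range n, weight s K h (z k) *
        (rvec p (z k / h) i * rvec p (z k / h) j)) / n * g j =
        (∑ k ∈ Finset.range n, weight s K h (z k) *
          (rvec p (z k / h) i * (rvec p (z k / h) ⬝ᵥ g))) / n := by
      simp only [dotProduct, Finset.mul_sum, Finset.sum_div, Finset.sum_mul]
      rw [Finset.sum_comm]
      refine Finset.sum_congr rfl fun k _ => Finset.sum_congr rfl fun j _ => by ring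
    rw [h2, div_left_inj' hn'] at h1
    simp only [mul_sub, Finset.sum_sub_distrib]
    rw [h1, sub_self]
  have hcross : ∑ k ∈ Finset.range n, weight s K h (z k) *
      ((rvec p (z k) ⬝ᵥ (δ - c)) * (y k - rvec p (z k) ⬝ᵥ c)) = 0 := by
    have : ∀ k, weight s K h (z k) * ((rvec p (z k) ⬝ᵥ (δ - c)) * (y k - rvec p (z k) ⬝ᵥ c)) =
        ∑ i : Fin (p + 1), (h ^ (i : ℕ) * (δ - c) i) *
          (weight s K h (z k) * (rvec p (z k / h) i * (y k - rvec p (z k / h) ⬝ᵥ g))) := by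
      intro k
      rw [hfit]
      simp only [dotProduct, Finset.sum_mul, Finset.mul_sum]
      refine Finset.sum_congr rfl fun i _ => ?_
      have : rvec p (z k) i = h ^ (i : ℕ) * rvec p (z k / h) i := by
        simp only [rvec, div_pow]; field_simp
      rw [this]; ring
    simp only [this]
    rw [Finset.sum_comm]
    refine Finset.sum_eq_zero fun i _ => ?_
    rw [← Finset.mul_sum, hnormal, mul_zero]
  have key : localPolyLoss s K p h n z y δ = localPolyLoss s K p h n z y c +
      ∑ k ∈ Finset.range n, weight s K h (z k) * (rvec p (z k) ⬝ᵥ (δ - c)) ^ 2 := by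
    have : localPolyLoss s K p h n z y δ = localPolyLoss s K p h n z y c +
        ∑ k ∈ Finset.range n, weight s K h (z k) * (rvec p (z k) ⬝ᵥ (δ - c)) ^ 2 -
        2 * ∑ k ∈ Finset.range n, weight s K h (z k) *
      ((rvec p (z k) ⬝ᵥ (δ - c)) * (y k - rvec p (z k) ⬝ᵥ c)) := by
      simp only [localPolyLoss, Finset.mul_sum, ← Finset.sum_add_distrib,
        ← Finset.sum_sub_distrib]
      refine Finset.sum_congr rfl fun k _ => ?_
      rw [dotProduct_sub]; ring
    rw [this, hcross]; ring
  rw [key]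
  exact le_add_of_nonneg_right (Finset.sum_nonneg fun k _ => mul_nonneg (hw _) (sq_nonneg _))

/-- `Δμ̂^(ν)_p(h) = ν! e_ν' δ̂_p(h)`. -/
def localPolyEst (s : Set ℝ) (K : ℝ → ℝ) (ν p : ℕ) (h : ℝ) (n : ℕ) (z y : ℕ → ℝ) : ℝ :=
  (Nat.factorial ν : ℝ) * (evec p ν ⬝ᵥ localPolyCoef s K p h n z y)

/-- `ℬ_{0,p,r}(h) = e_0' Γ_p(h)⁻¹ ϑ_{p,r}(h)`, with `ϑ_{p,r}(h) = Z_p(h)' W(h) S_r(h) / n` and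
`S_r(h) = ((z_1/h)^r, …, (z_n/h)^r)`. -/
def biasFactor (s : Set ℝ) (K : ℝ → ℝ) (p r : ℕ) (h : ℝ) (n : ℕ) (z : ℕ → ℝ) : ℝ :=
  evec p 0 ⬝ᵥ ((gram s K p h n z)⁻¹ *ᵥ wmoment s K p h n z (fun k => (z k / h) ^ r))

/-- Bias-corrected one-sided estimator
`Δμ̂_{p,q}(h,b) = Δμ̂_p(h) - h^(p+1) (Δμ̂^(p+1)_q(b) / (p+1)!) ℬ_{0,p,p+1}(h)`. -/
def bcEst (s : Set ℝ) (K : ℝ → ℝ) (p q : ℕ) (h b : ℝ) (n : ℕ) (z y : ℕ → ℝ) : ℝ :=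
  localPolyEst s K 0 p h n z y -
    h ^ (p + 1) * (localPolyEst s K (p + 1) q b n z y / (Nat.factorial (p + 1) : ℝ)) * biasFactor s K p (p + 1) h n z

/-- `θ̂ = (Δμ̂_{+,p,q}(h,b), Δμ̂_{-,p,q}(h,b))`, from the sample of the first `n` units. -/
def thetaHat {Ω : Type*} (S : Panel Ω) (K : ℝ → ℝ) (p q : ℕ) (h b : ℝ) (n : ℕ) (ω : Ω) : ℝ × ℝ :=
  (bcEst (Ici 0) K p q h b n (fun k => S.Z k ω) (fun k => S.deltaY k ω),
   bcEst (Iio 0) K p q h b n (fun k => S.Z k ω) (fun k => S.deltaY k ω))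

/-! ### Asymptotic variance of the one-sided estimators -/

/-- `Γ_p = ∫₀^∞ K(u) r_p(u) r_p(u)' du`. -/
def limGram (K : ℝ → ℝ) (p : ℕ) : Matrix (Fin (p + 1)) (Fin (p + 1)) ℝ :=
  Matrix.of fun i j => ∫ u in Ioi (0 : ℝ), K u * (rvec p u i * rvec p u j)

/-- `ϑ_{p,r} = ∫₀^∞ K(u) r_p(u) u^r du`. -/
def limMoment (K : ℝ → ℝ) (p r : ℕ) : Fin (p + 1) → ℝ :=
  fun i => ∫ u in Ioi (0 : ℝ), K u * (rvec p u i * u ^ r)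

/-- `e_0' Γ_p⁻¹ ϑ_{p,r}`. -/
def limBiasFactor (K : ℝ → ℝ) (p r : ℕ) : ℝ :=
  evec p 0 ⬝ᵥ ((limGram K p)⁻¹ *ᵥ limMoment K p r)

/-- `K(u) e_j' Γ_p⁻¹ r_p(u)`. -/
def equivKernel (K : ℝ → ℝ) (p j : ℕ) (u : ℝ) : ℝ :=
  K u * (evec p j ⬝ᵥ ((limGram K p)⁻¹ *ᵥ rvec p u))

/-- Equivalent kernel of the bias-corrected estimator when `h / b → ρ`. -/
def bcKernel (K : ℝ → ℝ) (p q : ℕ) (ρ u : ℝ) : ℝ :=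
  equivKernel K p 0 u -
    ρ ^ (p + 2) * limBiasFactor K p (p + 1) * equivKernel K q (p + 1) (ρ * u)

/-- Limit of `n min{h, b}` times the conditional variance of the bias-corrected one-sided
estimator, when the conditional variance of the outcome and the density of the running variable
at the cutoff are `v` and `f₀`. -/
def limVar (K : ℝ → ℝ) (p q : ℕ) (ρ v f₀ : ℝ) : ℝ :=
  v / f₀ * (1 / max 1 ρ) * ∫ u in Ioi (0 : ℝ), bcKernel K p q ρ u ^ 2

/-- Law of the Gaussian limit of the one-sided estimators: centred, independent coordinates. -/
def gaussianLimit (K : ℝ → ℝ) (p q : ℕ) (ρ vp vm f₀ : ℝ) : Measure (ℝ × ℝ) :=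
  (gaussianReal 0 (limVar K p q ρ vp f₀).toNNReal).prod
    (gaussianReal 0 (limVar K p q ρ vm f₀).toNNReal)

instance (K : ℝ → ℝ) (p q : ℕ) (ρ vp vm f₀ : ℝ) :
    IsProbabilityMeasure (gaussianLimit K p q ρ vp vm f₀) := by
  unfold gaussianLimit; infer_instance

/-! ### Bounds -/

/-- Lower bound of `τ_c` at `θ = (Δμ₊, Δμ₋)` and `c = (c₁, c₂)`. -/
def lowerBound (θ c : ℝ × ℝ) : ℝ := max (θ.1 - c.1) (θ.1 - θ.2 - c.2)

/-- Upper bound of `τ_c` at `θ = (Δμ₊, Δμ₋)` and `c = (c₁, c₂)`. -/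
def upperBound (θ c : ℝ × ℝ) : ℝ := min (θ.1 + c.1) (θ.1 - θ.2 + c.2)

/-- The max/min map `φ`, with values in `ℓ^∞(𝒞, ℝ²)` (all functions on the finite grid `𝒞`,
with the sup norm). -/
def boundMap (𝒞 : Finset (ℝ × ℝ)) (θ : ℝ × ℝ) : 𝒞 → ℝ × ℝ :=
  fun c => (lowerBound θ c, upperBound θ c)

/-- Directional derivative of `max` at `(a₁, a₂)` in direction `(k₁, k₂)`. -/
def maxDeriv (a₁ a₂ k₁ k₂ : ℝ) : ℝ := if a₁ < a₂ then k₂ else if a₂ < a₁ then k₁ else max k₁ k₂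

/-- Directional derivative of `min` at `(a₁, a₂)` in direction `(k₁, k₂)`. -/
def minDeriv (a₁ a₂ k₁ k₂ : ℝ) : ℝ := if a₁ < a₂ then k₁ else if a₂ < a₁ then k₂ else min k₁ k₂

/-- `φ'_θ(k)`. -/
def boundDeriv (𝒞 : Finset (ℝ × ℝ)) (θ k : ℝ × ℝ) : 𝒞 → ℝ × ℝ :=
  fun c =>
    (maxDeriv (θ.1 - c.1.1) (θ.1 - θ.2 - c.1.2) k.1 (k.1 - k.2),
     minDeriv (θ.1 + c.1.1) (θ.1 - θ.2 + c.1.2) k.1 (k.1 - k.2))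

/-- `φ'` is the Hadamard directional derivative of `φ` at `θ`. -/
def HasHadamardDirDerivAt {E F : Type*} [NormedAddCommGroup E] [NormedSpace ℝ E]
    [NormedAddCommGroup F] [NormedSpace ℝ F] (φ φ' : E → F) (θ : E) : Prop :=
  Continuous φ' ∧
  ∀ (t : ℕ → ℝ) (k : ℕ → E) (k₀ : E), (∀ n, 0 < t n) → Tendsto t atTop (𝓝 0) →
    Tendsto k atTop (𝓝 k₀) →
    Tendsto (fun n => (t n)⁻¹ • (φ (θ + t n • k n) - φ θ)) atTop (𝓝 (φ' k₀))

end

/-! The estimator on each side of the cutoff is shown to be asymptotically linear. A fit of degree r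
reproduces polynomials of degree r exactly, so inserting the Taylor expansion of the regression
function leaves three pieces (`bcEst_sub_eq`): the Taylor remainders, the noise moments, and the
degree p+1 monomial. The fit of that monomial is precisely the bias factor, so the correction
removes it up to the error in estimating its coefficient. The remainders contribute orders h^(p+2)
and h^(p+1) b^(q-p), which the bandwidth conditions make negligible. The weak law for kernel means
gives convergence of the random Gram matrices to f(0)Γ, and Γ is invertible because a nonzero
polynomial cannot vanish on an interval. Replacing the random weights by their limits turns the
noise into a sum of i.i.d. scores built on `bcKernel` (`bcEst_asymptotically_linear`).

The left side needs no separate analysis: the kernel is symmetric, so reflecting z to -z turns the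
left estimator into a right estimator (`bcEst_Iio`). The two scores of one unit are never both
nonzero. Powers of their linear combinations therefore have no cross terms, and Lyapunov's theorem
for characteristic functions gives a limit that factorises (`tendstoInDistribution_rowSum_prod`).
When h/b tends to 0 the second part of `bcKernel` spreads over an ever wider range; the bound by
C/(1+u²), uniform in the ratio, permits dominated convergence there too.

Identification compares conditional expectations: the observed change agrees with a difference of
potential outcomes on either side, so the regression functions agree at almost every value of Z. Z
charges every interval near 0, which forces equality of the limits.

For the bounds, the difference quotient of a Hadamard directionally differentiable map extends
continuously to step size 0. The delta method is then continuous mapping applied to the pair (scaled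
error, inverse rate). Finally, without ties the derivative is linear and preserves Gaussianity. At a
tie, one entry is, up to sign, ±G₊ plus an independent nonnegative variable that vanishes with
probability strictly between 0 and 1. Were the sum Gaussian, the Laplace transform of that variable
would be the exponential of a quadratic; being bounded away from 0 and at most 1 on a half-line, it
would be constant, which is impossible (`map_add_ne_gaussianReal`). -/

noncomputable section

/-! ### Convergence in probability -/

section InProbability

variable {Ω : Type*} [MeasurableSpace Ω] {P : Measure Ω} [IsProbabilityMeasure P]

/-- Stochastic boundedness, `X n = O_p(1)`. -/
def BoundedInProb (P : Measure Ω) (X : ℕ → Ω → ℝ) : Prop :=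
  ∀ ε > 0, ∃ C : ℝ, ∀ᶠ n in atTop, P.real {ω | C < |X n ω|} ≤ ε

theorem tendstoInMeasure_real_iff {X : ℕ → Ω → ℝ} {c : ℝ} :
    TendstoInMeasure P X atTop (fun _ => c) ↔
      ∀ ε > 0, Tendsto (fun n => P.real {ω | ε ≤ |X n ω - c|}) atTop (𝓝 0) := by
  rw [tendstoInMeasure_iff_measureReal_norm]; rfl

theorem MeasureTheory.TendstoInMeasure.comp_continuousAt {E F : Type*} [PseudoMetricSpace E]
    [PseudoMetricSpace F] {X : ℕ → Ω → E} {c : E} {g : E → F} (hg : ContinuousAt g c)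
    (hX : TendstoInMeasure P X atTop (fun _ => c)) :
    TendstoInMeasure P (fun n ω => g (X n ω)) atTop (fun _ => g c) := by
  rw [tendstoInMeasure_iff_measureReal_dist] at hX ⊢
  intro ε hε
  obtain ⟨δ, hδ, h⟩ := Metric.continuousAt_iff.1 hg ε hε
  refine squeeze_zero (fun _ => measureReal_nonneg) (fun n => ?_) (hX δ hδ)
  refine measureReal_mono fun ω hω => ?_
  by_contra hlt
  exact absurd (h (not_le.1 hlt)) (not_lt.2 hω)

theorem tendstoInMeasure_pi {ι E : Type*} [Fintype ι] [PseudoMetricSpace E]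
    {X : ℕ → Ω → ι → E} {c : ι → E}
    (hX : ∀ i, TendstoInMeasure P (fun n ω => X n ω i) atTop (fun _ => c i)) :
    TendstoInMeasure P X atTop (fun _ => c) := by
  rw [tendstoInMeasure_iff_measureReal_dist]
  intro ε hε
  have h0 : Tendsto (fun n => ∑ i, P.real {ω | ε ≤ dist (X n ω i) (c i)}) atTop (𝓝 0) := by
    rw [← Finset.sum_const_zero (s := (Finset.univ : Finset ι))]
    exact tendsto_finsetSum _ fun i _ => (tendstoInMeasure_iff_measureReal_dist.1 (hX i)) ε hε
  refine squeeze_zero (fun _ => measureReal_nonneg) (fun n => ?_) h0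
  refine le_trans (measureReal_mono ?_) (measureReal_iUnion_fintype_le _)
  intro ω hω
  by_contra hcon
  simp only [mem_iUnion, mem_ofPred_eq, not_exists, not_le] at hcon
  exact absurd ((dist_pi_lt_iff hε).2 hcon) (not_lt.2 hω)

theorem tendstoInMeasure_prodMk {E F : Type*} [PseudoMetricSpace E] [PseudoMetricSpace F]
    {X : ℕ → Ω → E} {Y : ℕ → Ω → F} {a : E} {b : F}
    (hX : TendstoInMeasure P X atTop (fun _ => a)) (hY : TendstoInMeasure P Y atTop (fun _ => b)) :
    TendstoInMeasure P (fun n ω => (X n ω, Y n ω)) atTop (fun _ => (a, b)) := by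
  rw [tendstoInMeasure_iff_measureReal_dist] at hX hY ⊢
  intro ε hε
  refine squeeze_zero (fun _ => measureReal_nonneg) (fun n => ?_)
    (by simpa using (hX ε hε).add (hY ε hε))
  refine le_trans (measureReal_mono ?_) (measureReal_union_le _ _)
  intro ω hω
  simpa [Prod.dist_eq, le_max_iff] using hω

theorem MeasureTheory.TendstoInMeasure.add_const {X Y : ℕ → Ω → ℝ} {a b : ℝ}
    (hX : TendstoInMeasure P X atTop (fun _ => a)) (hY : TendstoInMeasure P Y atTop (fun _ => b)) :
    TendstoInMeasure P (fun n ω => X n ω + Y n ω) atTop (fun _ => a + b) :=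
  TendstoInMeasure.comp_continuousAt (E := ℝ × ℝ) (F := ℝ) (X := fun n ω => (X n ω, Y n ω))
    (g := fun x : ℝ × ℝ => x.1 + x.2) (c := (a, b)) (by fun_prop) (tendstoInMeasure_prodMk hX hY)

theorem MeasureTheory.TendstoInMeasure.mul_const_limit {X Y : ℕ → Ω → ℝ} {a b : ℝ}
    (hX : TendstoInMeasure P X atTop (fun _ => a)) (hY : TendstoInMeasure P Y atTop (fun _ => b)) :
    TendstoInMeasure P (fun n ω => X n ω * Y n ω) atTop (fun _ => a * b) :=
  TendstoInMeasure.comp_continuousAt (E := ℝ × ℝ) (F := ℝ) (X := fun n ω => (X n ω, Y n ω))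
    (g := fun x : ℝ × ℝ => x.1 * x.2) (c := (a, b)) (by fun_prop) (tendstoInMeasure_prodMk hX hY)

theorem MeasureTheory.TendstoInMeasure.finset_sum_zero {ι : Type*} (t : Finset ι) {X : ι → ℕ → Ω → ℝ}
    (hX : ∀ i ∈ t, TendstoInMeasure P (X i) atTop (fun _ => (0 : ℝ))) :
    TendstoInMeasure P (fun n ω => ∑ i ∈ t, X i n ω) atTop (fun _ => (0 : ℝ)) := by
  classical
  induction t using Finset.induction_on with
  | empty =>
    rw [tendstoInMeasure_real_iff]
    intro ε hε
    simp [not_le.2 hε]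
  | insert i t hi ih =>
    simp only [Finset.sum_insert hi]
    simpa using TendstoInMeasure.add_const (hX i (Finset.mem_insert_self _ _))
      (ih fun j hj => hX j (Finset.mem_insert_of_mem hj))

theorem tendstoInMeasure_of_tendsto_const {x : ℕ → ℝ} {c : ℝ} (hx : Tendsto x atTop (𝓝 c)) :
    TendstoInMeasure P (fun n _ => x n) atTop (fun _ => c) := by
  rw [tendstoInMeasure_real_iff]
  intro ε hε
  refine tendsto_const_nhds.congr' ?_
  filter_upwards [Metric.tendsto_nhds.1 hx ε hε] with n hn
  rw [Real.dist_eq] at hn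
  simp [not_le.2 hn]

theorem MeasureTheory.TendstoInMeasure.of_abs_le {X Y : ℕ → Ω → ℝ}
    (hY : TendstoInMeasure P Y atTop (fun _ => (0 : ℝ)))
    (h : ∀ᶠ n in atTop, ∀ ω, |X n ω| ≤ |Y n ω|) :
    TendstoInMeasure P X atTop (fun _ => (0 : ℝ)) := by
  rw [tendstoInMeasure_real_iff] at hY ⊢
  intro ε hε
  refine tendsto_of_tendsto_of_tendsto_of_le_of_le' tendsto_const_nhds (hY ε hε)
    (Eventually.of_forall fun _ => measureReal_nonneg) ?_
  filter_upwards [h] with n hn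
  refine measureReal_mono fun ω hω => ?_
  simp only [sub_zero, mem_ofPred_eq] at hω ⊢
  exact hω.trans (hn ω)

/-- Two sequences that coincide with probability tending to one have the same limit. -/
theorem MeasureTheory.TendstoInMeasure.congr_eventually {X Y : ℕ → Ω → ℝ} {c : ℝ} {A : ℕ → Set Ω}
    (hY : TendstoInMeasure P Y atTop (fun _ => c))
    (hA : Tendsto (fun n => P.real (A n)) atTop (𝓝 0))
    (h : ∀ᶠ n in atTop, ∀ ω, ω ∉ A n → X n ω = Y n ω) :
    TendstoInMeasure P X atTop (fun _ => c) := by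
  rw [tendstoInMeasure_real_iff] at hY ⊢
  intro ε hε
  refine tendsto_of_tendsto_of_tendsto_of_le_of_le' tendsto_const_nhds
    (by simpa using (hY ε hε).add hA) (Eventually.of_forall fun _ => measureReal_nonneg) ?_
  filter_upwards [h] with n hn
  refine le_trans (measureReal_mono ?_) (measureReal_union_le _ _)
  intro ω hω
  by_cases hωA : ω ∈ A n
  · exact Or.inr hωA
  · left
    simpa [← hn ω hωA] using hω

theorem BoundedInProb.of_tendstoInMeasure {X : ℕ → Ω → ℝ} {c : ℝ}
    (hX : TendstoInMeasure P X atTop (fun _ => c)) : BoundedInProb P X := by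
  intro ε hε
  refine ⟨|c| + 1, ?_⟩
  filter_upwards [(tendstoInMeasure_real_iff.1 hX 1 one_pos).eventually (ge_mem_nhds hε)] with n hn
  refine le_trans (measureReal_mono fun ω hω => ?_) hn
  simp only [mem_ofPred_eq] at hω ⊢
  have := abs_sub_abs_le_abs_sub (X n ω) c
  linarith

theorem BoundedInProb.mul_tendsto_zero {X Y : ℕ → Ω → ℝ} (hX : BoundedInProb P X)
    (hY : TendstoInMeasure P Y atTop (fun _ => (0 : ℝ))) :
    TendstoInMeasure P (fun n ω => X n ω * Y n ω) atTop (fun _ => (0 : ℝ)) := by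
  rw [tendstoInMeasure_real_iff] at hY ⊢
  intro ε hε
  rw [tendsto_order]
  refine ⟨fun a ha => Eventually.of_forall fun n => ha.trans_le measureReal_nonneg, fun η hη => ?_⟩
  -- Half of η pays for |X| > C and half for |Y| ≥ ε/(|C|+1); off both events |XY| < ε. The +1 keeps
  -- the divisor positive.
  obtain ⟨C, hC⟩ := hX (η / 2) (by positivity)
  have hC1 : 0 < |C| + 1 := by positivity
  filter_upwards [hC, (hY (ε / (|C| + 1)) (by positivity)).eventually
    (gt_mem_nhds (half_pos hη))] with n h1 h2
  have hsub : {ω | ε ≤ |X n ω * Y n ω - 0|} ⊆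
      {ω | C < |X n ω|} ∪ {ω | ε / (|C| + 1) ≤ |Y n ω - 0|} := by
    intro ω hω
    simp only [sub_zero, mem_ofPred_eq, mem_union] at hω ⊢
    by_contra hcon
    push Not at hcon
    obtain ⟨h3, h4⟩ := hcon
    rw [lt_div_iff₀ hC1] at h4
    rw [abs_mul] at hω
    have h5 : |X n ω| ≤ |C| + 1 := by linarith [le_abs_self C]
    nlinarith [abs_nonneg (Y n ω), mul_le_mul_of_nonneg_right h5 (abs_nonneg (Y n ω))]
  calc _ ≤ _ := measureReal_mono hsub
    _ ≤ _ := measureReal_union_le _ _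
    _ < η := by linarith

theorem BoundedInProb.of_sq {X : ℕ → Ω → ℝ} {C : ℝ}
    (hX : ∀ᶠ n in atTop, Integrable (fun ω => X n ω ^ 2) P ∧ ∫ ω, X n ω ^ 2 ∂P ≤ C) :
    BoundedInProb P X := by
  intro ε hε
  have hC : 0 ≤ C := by
    obtain ⟨n, -, hn⟩ := hX.exists
    exact (integral_nonneg fun ω => sq_nonneg _).trans hn
  -- Chebyshev's inequality at level D gives probability at most C/D² = Cε/(C+1) ≤ ε; the +1 makes D
  -- positive even when C = 0.
  set D := √((C + 1) / ε) with hD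
  have hDpos : 0 < D := Real.sqrt_pos.2 (by positivity)
  refine ⟨D, ?_⟩
  filter_upwards [hX] with n ⟨hint, hn⟩
  have h1 := mul_meas_ge_le_integral_of_nonneg (μ := P) (f := fun ω => X n ω ^ 2)
    (Eventually.of_forall fun ω => sq_nonneg _) hint (D ^ 2)
  have h2 : P.real {ω | D < |X n ω|} ≤ P.real {ω | D ^ 2 ≤ X n ω ^ 2} :=
    measureReal_mono fun ω hω => by
      simp only [mem_ofPred_eq] at hω ⊢
      rw [← sq_abs (X n ω)]
      exact pow_le_pow_left₀ hDpos.le hω.le 2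
  have h3 : D ^ 2 = (C + 1) / ε := Real.sq_sqrt (by positivity)
  have h4 : (C + 1) / ε * P.real {ω | D < |X n ω|} ≤ C := by
    calc _ ≤ D ^ 2 * P.real {ω | D ^ 2 ≤ X n ω ^ 2} := by
          rw [← h3]; gcongr
      _ ≤ C := h1.trans hn
  have h5 : (C + 1) * P.real {ω | D < |X n ω|} ≤ (C + 1) * ε := by
    have := mul_le_mul_of_nonneg_right h4 hε.le
    have h6 : (C + 1) / ε * P.real {ω | D < |X n ω|} * ε = (C + 1) * P.real {ω | D < |X n ω|} := by
      field_simp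
    nlinarith
  exact le_of_mul_le_mul_left h5 (by positivity)

/-- A sequence with mean tending to `c` and variance tending to `0` tends to `c` in probability;
here both are expressed through the second moment around `c`. -/
theorem tendstoInMeasure_of_sq {X : ℕ → Ω → ℝ} {c : ℝ}
    (hint : ∀ᶠ n in atTop, Integrable (fun ω => (X n ω - c) ^ 2) P)
    (hX : Tendsto (fun n => ∫ ω, (X n ω - c) ^ 2 ∂P) atTop (𝓝 0)) :
    TendstoInMeasure P X atTop (fun _ => c) := by
  rw [tendstoInMeasure_real_iff]
  intro ε hε
  have h0 : Tendsto (fun n => (ε ^ 2)⁻¹ * ∫ ω, (X n ω - c) ^ 2 ∂P) atTop (𝓝 0) := by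
    simpa using hX.const_mul (ε ^ 2)⁻¹
  refine tendsto_of_tendsto_of_tendsto_of_le_of_le' tendsto_const_nhds h0
    (Eventually.of_forall fun _ => measureReal_nonneg) ?_
  filter_upwards [hint] with n hn
  have h1 := mul_meas_ge_le_integral_of_nonneg (μ := P) (f := fun ω => (X n ω - c) ^ 2)
    (Eventually.of_forall fun ω => sq_nonneg _) hn (ε ^ 2)
  have h2 : P.real {ω | ε ≤ |X n ω - c|} ≤ P.real {ω | ε ^ 2 ≤ (X n ω - c) ^ 2} :=
    measureReal_mono fun ω hω => by
      simp only [mem_ofPred_eq] at hω ⊢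
      rw [← sq_abs (X n ω - c)]
      exact pow_le_pow_left₀ hε.le hω 2
  rw [le_inv_mul_iff₀ (by positivity)]
  exact le_trans (by gcongr) h1

end InProbability

/-! ### Row sums of triangular arrays with i.i.d. rows -/

section Rows

variable {Ω : Type*} [MeasurableSpace Ω] {P : Measure Ω} [IsProbabilityMeasure P]
  {E : Type*} [MeasurableSpace E] {W : ℕ → Ω → E}

/-- Independence makes the variance of the sum n times the variance of one term, and a variance is
at most the second moment. -/
theorem integral_sq_rowSum_le (hindep : iIndepFun W P)
    (hident : ∀ i, IdentDistrib (W i) (W 0) P P) {φ : E → ℝ} (hφ : Measurable φ)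
    (hL2 : MemLp (fun ω => φ (W 0 ω)) 2 P) (n : ℕ) :
    MemLp (fun ω => ∑ k ∈ Finset.range n, φ (W k ω) - n * ∫ ω, φ (W 0 ω) ∂P) 2 P ∧
    ∫ ω, (∑ k ∈ Finset.range n, φ (W k ω) - n * ∫ ω, φ (W 0 ω) ∂P) ^ 2 ∂P ≤
      n * ∫ ω, φ (W 0 ω) ^ 2 ∂P := by
  have hid : ∀ k, IdentDistrib (fun ω => φ (W k ω)) (fun ω => φ (W 0 ω)) P P :=
    fun k => (hident k).comp hφ
  have hk : ∀ k, MemLp (fun ω => φ (W k ω)) 2 P := fun k => (hid k).memLp_iff.2 hL2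
  have hsum : MemLp (fun ω => ∑ k ∈ Finset.range n, φ (W k ω)) 2 P :=
    memLp_finsetSum _ fun k _ => hk k
  refine ⟨hsum.sub (memLp_const _), ?_⟩
  have hmean : ∫ ω, ∑ k ∈ Finset.range n, φ (W k ω) ∂P = n * ∫ ω, φ (W 0 ω) ∂P := by
    rw [integral_finsetSum _ fun k _ => (hk k).integrable one_le_two]
    simp [fun k => (hid k).integral_eq]
  rw [← hmean, ← variance_eq_integral hsum.aestronglyMeasurable.aemeasurable]
  have hvar := IndepFun.variance_sum (μ := P) (s := Finset.range n)
    (X := fun k ω => φ (W k ω)) (fun k _ => hk k)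
    (fun i _ j _ hij => (hindep.indepFun hij).comp hφ hφ)
  have h2 : (∑ k ∈ Finset.range n, fun ω => φ (W k ω)) =
      fun ω => ∑ k ∈ Finset.range n, φ (W k ω) := by ext ω; simp
  rw [h2] at hvar
  rw [hvar, Finset.sum_congr rfl fun k _ => (hid k).variance_eq]
  simp only [Finset.sum_const, Finset.card_range, nsmul_eq_mul]
  gcongr
  exact variance_le_expectation_sq hL2.aestronglyMeasurable

/-- Weak law of large numbers for row means. -/
theorem tendstoInMeasure_rowMean (hindep : iIndepFun W P)
    (hident : ∀ i, IdentDistrib (W i) (W 0) P P) {φ : ℕ → E → ℝ} (hφ : ∀ n, Measurable (φ n))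
    (hL2 : ∀ᶠ n in atTop, MemLp (fun ω => φ n (W 0 ω)) 2 P) {c : ℝ}
    (hmean : Tendsto (fun n => ∫ ω, φ n (W 0 ω) ∂P) atTop (𝓝 c))
    (hvar : Tendsto (fun n : ℕ => (∫ ω, φ n (W 0 ω) ^ 2 ∂P) / n) atTop (𝓝 0)) :
    TendstoInMeasure P (fun (n : ℕ) ω => (∑ k ∈ Finset.range n, φ n (W k ω)) / n) atTop
      (fun _ => c) := by
  have key : TendstoInMeasure P (fun (n : ℕ) ω =>
      (∑ k ∈ Finset.range n, φ n (W k ω) - n * ∫ ω, φ n (W 0 ω) ∂P) / n) atTop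
      (fun _ => (0 : ℝ)) := by
    refine tendstoInMeasure_of_sq ?_ ?_
    · filter_upwards [hL2] with n hn
      simp only [sub_zero, div_pow]
      exact ((integral_sq_rowSum_le hindep hident (hφ n) hn n).1.integrable_sq).div_const _
    · refine tendsto_of_tendsto_of_tendsto_of_le_of_le' tendsto_const_nhds hvar
        (Eventually.of_forall fun _ => integral_nonneg fun ω => sq_nonneg _) ?_
      filter_upwards [hL2, eventually_gt_atTop 0] with n hn hpos
      have hpos' : (0 : ℝ) < n := by exact_mod_cast hpos
      simp only [sub_zero, div_pow]
      rw [integral_div, div_le_div_iff₀ (by positivity) hpos']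
      have := (integral_sq_rowSum_le hindep hident (hφ n) hn n).2
      nlinarith [mul_le_mul_of_nonneg_right this hpos'.le]
  have h2 := TendstoInMeasure.add_const key (tendstoInMeasure_of_tendsto_const hmean)
  rw [zero_add] at h2
  refine h2.congr' ?_ (ae_eq_refl _)
  filter_upwards [eventually_gt_atTop 0] with n hpos
  have hpos' : (n : ℝ) ≠ 0 := by positivity
  refine Eventually.of_forall fun ω => ?_
  field_simp
  ring

theorem boundedInProb_rowSum (hindep : iIndepFun W P)
    (hident : ∀ i, IdentDistrib (W i) (W 0) P P) {φ : ℕ → E → ℝ} (hφ : ∀ n, Measurable (φ n))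
    (hL2 : ∀ᶠ n in atTop, MemLp (fun ω => φ n (W 0 ω)) 2 P)
    (hmean : ∀ᶠ n in atTop, ∫ ω, φ n (W 0 ω) ∂P = 0) {C : ℝ}
    (hvar : ∀ᶠ n : ℕ in atTop, n * ∫ ω, φ n (W 0 ω) ^ 2 ∂P ≤ C) :
    BoundedInProb P (fun (n : ℕ) ω => ∑ k ∈ Finset.range n, φ n (W k ω)) := by
  refine BoundedInProb.of_sq (C := C) ?_
  filter_upwards [hL2, hmean, hvar] with n h1 h2 h3
  have := integral_sq_rowSum_le hindep hident (hφ n) h1 n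
  simp only [h2, mul_zero, sub_zero] at this
  exact ⟨this.1.integrable_sq, this.2.trans h3⟩

/-- For |x| ≤ 1 this is the Taylor estimate; for |x| > 1 the triangle inequality suffices, every
term being at most a multiple of |x|³. The constant 4 is not sharp. -/
theorem norm_cexp_I_sub_quadratic_le (x : ℝ) :
    ‖Complex.exp (x * Complex.I) - (1 + x * Complex.I - x ^ 2 / 2)‖ ≤ 4 * |x| ^ 3 := by
  have hn : ‖(x * Complex.I : ℂ)‖ = |x| := by simp
  rcases le_or_gt |x| 1 with h | h
  · have h1 := Complex.exp_bound (x := x * Complex.I) (by rw [hn]; exact h) (n := 3) (by norm_num)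
    rw [hn] at h1
    have h2 : ∑ m ∈ Finset.range 3, (x * Complex.I : ℂ) ^ m / (m.factorial : ℂ) =
        1 + x * Complex.I - x ^ 2 / 2 := by
      simp only [Finset.sum_range_succ, Finset.sum_range_zero, mul_pow, Complex.I_sq]
      norm_num [Nat.factorial]
      ring
    rw [h2] at h1
    refine h1.trans ?_
    norm_num [Nat.factorial]
    nlinarith [pow_nonneg (abs_nonneg x) 3]
  · have h1 : ‖Complex.exp (x * Complex.I)‖ = 1 := Complex.norm_exp_ofReal_mul_I x
    have h2 : ‖(1 + x * Complex.I - x ^ 2 / 2 : ℂ)‖ ≤ 1 + |x| + |x| ^ 2 / 2 := by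
      refine (norm_sub_le _ _).trans (add_le_add ((norm_add_le _ _).trans ?_) ?_)
      · simp
      · simp
    refine (norm_sub_le _ _).trans ?_
    rw [h1]
    nlinarith [pow_pos (zero_lt_one.trans h) 2, pow_pos (zero_lt_one.trans h) 3,
      mul_pos (sub_pos.2 h) (pow_pos (zero_lt_one.trans h) 2)]

/-- **Lyapunov's central limit theorem** for row sums, in terms of characteristic functions. -/
theorem tendsto_charFun_rowSum (hindep : iIndepFun W P)
    (hident : ∀ i, IdentDistrib (W i) (W 0) P P) {φ : ℕ → E → ℝ} (hφ : ∀ n, Measurable (φ n))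
    (hL4 : ∀ᶠ n in atTop, Integrable (fun ω => φ n (W 0 ω) ^ 4) P)
    (hmean : ∀ᶠ n in atTop, ∫ ω, φ n (W 0 ω) ∂P = 0) {v : ℝ}
    (hvar : Tendsto (fun n : ℕ => n * ∫ ω, φ n (W 0 ω) ^ 2 ∂P) atTop (𝓝 v))
    (hfour : Tendsto (fun n : ℕ => n * ∫ ω, φ n (W 0 ω) ^ 4 ∂P) atTop (𝓝 0)) :
    Tendsto (fun n : ℕ => charFun (P.map fun ω => ∑ k ∈ Finset.range n, φ n (W k ω)) 1) atTop
      (𝓝 (Complex.exp (-(v / 2 : ℝ)))) := by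
  have hW : ∀ k, AEMeasurable (W k) P := fun k => (hident k).aemeasurable_fst
  -- Written as (1 + a)^n, so that it suffices to find the limit of n·a.
  have hprod : ∀ n, charFun (P.map fun ω => ∑ k ∈ Finset.range n, φ n (W k ω)) 1 =
      (1 + (charFun (P.map fun ω => φ n (W 0 ω)) 1 - 1)) ^ n := by
    intro n
    have h1 : iIndepFun (fun k ω => φ n (W k ω)) P := hindep.comp (fun _ => φ n) fun _ => hφ n
    rw [iIndepFun.charFun_map_fun_finsetSum_eq_prod (s := Finset.range n)
      (X := fun k ω => φ n (W k ω)) (fun k _ => (hφ n).comp_aemeasurable (hW k)) (h1.restrict _)]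
    have h2 : ∀ k, P.map (fun ω => φ n (W k ω)) = P.map (fun ω => φ n (W 0 ω)) :=
      fun k => ((hident k).comp (hφ n)).map_eq
    simp [h2]
  simp only [hprod]
  refine Complex.tendsto_one_add_pow_exp_of_tendsto ?_
  have hlin : Tendsto (fun n : ℕ => ((-(n * ∫ ω, φ n (W 0 ω) ^ 2 ∂P) / 2 : ℝ) : ℂ)) atTop
      (𝓝 ((-(v / 2) : ℝ) : ℂ)) := by
    have h1 : Tendsto (fun n : ℕ => -(n * ∫ ω, φ n (W 0 ω) ^ 2 ∂P) / 2) atTop (𝓝 (-(v / 2))) := by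
      rw [← neg_div]
      exact hvar.neg.div_const 2
    exact (Complex.continuous_ofReal.tendsto _).comp h1
  push_cast at hlin ⊢
  refine tendsto_of_tendsto_of_dist hlin ?_
  rw [tendsto_order]
  refine ⟨fun a ha => Eventually.of_forall fun n => ha.trans_le dist_nonneg, fun η hη => ?_⟩
  -- The error will be at most 4δ·nE[φ²] + (4/δ)·nE[φ⁴]. This δ makes the first term at most η/2,
  -- and the threshold δη/8 for the fourth moments does the same for the second.
  set δ := η / (8 * (|v| + 1)) with hδ
  have hδpos : 0 < δ := by positivity
  filter_upwards [hL4, hmean, hvar.eventually (gt_mem_nhds (show v < |v| + 1 by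
    linarith [le_abs_self v])), hfour.eventually (gt_mem_nhds (show 0 < δ * η / 8 by positivity))]
    with n h4 h0 hv hf
  have hm : AEStronglyMeasurable (fun ω => φ n (W 0 ω)) P :=
    ((hφ n).comp_aemeasurable (hW 0)).aestronglyMeasurable
  have h2 : Integrable (fun ω => φ n (W 0 ω) ^ 2) P := by
    refine (h4.add (integrable_const 1)).mono' (hm.pow 2) (Eventually.of_forall fun ω => ?_)
    simp only [Real.norm_eq_abs, abs_pow, sq_abs, Pi.add_apply]
    nlinarith [sq_nonneg (φ n (W 0 ω) ^ 2 - 1)]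
  have h1 : Integrable (fun ω => φ n (W 0 ω)) P := by
    refine (h2.add (integrable_const 1)).mono' hm (Eventually.of_forall fun ω => ?_)
    simp only [Real.norm_eq_abs, Pi.add_apply]
    nlinarith [sq_nonneg (|φ n (W 0 ω)| - 1), sq_abs (φ n (W 0 ω))]
  have hexp : Integrable (fun ω => Complex.exp (φ n (W 0 ω) * Complex.I)) P := by
    refine (integrable_const (1 : ℝ)).mono' ?_ (Eventually.of_forall fun ω => ?_)
    · exact (by fun_prop : Continuous fun x : ℝ => Complex.exp (x * Complex.I)
        ).comp_aestronglyMeasurable hm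
    · rw [Complex.norm_exp_ofReal_mul_I]
  have hchar : charFun (P.map fun ω => φ n (W 0 ω)) 1 =
      ∫ ω, Complex.exp (φ n (W 0 ω) * Complex.I) ∂P := by
    rw [charFun_apply_real, integral_map hm.aemeasurable (by fun_prop)]
    simp
  have hquad : ∫ ω, (1 + φ n (W 0 ω) * Complex.I - φ n (W 0 ω) ^ 2 / 2 : ℂ) ∂P =
      1 - (∫ ω, φ n (W 0 ω) ^ 2 ∂P : ℝ) / 2 := by
    have e1 : Integrable (fun ω => (φ n (W 0 ω) : ℂ)) P := h1.ofReal
    have e2 : Integrable (fun ω => (φ n (W 0 ω) : ℂ) ^ 2) P := by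
      simpa using h2.ofReal (𝕜 := ℂ)
    have e5 : Integrable (fun ω => (1 + φ n (W 0 ω) * Complex.I : ℂ)) P :=
      (integrable_const _).add (e1.mul_const _)
    rw [integral_sub e5 (e2.div_const _),
      integral_add (integrable_const _) (e1.mul_const _), integral_mul_const, integral_div]
    have e3 : ∫ ω, (φ n (W 0 ω) : ℂ) ∂P = 0 := by
      rw [integral_complex_ofReal, h0]; simp
    have e4 : ∫ ω, (φ n (W 0 ω) : ℂ) ^ 2 ∂P = (∫ ω, φ n (W 0 ω) ^ 2 ∂P : ℝ) := by
      rw [← integral_complex_ofReal]; simp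
    rw [e3, e4]; simp
  have hquadint : Integrable (fun ω => (1 + φ n (W 0 ω) * Complex.I - φ n (W 0 ω) ^ 2 / 2 : ℂ)) P :=
    ((integrable_const _).add (h1.ofReal.mul_const _)).sub
      ((by simpa using h2.ofReal (𝕜 := ℂ) : Integrable (fun ω => (φ n (W 0 ω) : ℂ) ^ 2) P).div_const _)
  have hbd : ‖∫ ω, (Complex.exp (φ n (W 0 ω) * Complex.I) -
      (1 + φ n (W 0 ω) * Complex.I - φ n (W 0 ω) ^ 2 / 2)) ∂P‖ ≤
      4 * (δ * ∫ ω, φ n (W 0 ω) ^ 2 ∂P) + 4 * ((∫ ω, φ n (W 0 ω) ^ 4 ∂P) / δ) := by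
    rw [← integral_const_mul, ← integral_div, ← integral_const_mul, ← integral_const_mul,
      ← integral_add ((h2.const_mul _).const_mul _) ((h4.div_const _).const_mul _)]
    refine norm_integral_le_of_norm_le
      (((h2.const_mul _).const_mul _).add ((h4.div_const _).const_mul _))
      (Eventually.of_forall fun ω => (norm_cexp_I_sub_quadratic_le _).trans ?_)
    set x := φ n (W 0 ω)
    -- Trading the cube for second and fourth powers avoids third moments; the difference is a
    -- square plus a nonnegative term.
    have : |x| ^ 3 ≤ δ * x ^ 2 + x ^ 4 / δ := by
      have e : δ * x ^ 2 + x ^ 4 / δ - |x| ^ 3 = δ * (|x| - x ^ 2 / δ) ^ 2 + |x| * x ^ 2 := by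
        have : |x| ^ 3 = |x| * x ^ 2 := by rw [← sq_abs x]; ring
        rw [this, sub_sq, sq_abs]
        field_simp
        ring
      have : 0 ≤ δ * (|x| - x ^ 2 / δ) ^ 2 + |x| * x ^ 2 := by positivity
      linarith
    linarith
  rw [integral_sub hexp hquadint, hquad, ← hchar] at hbd
  rw [dist_eq_norm, ← norm_neg]
  have hident' : -(-(↑n * ((∫ ω, φ n (W 0 ω) ^ 2 ∂P : ℝ) : ℂ)) / 2 -
      ↑n * (charFun (P.map fun ω => φ n (W 0 ω)) 1 - 1)) =
      (n : ℂ) * (charFun (P.map fun ω => φ n (W 0 ω)) 1 -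
        (1 - (∫ ω, φ n (W 0 ω) ^ 2 ∂P : ℝ) / 2)) := by ring
  rw [hident', norm_mul, Complex.norm_natCast]
  calc _ ≤ (n : ℝ) * (4 * (δ * ∫ ω, φ n (W 0 ω) ^ 2 ∂P) + 4 * ((∫ ω, φ n (W 0 ω) ^ 4 ∂P) / δ)) := by
        gcongr
    _ = 4 * δ * (n * ∫ ω, φ n (W 0 ω) ^ 2 ∂P) + 4 / δ * (n * ∫ ω, φ n (W 0 ω) ^ 4 ∂P) := by
        field_simp
    _ < 4 * δ * (|v| + 1) + 4 / δ * (δ * η / 8) := by gcongr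
    _ = η := by rw [hδ]; field_simp; ring

end Rows

/-! ### Limits of kernel moments -/

section Kernel

variable {K : ℝ → ℝ} {κ : ℝ}

/-- By symmetry K is continuous on (-κ,0) as well as on (0,κ), and it vanishes outside [-κ,κ]. Only
the points 0 and ±κ are uncontrolled, and a countable set does not affect Borel measurability. -/
theorem IsRDKernel.measurable (hK : IsRDKernel K κ) : Measurable K := by
  have hneg : ContinuousOn K (Ioo (-κ) 0) := by
    have h1 : ContinuousOn (fun u => K (-u)) (Ioo (-κ) 0) :=
      hK.continuous.comp continuous_neg.continuousOn fun u hu => ⟨by linarith [hu.2], by linarith [hu.1]⟩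
    exact h1.congr fun u _ => (hK.symmetric u).symm
  have hpos : Measurable ((Ioo 0 κ).indicator K) := by
    classical
    rw [← piecewise_eq_indicator]
    exact hK.continuous.measurable_piecewise continuousOn_const measurableSet_Ioo
  have hneg' : Measurable ((Ioo (-κ) 0).indicator K) := by
    classical
    rw [← piecewise_eq_indicator]
    exact hneg.measurable_piecewise continuousOn_const measurableSet_Ioo
  refine (hpos.add hneg').measurable_of_countable_ne ?_
  refine (Set.toFinite ({0, κ, -κ} : Set ℝ)).countable.mono fun u hu => ?_
  by_contra hcon
  simp only [mem_insert_iff, mem_singleton_iff, not_or] at hcon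
  apply hu
  obtain ⟨h0, h1, h2⟩ := hcon
  have hκ := hK.pos
  simp only [Pi.add_apply, indicator_apply, mem_Ioo]
  rcases lt_or_gt_of_ne h0 with h | h
  · rcases lt_or_gt_of_ne h2 with h' | h'
    · rw [hK.support u (by rw [abs_of_neg h]; linarith)]; simp
    · simp [h, h', not_lt.2 h.le]
  · rcases lt_or_gt_of_ne h1 with h' | h'
    · simp [h, h', not_lt.2 h.le]
    · rw [hK.support u (by rw [abs_of_pos h]; linarith)]; simp

theorem IsRDKernel.continuousAt (hK : IsRDKernel K κ) {u : ℝ} (hu : 0 < u) (hne : u ≠ κ) :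
    ContinuousAt K u := by
  rcases lt_or_gt_of_ne hne with h | h
  · exact hK.continuous.continuousAt (Ioo_mem_nhds hu h)
  · refine (continuousAt_const (y := (0 : ℝ))).congr ?_
    filter_upwards [Ioi_mem_nhds h] with w hw
    exact (hK.support w (lt_of_lt_of_le hw (le_abs_self w))).symm

theorem IsRDKernel.abs_le_of_ne_zero (hK : IsRDKernel K κ) {u : ℝ} (hu : K u ≠ 0) : |u| ≤ κ :=
  not_lt.1 fun h => hu (hK.support u h)

/-- A continuous function times the kernel is bounded. -/
theorem IsRDKernel.exists_bound (hK : IsRDKernel K κ) {A : ℝ → ℝ} (hA : Continuous A) :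
    ∃ C, 0 ≤ C ∧ ∀ u, |K u * A u| ≤ C := by
  obtain ⟨M, hM⟩ := hK.bounded
  obtain ⟨D, hD⟩ := (isCompact_Icc (a := -κ) (b := κ)).exists_bound_of_continuousOn hA.continuousOn
  have hM0 : 0 ≤ M := (hK.nonneg 0).trans (hM 0)
  refine ⟨M * |D|, by positivity, fun u => ?_⟩
  by_cases hu : K u = 0
  · simp only [hu, zero_mul, abs_zero]; positivity
  · rw [abs_mul, abs_of_nonneg (hK.nonneg u)]
    have := hD u (abs_le.1 (hK.abs_le_of_ne_zero hu))
    exact mul_le_mul (hM u) (this.trans (le_abs_self D)) (abs_nonneg _) hM0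

theorem integrableOn_of_bounded_of_support {F : ℝ → ℝ} (hF : Measurable F) {C R : ℝ}
    (hC : ∀ u, |F u| ≤ C) (hR : ∀ u, R < u → F u = 0) : IntegrableOn F (Ioi 0) := by
  have h1 : IntegrableOn F (Ioc 0 R) :=
    Integrable.of_bound hF.aestronglyMeasurable C (Eventually.of_forall hC)
  refine h1.of_forall_sdiff_eq_zero measurableSet_Ioi fun u hu => hR u ?_
  by_contra hcon
  exact hu.2 ⟨hu.1, not_lt.1 hcon⟩

theorem IsRDKernel.integrableOn_mul (hK : IsRDKernel K κ) {A : ℝ → ℝ} (hA : Continuous A) :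
    IntegrableOn (fun u => K u * A u) (Ioi 0) := by
  obtain ⟨C, -, hC⟩ := hK.exists_bound hA
  exact integrableOn_of_bounded_of_support (hK.measurable.mul hA.measurable) hC
    fun u hu => by rw [hK.support u (hu.trans_le (le_abs_self u)), zero_mul]

theorem continuous_rvec (p : ℕ) (i : Fin (p + 1)) : Continuous fun u => rvec p u i := by
  unfold rvec; fun_prop

theorem dotProduct_limGram_mulVec (hK : IsRDKernel K κ) (p : ℕ) (x : Fin (p + 1) → ℝ) :
    x ⬝ᵥ (limGram K p *ᵥ x) = ∫ u in Ioi (0 : ℝ), K u * (rvec p u ⬝ᵥ x) ^ 2 := by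
  have h1 : ∀ u, K u * (rvec p u ⬝ᵥ x) ^ 2 =
      ∑ i, ∑ j, x i * ((K u * (rvec p u i * rvec p u j)) * x j) := by
    intro u
    rw [sq, dotProduct, Finset.sum_mul_sum, Finset.mul_sum]
    refine Finset.sum_congr rfl fun i _ => ?_
    rw [Finset.mul_sum]
    exact Finset.sum_congr rfl fun j _ => by ring
  have hint : ∀ i j, IntegrableOn (fun u => K u * (rvec p u i * rvec p u j)) (Ioi 0) :=
    fun i j => hK.integrableOn_mul ((continuous_rvec p i).mul (continuous_rvec p j))
  simp only [h1]
  rw [integral_finsetSum _ fun i _ => integrable_finsetSum _ fun j _ =>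
    ((hint i j).mul_const _).const_mul _]
  simp only [dotProduct, Matrix.mulVec, Finset.mul_sum]
  refine Finset.sum_congr rfl fun i _ => ?_
  rw [integral_finsetSum _ fun j _ => ((hint i j).mul_const _).const_mul _]
  refine Finset.sum_congr rfl fun j _ => ?_
  rw [integral_const_mul, integral_mul_const]
  rfl

/-- A null vector gives a polynomial whose square has zero integral against K. As K is positive on
(0,κ), the polynomial vanishes on that interval and so has only zero coefficients. -/
theorem limGram_det_ne_zero (hK : IsRDKernel K κ) (p : ℕ) : (limGram K p).det ≠ 0 := by
  intro hdet
  obtain ⟨x, hx0, hx⟩ := Matrix.exists_mulVec_eq_zero_iff.2 hdet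
  have h1 := dotProduct_limGram_mulVec hK p x
  rw [hx, dotProduct_zero] at h1
  have hcont : Continuous fun u => rvec p u ⬝ᵥ x :=
    continuous_finsetSum _ fun i _ => (continuous_rvec p i).mul continuous_const
  have h2 := (integral_eq_zero_iff_of_nonneg
    (fun u => mul_nonneg (hK.nonneg u) (sq_nonneg (rvec p u ⬝ᵥ x)))
    (hK.integrableOn_mul (hcont.pow 2))).1 h1.symm
  have h3 : ∀ᵐ u ∂(volume.restrict (Ioo 0 κ)), rvec p u ⬝ᵥ x = 0 := by
    have := ae_restrict_of_ae_restrict_of_subset (Ioo_subset_Ioi_self : Ioo 0 κ ⊆ Ioi 0) h2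
    filter_upwards [this, ae_restrict_mem measurableSet_Ioo] with u hu hu'
    simpa [(hK.positive u hu').ne'] using hu
  have h4 : EqOn (fun u => rvec p u ⬝ᵥ x) (fun _ => 0) (Ioo 0 κ) :=
    Measure.eqOn_open_of_ae_eq h3 isOpen_Ioo hcont.continuousOn continuousOn_const
  let Q : Polynomial ℝ := ∑ i : Fin (p + 1), Polynomial.C (x i) * Polynomial.X ^ (i : ℕ)
  have hQeval : ∀ u, Q.eval u = rvec p u ⬝ᵥ x := by
    intro u
    simp only [Q, Polynomial.eval_finsetSum, Polynomial.eval_mul, Polynomial.eval_C,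
      Polynomial.eval_pow, Polynomial.eval_X, dotProduct, rvec]
    exact Finset.sum_congr rfl fun i _ => mul_comm _ _
  have hQ : Q = 0 := by
    refine Polynomial.eq_zero_of_infinite_isRoot Q ((Ioo_infinite hK.pos).mono fun u hu => ?_)
    simpa [Polynomial.IsRoot, hQeval u] using h4 hu
  apply hx0
  ext i
  have h5 : Q.coeff i = x i := by
    simp only [Q, Polynomial.finsetSum_coeff, Polynomial.coeff_C_mul, Polynomial.coeff_X_pow]
    rw [Finset.sum_eq_single i]
    · simp
    · intro j _ hj
      rw [if_neg fun h => hj (Fin.ext h.symm), mul_zero]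
    · simp
  rw [← h5, hQ]; simp

theorem evec_dotProduct {p j : ℕ} (hj : j < p + 1) (x : Fin (p + 1) → ℝ) :
    evec p j ⬝ᵥ x = x ⟨j, hj⟩ := by
  simp only [dotProduct, evec]
  rw [Finset.sum_eq_single ⟨j, hj⟩]
  · simp
  · intro i _ hi
    rw [if_neg fun h => hi (Fin.ext h), zero_mul]
  · simp

theorem equivKernel_eq {p j : ℕ} (hj : j < p + 1) (u : ℝ) :
    equivKernel K p j u = K u * ∑ i, (limGram K p)⁻¹ ⟨j, hj⟩ i * u ^ (i : ℕ) := by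
  rw [equivKernel, evec_dotProduct hj]; rfl

/-- Since the zeroth entry of r_p(u) is 1, the integral is the entry (j,0) of Γ⁻¹Γ = I. -/
theorem integral_equivKernel (hK : IsRDKernel K κ) {p j : ℕ} (hj : j < p + 1) :
    ∫ u in Ioi (0 : ℝ), equivKernel K p j u = if j = 0 then 1 else 0 := by
  have h0 : 0 < p + 1 := Nat.succ_pos p
  have h1 : ∀ u, equivKernel K p j u =
      ∑ i, (limGram K p)⁻¹ ⟨j, hj⟩ i * (K u * (rvec p u i * rvec p u ⟨0, h0⟩)) := by
    intro u
    rw [equivKernel_eq hj, Finset.mul_sum]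
    refine Finset.sum_congr rfl fun i _ => ?_
    simp only [rvec, pow_zero, mul_one]; ring
  simp only [h1]
  have hint : ∀ i, IntegrableOn (fun u => (limGram K p)⁻¹ ⟨j, hj⟩ i *
      (K u * (rvec p u i * rvec p u ⟨0, h0⟩))) (Ioi 0) := fun i =>
    (hK.integrableOn_mul ((continuous_rvec p i).mul (continuous_rvec p ⟨0, h0⟩))).const_mul _
  rw [integral_finsetSum _ fun i _ => hint i]
  simp only [integral_const_mul]
  have h2 : ((limGram K p)⁻¹ * limGram K p) ⟨j, hj⟩ ⟨0, h0⟩ = if j = 0 then 1 else 0 := by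
    rw [Matrix.nonsing_inv_mul _ (isUnit_iff_ne_zero.2 (limGram_det_ne_zero hK p)),
      Matrix.one_apply]
    simp [Fin.ext_iff]
  rw [← h2, Matrix.mul_apply]
  rfl

theorem measurable_equivKernel (hK : IsRDKernel K κ) (p j : ℕ) :
    Measurable (equivKernel K p j) := by
  have : Continuous fun u => evec p j ⬝ᵥ ((limGram K p)⁻¹ *ᵥ rvec p u) := by
    simp only [dotProduct, Matrix.mulVec]
    exact continuous_finsetSum _ fun i _ => continuous_const.mul
      (continuous_finsetSum _ fun l _ => continuous_const.mul (continuous_rvec p l))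
  exact hK.measurable.mul this.measurable

theorem exists_bound_equivKernel (hK : IsRDKernel K κ) (p j : ℕ) :
    ∃ C, 0 ≤ C ∧ ∀ u, |equivKernel K p j u| ≤ C := by
  refine hK.exists_bound (A := fun u => evec p j ⬝ᵥ ((limGram K p)⁻¹ *ᵥ rvec p u)) ?_
  simp only [dotProduct, Matrix.mulVec]
  exact continuous_finsetSum _ fun i _ => continuous_const.mul
      (continuous_finsetSum _ fun l _ => continuous_const.mul (continuous_rvec p l))

theorem equivKernel_eq_zero (hK : IsRDKernel K κ) (p j : ℕ) {u : ℝ} (hu : κ < |u|) :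
    equivKernel K p j u = 0 := by rw [equivKernel, hK.support u hu, zero_mul]

theorem continuousAt_equivKernel (hK : IsRDKernel K κ) (p j : ℕ) {u : ℝ} (hu : 0 < u)
    (hne : u ≠ κ) : ContinuousAt (equivKernel K p j) u := by
  have : Continuous fun u => evec p j ⬝ᵥ ((limGram K p)⁻¹ *ᵥ rvec p u) := by
    simp only [dotProduct, Matrix.mulVec]
    exact continuous_finsetSum _ fun i _ => continuous_const.mul
      (continuous_finsetSum _ fun l _ => continuous_const.mul (continuous_rvec p l))
  exact (hK.continuousAt hu hne).mul this.continuousAt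

theorem measurable_bcKernel (hK : IsRDKernel K κ) (p q : ℕ) (ρ : ℝ) :
    Measurable (bcKernel K p q ρ) :=
  (measurable_equivKernel hK p 0).sub
    (((measurable_equivKernel hK q (p + 1)).comp (measurable_const_mul ρ)).const_mul _)

theorem exists_bound_bcKernel (hK : IsRDKernel K κ) (p q : ℕ) (R : ℝ) :
    ∃ C, 0 ≤ C ∧ ∀ ρ, 0 ≤ ρ → ρ ≤ R → ∀ u, |bcKernel K p q ρ u| ≤ C := by
  obtain ⟨C, hC0, hC⟩ := exists_bound_equivKernel hK p 0
  obtain ⟨D, hD0, hD⟩ := exists_bound_equivKernel hK q (p + 1)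
  refine ⟨C + |R| ^ (p + 2) * |limBiasFactor K p (p + 1)| * D, by positivity,
    fun ρ hρ hR u => (abs_sub _ _).trans (add_le_add (hC u) ?_)⟩
  rw [abs_mul, abs_mul, abs_pow, abs_of_nonneg hρ]
  gcongr
  · exact hR.trans (le_abs_self R)
  · exact hD _

/-- The second part of the kernel lives on |u| ≤ κ/ρ, which is unbounded as ρ → 0, so no fixed
compact support is available. Its factor ρ^(p+2) compensates: ρ^(2p+4) u² = ρ^(2p+2) (ρu)² ≤
ρ^(2p+2) κ² there. This yields an integrable majorant that is uniform in ρ. -/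
theorem exists_bound_sq_bcKernel (hK : IsRDKernel K κ) (p q : ℕ) (R : ℝ) :
    ∃ C, 0 ≤ C ∧ ∀ ρ, 0 ≤ ρ → ρ ≤ R → ∀ u, bcKernel K p q ρ u ^ 2 ≤ C * (1 + u ^ 2)⁻¹ := by
  obtain ⟨C, hC0, hC⟩ := exists_bound_equivKernel hK p 0
  obtain ⟨D, hD0, hD⟩ := exists_bound_equivKernel hK q (p + 1)
  set B := limBiasFactor K p (p + 1) with hB
  have hκ := hK.pos
  refine ⟨2 * (C ^ 2 * (1 + κ ^ 2)) +
    2 * (B ^ 2 * D ^ 2 * (|R| ^ (2 * p + 4) + |R| ^ (2 * p + 2) * κ ^ 2)), by positivity,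
    fun ρ hρ hR u => ?_⟩
  rw [← div_eq_mul_inv, le_div_iff₀ (by positivity)]
  have hR' : ρ ≤ |R| := hR.trans (le_abs_self R)
  set x := equivKernel K p 0 u with hx
  set y := ρ ^ (p + 2) * B * equivKernel K q (p + 1) (ρ * u) with hy
  have h1 : x ^ 2 * (1 + u ^ 2) ≤ C ^ 2 * (1 + κ ^ 2) := by
    rcases le_or_gt |u| κ with h | h
    · have e1 : x ^ 2 ≤ C ^ 2 := sq_le_sq' (abs_le.1 (hC u)).1 (abs_le.1 (hC u)).2
      have e2 : u ^ 2 ≤ κ ^ 2 := sq_le_sq' (abs_le.1 h).1 (abs_le.1 h).2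
      gcongr
    · rw [hx, equivKernel_eq_zero hK p 0 h]; simp only [ne_eq, OfNat.ofNat_ne_zero, not_false_eq_true, zero_pow, zero_mul]; positivity
  have h2 : y ^ 2 * (1 + u ^ 2) ≤
      B ^ 2 * D ^ 2 * (|R| ^ (2 * p + 4) + |R| ^ (2 * p + 2) * κ ^ 2) := by
    rcases le_or_gt |ρ * u| κ with h | h
    · have e1 : equivKernel K q (p + 1) (ρ * u) ^ 2 ≤ D ^ 2 :=
        sq_le_sq' (abs_le.1 (hD _)).1 (abs_le.1 (hD _)).2
      have e2 : (ρ * u) ^ 2 ≤ κ ^ 2 := sq_le_sq' (abs_le.1 h).1 (abs_le.1 h).2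
      calc y ^ 2 * (1 + u ^ 2) = B ^ 2 * equivKernel K q (p + 1) (ρ * u) ^ 2 *
            (ρ ^ (2 * p + 4) + ρ ^ (2 * p + 2) * (ρ * u) ^ 2) := by rw [hy]; ring
        _ ≤ _ := by gcongr
    · rw [hy, equivKernel_eq_zero hK q (p + 1) h]
      simp only [mul_zero, ne_eq, OfNat.ofNat_ne_zero, not_false_eq_true, zero_pow, zero_mul]
      positivity
  have h3 : bcKernel K p q ρ u = x - y := rfl
  rw [h3]
  have h4 : (x - y) ^ 2 * (1 + u ^ 2) ≤ 2 * (x ^ 2 * (1 + u ^ 2)) + 2 * (y ^ 2 * (1 + u ^ 2)) := by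
    nlinarith [sq_nonneg ((x + y)), mul_nonneg (sq_nonneg (x + y)) (by positivity : 0 ≤ 1 + u ^ 2)]
  linarith

theorem integrable_sq_bcKernel (hK : IsRDKernel K κ) (p q : ℕ) {ρ : ℝ} (hρ : 0 ≤ ρ) :
    Integrable (fun u => bcKernel K p q ρ u ^ 2) := by
  obtain ⟨C, -, hC⟩ := exists_bound_sq_bcKernel hK p q ρ
  refine (integrable_inv_one_add_sq.const_mul C).mono'
    ((measurable_bcKernel hK p q ρ).pow_const 2).aestronglyMeasurable
    (Eventually.of_forall fun u => ?_)
  rw [Real.norm_eq_abs, abs_of_nonneg (sq_nonneg _)]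
  exact hC ρ hρ le_rfl u

theorem bcKernel_eq_zero (hK : IsRDKernel K κ) (p q : ℕ) {ρ u : ℝ} (h1 : κ < |u|)
    (h2 : κ < |ρ * u|) : bcKernel K p q ρ u = 0 := by
  rw [bcKernel, equivKernel_eq_zero hK _ _ h1, equivKernel_eq_zero hK _ _ h2]; simp

/-- The equivalent kernel of the bias-corrected estimator integrates to one. -/
theorem integral_bcKernel (hK : IsRDKernel K κ) {p q : ℕ} (hpq : p < q) {ρ : ℝ} (hρ : 0 ≤ ρ) :
    ∫ u in Ioi (0 : ℝ), bcKernel K p q ρ u = 1 := by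
  have hint : ∀ r j, IntegrableOn (equivKernel K r j) (Ioi 0) := fun r j => by
    obtain ⟨C, -, hC⟩ := exists_bound_equivKernel hK r j
    exact integrableOn_of_bounded_of_support (measurable_equivKernel hK r j) hC
      fun u hu => equivKernel_eq_zero hK r j (hu.trans_le (le_abs_self u))
  have h1 := integral_equivKernel hK (p := p) (j := 0) (Nat.succ_pos p)
  rcases hρ.eq_or_lt with h | h
  · have : bcKernel K p q ρ = equivKernel K p 0 := by
      ext u; simp [bcKernel, ← h]
    rw [this, h1, if_pos rfl]
  · have h2 : ∫ u in Ioi (0 : ℝ), equivKernel K q (p + 1) (ρ * u) = 0 := by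
      rw [integral_comp_mul_left_Ioi _ _ h, mul_zero,
        integral_equivKernel hK (by omega : p + 1 < q + 1)]
      simp
    have h3 : IntegrableOn (fun u => equivKernel K q (p + 1) (ρ * u)) (Ioi 0) := by
      rw [integrableOn_Ioi_comp_mul_left_iff _ _ h, mul_zero]
      exact hint _ _
    simp only [bcKernel]
    rw [integral_sub (hint _ _) (h3.const_mul _), integral_const_mul, h2, h1]
    simp

/-- A kernel with integral one cannot vanish almost everywhere. This is what makes the limiting
variance nondegenerate. -/
theorem integral_sq_bcKernel_pos (hK : IsRDKernel K κ) {p q : ℕ} (hpq : p < q) {ρ : ℝ}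
    (hρ : 0 ≤ ρ) : 0 < ∫ u in Ioi (0 : ℝ), bcKernel K p q ρ u ^ 2 := by
  refine lt_of_le_of_ne (integral_nonneg fun u => sq_nonneg _) fun h => ?_
  have h1 := (integral_eq_zero_iff_of_nonneg (fun u => sq_nonneg (bcKernel K p q ρ u))
    (integrable_sq_bcKernel hK p q hρ).integrableOn).1 h.symm
  have h2 := integral_bcKernel hK hpq hρ
  rw [integral_congr_ae (g := fun _ => (0 : ℝ))] at h2
  · simp at h2
  · filter_upwards [h1] with u hu
    simpa using hu

/-- For ρ > 0 the kernel may jump only where ρu = κ, a null set. For ρ = 0 the argument tends to 0,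
where K need not be continuous, but the prefactor tends to 0 and the kernel is bounded. -/
theorem tendsto_bcKernel (hK : IsRDKernel K κ) (p q : ℕ) {r : ℕ → ℝ} {ρ : ℝ} (hr0 : ∀ n, 0 ≤ r n)
    (hr : Tendsto r atTop (𝓝 ρ)) :
    ∀ᵐ u ∂(volume.restrict (Ioi (0 : ℝ))),
      Tendsto (fun n => bcKernel K p q (r n) u) atTop (𝓝 (bcKernel K p q ρ u)) := by
  have hρ : 0 ≤ ρ := ge_of_tendsto' hr hr0
  have hne : ∀ᵐ u : ℝ, u ≠ κ / ρ := by simp [ae_iff, measure_singleton]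
  filter_upwards [ae_restrict_of_ae hne, ae_restrict_mem measurableSet_Ioi] with u hu hpos
  refine tendsto_const_nhds.sub ?_
  rcases hρ.eq_or_lt with h | h
  · obtain ⟨D, hD0, hD⟩ := exists_bound_equivKernel hK q (p + 1)
    rw [← h, zero_pow (by omega), zero_mul, zero_mul]
    have h1 : Tendsto (fun n => r n ^ (p + 2) * limBiasFactor K p (p + 1)) atTop (𝓝 0) := by
      have := (hr.pow (p + 2)).mul_const (limBiasFactor K p (p + 1))
      rwa [← h, zero_pow (by omega), zero_mul] at this
    exact h1.zero_mul_isBoundedUnder_le (isBoundedUnder_of ⟨D, fun n => hD _⟩)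
  · refine ((hr.pow _).mul_const _).mul ?_
    have hc : ContinuousAt (equivKernel K q (p + 1)) (ρ * u) := by
      refine continuousAt_equivKernel hK _ _ (mul_pos h hpos) fun hcon => hu ?_
      rw [eq_div_iff h.ne', mul_comm, hcon]
    exact hc.tendsto.comp (hr.mul_const u)

theorem integral_indicator_scaled {s : Set ℝ} (hs : Ioi 0 ⊆ s) (hs' : s ⊆ Ici 0)
    (hsm : MeasurableSet s) {h : ℝ} (hh : 0 < h) (Ψ F : ℝ → ℝ) :
    ∫ z, s.indicator (fun z => Ψ (z / h)) z * F z =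
      h * ∫ u in Ioi (0 : ℝ), Ψ u * F (h * u) := by
  have h1 : s =ᵐ[volume] Ioi (0 : ℝ) := by
    have h2 : Ici (0 : ℝ) =ᵐ[volume] Ioi (0 : ℝ) := Ioi_ae_eq_Ici.symm
    exact (hs'.eventuallyLE.trans h2.le).antisymm hs.eventuallyLE
  have h3 : ∀ z, s.indicator (fun z => Ψ (z / h)) z * F z =
      s.indicator (fun z => Ψ (z / h) * F z) z := fun z => by
    by_cases hz : z ∈ s <;> simp [hz]
  simp only [h3]
  rw [integral_indicator hsm, setIntegral_congr_set h1]
  have h4 := integral_comp_mul_left_Ioi' (fun z => Ψ (z / h) * F z) 0 hh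
  rw [mul_zero] at h4
  rw [← h4, smul_eq_mul]
  congr 1
  refine integral_congr_ae (Eventually.of_forall fun u => ?_)
  simp only
  rw [mul_div_cancel_left₀ _ hh.ne']

/-- Dominated convergence. The profile may vary with n because the ratio h/b enters the equivalent
kernel. -/
theorem tendsto_integral_scaled {h : ℕ → ℝ} (hh : Tendsto h atTop (𝓝 0)) {F : ℝ → ℝ}
    (hFm : Measurable F) {M : ℝ} (hFb : ∀ z, |F z| ≤ M) (hFc : ContinuousAt F 0)
    {Ψ : ℕ → ℝ → ℝ} {Ψ₀ bound : ℝ → ℝ} (hΨm : ∀ n, Measurable (Ψ n))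
    (hbound : IntegrableOn bound (Ioi 0)) (hΨb : ∀ᶠ n in atTop, ∀ u, |Ψ n u| ≤ bound u)
    (hΨ : ∀ᵐ u ∂(volume.restrict (Ioi (0 : ℝ))), Tendsto (fun n => Ψ n u) atTop (𝓝 (Ψ₀ u))) :
    Tendsto (fun n => ∫ u in Ioi (0 : ℝ), Ψ n u * F (h n * u)) atTop
      (𝓝 (F 0 * ∫ u in Ioi (0 : ℝ), Ψ₀ u)) := by
  rw [← integral_const_mul]
  refine tendsto_integral_filter_of_dominated_convergence (fun u => bound u * M) ?_ ?_
    (hbound.mul_const M) ?_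
  · exact Eventually.of_forall fun n =>
      ((hΨm n).mul (hFm.comp (measurable_const_mul _))).aestronglyMeasurable
  · filter_upwards [hΨb] with n hn
    refine Eventually.of_forall fun u => ?_
    rw [Real.norm_eq_abs, abs_mul]
    exact mul_le_mul (hn u) (hFb _) (abs_nonneg _) ((abs_nonneg _).trans (hn u))
  · filter_upwards [hΨ] with u hu
    rw [mul_comm (F 0)]
    refine hu.mul ?_
    have : Tendsto (fun n => h n * u) atTop (𝓝 0) := by simpa using hh.mul_const u
    exact hFc.tendsto.comp this

end Kernel

/-! ### Algebra of local polynomial estimators -/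

section Algebra

variable {s : Set ℝ} {K : ℝ → ℝ} {p q n : ℕ} {h b : ℝ}

theorem wmoment_add (z x y : ℕ → ℝ) :
    wmoment s K p h n z (fun k => x k + y k) = wmoment s K p h n z x + wmoment s K p h n z y := by
  ext i
  simp only [wmoment, Pi.add_apply, ← add_div, ← Finset.sum_add_distrib]
  congr 1
  exact Finset.sum_congr rfl fun k _ => by ring

theorem wmoment_const_mul (c : ℝ) (z x : ℕ → ℝ) :
    wmoment s K p h n z (fun k => c * x k) = c • wmoment s K p h n z x := by
  ext i
  simp only [wmoment, Pi.smul_apply, smul_eq_mul, ← mul_div_assoc, Finset.mul_sum]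
  congr 1
  exact Finset.sum_congr rfl fun k _ => by ring

theorem wmoment_poly (hh : h ≠ 0) (z : ℕ → ℝ) (c : ℕ → ℝ) :
    wmoment s K p h n z (fun k => ∑ j ∈ Finset.range (p + 1), c j * z k ^ j) =
      gram s K p h n z *ᵥ fun j => c j * h ^ (j : ℕ) := by
  ext i
  simp only [wmoment, Matrix.mulVec, dotProduct, gram, Matrix.of_apply, div_mul_eq_mul_div,
    ← Finset.sum_div]
  congr 1
  simp only [Finset.sum_mul]
  rw [Finset.sum_comm]
  refine Finset.sum_congr rfl fun k _ => ?_
  rw [← Fin.sum_univ_eq_sum_range (fun j => c j * z k ^ j), Finset.mul_sum, Finset.mul_sum]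
  refine Finset.sum_congr rfl fun j _ => ?_
  simp only [rvec, div_pow]
  field_simp

/-- A local polynomial fit of degree `p` reproduces polynomials of degree `p`. -/
theorem localPolyCoef_poly_add (hh : h ≠ 0) (z : ℕ → ℝ) (c : ℕ → ℝ) (e : ℕ → ℝ)
    (hdet : IsUnit (gram s K p h n z).det) (i : Fin (p + 1)) :
    localPolyCoef s K p h n z
      (fun k => (∑ j ∈ Finset.range (p + 1), c j * z k ^ j) + e k) i =
      c i + h⁻¹ ^ (i : ℕ) * ((gram s K p h n z)⁻¹ *ᵥ wmoment s K p h n z e) i := by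
  rw [localPolyCoef, wmoment_add, wmoment_poly hh, Matrix.mulVec_add, Matrix.mulVec_mulVec,
    Matrix.nonsing_inv_mul _ hdet, Matrix.one_mulVec, Pi.add_apply, mul_add]
  congr 1
  rw [mul_left_comm, ← mul_pow, inv_mul_cancel₀ hh, one_pow, mul_one]

/-- Error decomposition of the bias-corrected estimator when the outcomes are `g k + e k`. -/
theorem bcEst_sub_eq (hpq : p < q) (hh : h ≠ 0) (hb : b ≠ 0) (z : ℕ → ℝ) (c g e : ℕ → ℝ)
    (hdetp : IsUnit (gram s K p h n z).det) (hdetq : IsUnit (gram s K q b n z).det) :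
    bcEst s K p q h b n z (fun k => g k + e k) - c 0 =
      ((gram s K p h n z)⁻¹ *ᵥ wmoment s K p h n z
        (fun k => g k - ∑ j ∈ Finset.range (p + 2), c j * z k ^ j)) ⟨0, Nat.succ_pos p⟩ +
      ((gram s K p h n z)⁻¹ *ᵥ wmoment s K p h n z e) ⟨0, Nat.succ_pos p⟩ -
      (h / b) ^ (p + 1) * biasFactor s K p (p + 1) h n z *
        (((gram s K q b n z)⁻¹ *ᵥ wmoment s K q b n z
          (fun k => g k - ∑ j ∈ Finset.range (q + 1), c j * z k ^ j)) ⟨p + 1, by omega⟩ +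
        ((gram s K q b n z)⁻¹ *ᵥ wmoment s K q b n z e) ⟨p + 1, by omega⟩) := by
  -- The monomial of degree p+1 is separated and written in z/h: its order-p fit at the cutoff is
  -- then c_(p+1) h^(p+1) times the bias factor, exactly what the correction estimates.
  have hp : (fun k => g k + e k) = fun k => (∑ j ∈ Finset.range (p + 1), c j * z k ^ j) +
      ((c (p + 1) * h ^ (p + 1)) * (z k / h) ^ (p + 1) +
        ((g k - ∑ j ∈ Finset.range (p + 2), c j * z k ^ j) + e k)) := by
    ext k
    rw [Finset.sum_range_succ _ (p + 1), div_pow]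
    field_simp
    ring
  have hq : (fun k => g k + e k) = fun k => (∑ j ∈ Finset.range (q + 1), c j * z k ^ j) +
      ((g k - ∑ j ∈ Finset.range (q + 1), c j * z k ^ j) + e k) := by
    ext k; ring
  have h1 : localPolyEst s K 0 p h n z (fun k => g k + e k) = c 0 +
      (c (p + 1) * h ^ (p + 1) * biasFactor s K p (p + 1) h n z +
      (((gram s K p h n z)⁻¹ *ᵥ wmoment s K p h n z
        (fun k => g k - ∑ j ∈ Finset.range (p + 2), c j * z k ^ j)) ⟨0, Nat.succ_pos p⟩ +
      ((gram s K p h n z)⁻¹ *ᵥ wmoment s K p h n z e) ⟨0, Nat.succ_pos p⟩)) := by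
    rw [localPolyEst, evec_dotProduct (Nat.succ_pos p), hp, localPolyCoef_poly_add hh _ _ _ hdetp,
      wmoment_add, wmoment_const_mul, wmoment_add, Matrix.mulVec_add, Matrix.mulVec_add,
      Matrix.mulVec_smul, biasFactor, evec_dotProduct (Nat.succ_pos p)]
    simp
  have h2 : localPolyEst s K (p + 1) q b n z (fun k => g k + e k) / (p + 1).factorial =
      c (p + 1) + b⁻¹ ^ (p + 1) * (((gram s K q b n z)⁻¹ *ᵥ wmoment s K q b n z
          (fun k => g k - ∑ j ∈ Finset.range (q + 1), c j * z k ^ j)) ⟨p + 1, by omega⟩ +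
        ((gram s K q b n z)⁻¹ *ᵥ wmoment s K q b n z e) ⟨p + 1, by omega⟩) := by
    rw [localPolyEst, evec_dotProduct (by omega : p + 1 < q + 1), hq,
      localPolyCoef_poly_add hb _ _ _ hdetq, wmoment_add, Matrix.mulVec_add]
    have : ((p + 1).factorial : ℝ) ≠ 0 := by exact_mod_cast Nat.factorial_ne_zero _
    rw [mul_div_cancel_left₀ _ this]
    rfl
  rw [bcEst, h1, h2, div_pow, inv_pow]
  field_simp
  ring

/-- Diagonal matrix of the signs `(-1)^i`. -/
def signMatrix (p : ℕ) : Matrix (Fin (p + 1)) (Fin (p + 1)) ℝ :=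
  Matrix.diagonal fun i => (-1) ^ (i : ℕ)

theorem signMatrix_mul_self (p : ℕ) : signMatrix p * signMatrix p = 1 := by
  rw [signMatrix, Matrix.diagonal_mul_diagonal, ← Matrix.diagonal_one]
  congr 1
  ext i
  rw [← mul_pow]; norm_num

theorem signMatrix_inv (p : ℕ) : (signMatrix p)⁻¹ = signMatrix p :=
  Matrix.inv_eq_right_inv (signMatrix_mul_self p)

theorem signMatrix_mulVec (p : ℕ) (x : Fin (p + 1) → ℝ) :
    signMatrix p *ᵥ x = fun i : Fin (p + 1) => (-1) ^ (i : ℕ) * x i := by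
  ext i
  rw [signMatrix, Matrix.mulVec_diagonal]

/-- The reflection of the open left half-line is the open right one. -/
theorem weight_Iio_neg (K : ℝ → ℝ) (hK : ∀ u, K (-u) = K u) (h u : ℝ) :
    weight (Iio 0) K h u = weight (Ioi 0) K h (-u) := by
  simp only [weight, indicator_apply, mem_Iio, mem_Ioi, Left.neg_pos_iff, neg_div, hK]

theorem rvec_neg (p : ℕ) (u : ℝ) (i : Fin (p + 1)) :
    rvec p u i = (-1) ^ (i : ℕ) * rvec p (-u) i := by
  rw [rvec, rvec, ← mul_pow]; simp

theorem wmoment_Iio (hK : ∀ u, K (-u) = K u) (z x : ℕ → ℝ) :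
    wmoment (Iio 0) K p h n z x =
      signMatrix p *ᵥ wmoment (Ioi 0) K p h n (fun k => -z k) x := by
  rw [signMatrix_mulVec]
  ext i
  simp only [wmoment, ← mul_div_assoc, Finset.mul_sum]
  congr 1
  refine Finset.sum_congr rfl fun k _ => ?_
  rw [weight_Iio_neg K hK, rvec_neg, neg_div]
  ring

theorem gram_Iio (hK : ∀ u, K (-u) = K u) (z : ℕ → ℝ) :
    gram (Iio 0) K p h n z =
      signMatrix p * gram (Ioi 0) K p h n (fun k => -z k) * signMatrix p := by
  ext i j
  rw [signMatrix, Matrix.mul_diagonal, Matrix.diagonal_mul]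
  simp only [gram, Matrix.of_apply, ← mul_div_assoc, div_mul_eq_mul_div, Finset.mul_sum,
    Finset.sum_mul]
  congr 1
  refine Finset.sum_congr rfl fun k _ => ?_
  rw [weight_Iio_neg K hK, rvec_neg p (z k / h) i, rvec_neg p (z k / h) j, neg_div]
  ring

/-- Reflection conjugates the Gram matrix by the sign matrix S and multiplies the moment by S, and
(SΓS)⁻¹S = SΓ⁻¹. No invertibility of Γ is needed. -/
theorem gram_inv_mulVec_wmoment_Iio (hK : ∀ u, K (-u) = K u) (z x : ℕ → ℝ) :
    (gram (Iio 0) K p h n z)⁻¹ *ᵥ wmoment (Iio 0) K p h n z x =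
      signMatrix p *ᵥ ((gram (Ioi 0) K p h n (fun k => -z k))⁻¹ *ᵥ
        wmoment (Ioi 0) K p h n (fun k => -z k) x) := by
  rw [gram_Iio hK, wmoment_Iio hK, Matrix.mul_inv_rev, Matrix.mul_inv_rev, signMatrix_inv,
    Matrix.mulVec_mulVec, Matrix.mulVec_mulVec]
  congr 1
  rw [Matrix.mul_assoc, Matrix.mul_assoc, signMatrix_mul_self, Matrix.mul_one]

/-- The estimator on the left of the cutoff is the one on the right for the reflected data. -/
theorem bcEst_Iio (hK : ∀ u, K (-u) = K u) (hpq : p < q) (z y : ℕ → ℝ) :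
    bcEst (Iio 0) K p q h b n z y = bcEst (Ioi 0) K p q h b n (fun k => -z k) y := by
  have hest : ∀ {r ν : ℕ} {a : ℝ}, ν < r + 1 → localPolyEst (Iio 0) K ν r a n z y =
      (-1) ^ ν * localPolyEst (Ioi 0) K ν r a n (fun k => -z k) y := by
    intro r ν a hν
    rw [localPolyEst, localPolyEst, evec_dotProduct hν, evec_dotProduct hν, localPolyCoef,
      localPolyCoef, gram_inv_mulVec_wmoment_Iio hK, signMatrix_mulVec]
    ring
  have hbias : biasFactor (Iio 0) K p (p + 1) h n z =
      (-1) ^ (p + 1) * biasFactor (Ioi 0) K p (p + 1) h n (fun k => -z k) := by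
    have hx : (fun k => (z k / h) ^ (p + 1)) =
        fun k => (-1) ^ (p + 1) * (-z k / h) ^ (p + 1) := by
      ext k
      rw [← mul_pow]; ring
    rw [biasFactor, biasFactor, gram_inv_mulVec_wmoment_Iio hK, signMatrix_mulVec,
      evec_dotProduct (Nat.succ_pos p), evec_dotProduct (Nat.succ_pos p), hx, wmoment_const_mul,
      Matrix.mulVec_smul]
    simp
  -- The derivative of order p+1 and the bias factor each change sign by (-1)^(p+1), so their
  -- product is invariant under reflection.
  have hsign : ((-1 : ℝ) ^ (p + 1)) * (-1) ^ (p + 1) = 1 := by rw [← mul_pow]; simp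
  rw [bcEst, bcEst, hest (Nat.succ_pos p), hest (by omega : p + 1 < q + 1), hbias]
  linear_combination (-h ^ (p + 1) * (localPolyEst (Ioi 0) K (p + 1) q b n (fun k => -z k) y /
    (p + 1).factorial) * biasFactor (Ioi 0) K p (p + 1) h n (fun k => -z k)) * hsign

end Algebra

/-! ### Measurability of the estimators -/

section Measurability

variable {Ω : Type*} [MeasurableSpace Ω] {s : Set ℝ} {K : ℝ → ℝ}

theorem measurable_weight (hs : MeasurableSet s) (hK : Measurable K) (h : ℝ) :
    Measurable (weight s K h) :=
  ((hK.comp (measurable_id.div_const h)).div_const h).indicator hs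

theorem measurable_wmoment (hs : MeasurableSet s) (hK : Measurable K) (p : ℕ) (h : ℝ) (n : ℕ)
    {Z X : ℕ → Ω → ℝ} (hZ : ∀ k, Measurable (Z k)) (hX : ∀ k, Measurable (X k))
    (i : Fin (p + 1)) :
    Measurable fun ω => wmoment s K p h n (fun k => Z k ω) (fun k => X k ω) i := by
  unfold wmoment
  refine Measurable.div_const (Finset.measurable_fun_sum _ fun k _ => ?_) _
  exact ((measurable_weight hs hK h).comp (hZ k)).mul
    (((continuous_rvec p i).measurable.comp ((hZ k).div_const h)).mul (hX k))

theorem measurable_gram (hs : MeasurableSet s) (hK : Measurable K) (p : ℕ) (h : ℝ) (n : ℕ)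
    {Z : ℕ → Ω → ℝ} (hZ : ∀ k, Measurable (Z k)) (i j : Fin (p + 1)) :
    Measurable fun ω => gram s K p h n (fun k => Z k ω) i j :=
  measurable_wmoment hs hK p h n hZ
    (fun k => (continuous_rvec p j).measurable.comp ((hZ k).div_const h)) i

theorem matrix_inv_apply {m : ℕ} (A : Matrix (Fin m) (Fin m) ℝ) (i j : Fin m) :
    A⁻¹ i j = A.det⁻¹ * A.adjugate i j := by
  rw [Matrix.inv_def, Ring.inverse_eq_inv']; rfl

/-- Cramer's formula with the convention 0⁻¹ = 0 for the determinant also covers singular matrices,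
so measurability holds on the whole space. -/
theorem measurable_matrix_inv_apply {m : ℕ} {A : Ω → Matrix (Fin m) (Fin m) ℝ}
    (hA : ∀ i j, Measurable fun ω => A ω i j) (i j : Fin m) :
    Measurable fun ω => (A ω)⁻¹ i j := by
  have hA' : Measurable fun ω => (fun i j => A ω i j : Fin m → Fin m → ℝ) :=
    measurable_pi_lambda _ fun i => measurable_pi_lambda _ fun j => hA i j
  have h1 : Continuous fun B : Fin m → Fin m → ℝ => (Matrix.of B).det :=
    Continuous.matrix_det continuous_id
  have h2 : Continuous fun B : Fin m → Fin m → ℝ => (Matrix.of B).adjugate i j :=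
    (Continuous.matrix_adjugate continuous_id).matrix_elem i j
  simp only [matrix_inv_apply]
  exact (h1.measurable.comp hA').inv.mul (h2.measurable.comp hA')

theorem measurable_gram_inv_mulVec (hs : MeasurableSet s) (hK : Measurable K) (p : ℕ) (h : ℝ)
    (n : ℕ) {Z X : ℕ → Ω → ℝ} (hZ : ∀ k, Measurable (Z k)) (hX : ∀ k, Measurable (X k))
    (i : Fin (p + 1)) :
    Measurable fun ω => ((gram s K p h n (fun k => Z k ω))⁻¹ *ᵥ
      wmoment s K p h n (fun k => Z k ω) (fun k => X k ω)) i := by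
  simp only [Matrix.mulVec, dotProduct]
  exact Finset.measurable_fun_sum _ fun j _ =>
    (measurable_matrix_inv_apply (measurable_gram hs hK p h n hZ) i j).mul
      (measurable_wmoment hs hK p h n hZ hX j)

theorem measurable_bcEst (hs : MeasurableSet s) (hK : Measurable K) {p q : ℕ}
    (hpq : p < q) (h b : ℝ) (n : ℕ) {Z Y : ℕ → Ω → ℝ} (hZ : ∀ k, Measurable (Z k))
    (hY : ∀ k, Measurable (Y k)) :
    Measurable fun ω => bcEst s K p q h b n (fun k => Z k ω) (fun k => Y k ω) := by
  have h1 : ∀ {r ν : ℕ} (a : ℝ), ν < r + 1 →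
      Measurable fun ω => localPolyEst s K ν r a n (fun k => Z k ω) (fun k => Y k ω) := by
    intro r ν a hν
    simp only [localPolyEst, evec_dotProduct hν, localPolyCoef]
    exact ((measurable_gram_inv_mulVec hs hK r a n hZ hY _).const_mul _).const_mul _
  have h2 : Measurable fun ω => biasFactor s K p (p + 1) h n (fun k => Z k ω) := by
    simp only [biasFactor, evec_dotProduct (Nat.succ_pos p)]
    exact measurable_gram_inv_mulVec hs hK p h n hZ
      (fun k => ((hZ k).div_const h).pow_const (p + 1)) _
  unfold bcEst
  exact (h1 h (Nat.succ_pos p)).sub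
    ((((h1 b (by omega : p + 1 < q + 1)).div_const _).const_mul _).mul h2)

end Measurability

/-! ### One-sided estimation: stochastic limits -/

/-- Bounded measurable functions that vanish outside `s ∩ (-δ, δ)`. -/
structure IsLocalTest (s : Set ℝ) (δ : ℝ) (ψ : ℝ → ℝ) : Prop where
  measurable : Measurable ψ
  bounded : ∃ C, ∀ z, |ψ z| ≤ C
  support : ∀ z, ψ z ≠ 0 → z ∈ s ∧ |z| < δ

/-- Regression model `Y = g(Z) + ε` on one side `s` of the cutoff, close to the cutoff: `f` is the
density of `Z`, `G / f` is the conditional variance of `ε`, and the conditional fourth moment of `ε`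
is bounded. -/
structure OneSidedModel {Ω : Type*} [MeasurableSpace Ω] (P : Measure Ω) (Z Y : Ω → ℝ)
    (s : Set ℝ) (δ : ℝ) (g f G : ℝ → ℝ) : Prop where
  δ_pos : 0 < δ
  measurable_g : Measurable g
  measurable_f : Measurable f
  measurable_G : Measurable G
  bounded_f : ∃ M, ∀ z, |f z| ≤ M
  bounded_G : ∃ M, ∀ z, |G z| ≤ M
  continuousAt_f : ContinuousAt f 0
  continuousAt_G : ContinuousAt G 0
  f_pos : 0 < f 0
  density : ∀ ψ, IsLocalTest s δ ψ → ∫ ω, ψ (Z ω) ∂P = ∫ z, ψ z * f z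
  mean : ∀ ψ, IsLocalTest s δ ψ → ∫ ω, ψ (Z ω) * (Y ω - g (Z ω)) ∂P = 0
  second : ∀ ψ, IsLocalTest s δ ψ →
    ∫ ω, ψ (Z ω) * (Y ω - g (Z ω)) ^ 2 ∂P = ∫ z, ψ z * G z
  fourth : ∃ C, ∀ ψ, IsLocalTest s δ ψ → (∀ z, 0 ≤ ψ z) →
    Integrable (fun ω => ψ (Z ω) * (Y ω - g (Z ω)) ^ 4) P ∧
    ∫ ω, ψ (Z ω) * (Y ω - g (Z ω)) ^ 4 ∂P ≤ C * ∫ z, ψ z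

theorem isLocalTest_scaled {s : Set ℝ} (hs : MeasurableSet s) {δ h R C : ℝ} (hh : 0 < h)
    (hR : R * h < δ) {Ψ : ℝ → ℝ} (hΨ : Measurable Ψ) (hC : ∀ u, |Ψ u| ≤ C)
    (hsupp : ∀ u, Ψ u ≠ 0 → |u| ≤ R) :
    IsLocalTest s δ (s.indicator fun z => Ψ (z / h)) where
  measurable := (hΨ.comp (measurable_id.div_const h)).indicator hs
  bounded := by
    refine ⟨C, fun z => ?_⟩
    by_cases hz : z ∈ s
    · simpa [hz] using hC _
    · simpa [hz] using (abs_nonneg _).trans (hC 0)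
  support := by
    intro z hz
    have hz' : z ∈ s := by
      by_contra hcon
      exact hz (indicator_of_notMem hcon _)
    rw [indicator_of_mem hz'] at hz
    refine ⟨hz', ?_⟩
    have := hsupp _ hz
    rw [abs_div, abs_of_pos hh, div_le_iff₀ hh] at this
    exact this.trans_lt hR

section OneSided

variable {Ω : Type*} [MeasurableSpace Ω] {P : Measure Ω} [IsProbabilityMeasure P]
  {Z Y : ℕ → Ω → ℝ} {s : Set ℝ} {δ : ℝ} {g f G : ℝ → ℝ} {K : ℝ → ℝ} {κ : ℝ}

/-- In the variable u = z/a the mean of one term is ∫Ψ(u) f(au) du, which tends to f(0)∫Ψ. Its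
second moment is of order 1/a, so the variance of the average is of order 1/(na) and vanishes. -/
theorem tendstoInMeasure_kernelMean
    (hindep : iIndepFun (fun k ω => (Z k ω, Y k ω)) P)
    (hident : ∀ k, IdentDistrib (fun ω => (Z k ω, Y k ω)) (fun ω => (Z 0 ω, Y 0 ω)) P P)
    (hZ : Measurable (Z 0))
    (hs : Ioi 0 ⊆ s) (hs' : s ⊆ Ici 0) (hsm : MeasurableSet s)
    (hM : OneSidedModel P (Z 0) (Y 0) s δ g f G) {a : ℕ → ℝ} (ha : ∀ n, 0 < a n)
    (ha0 : Tendsto a atTop (𝓝 0)) (han : Tendsto (fun n : ℕ => (n : ℝ) * a n) atTop atTop)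
    {Ψ : ℝ → ℝ} (hΨ : Measurable Ψ) {C R : ℝ} (hC : ∀ u, |Ψ u| ≤ C)
    (hsupp : ∀ u, Ψ u ≠ 0 → |u| ≤ R) :
    TendstoInMeasure P (fun (n : ℕ) ω =>
      (∑ k ∈ Finset.range n, s.indicator (fun z => Ψ (z / a n)) (Z k ω) / a n) / n) atTop
      (fun _ => f 0 * ∫ u in Ioi (0 : ℝ), Ψ u) := by
  obtain ⟨M, hMf⟩ := hM.bounded_f
  have hsmall : ∀ᶠ n in atTop, R * a n < δ := by
    have : Tendsto (fun n => R * a n) atTop (𝓝 0) := by simpa using ha0.const_mul R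
    exact this.eventually (gt_mem_nhds hM.δ_pos)
  have hmeas : ∀ n, Measurable (s.indicator fun z => Ψ (z / a n)) := fun n =>
    (hΨ.comp (measurable_id.div_const _)).indicator hsm
  have hbdd : ∀ n z, |s.indicator (fun z => Ψ (z / a n)) z| ≤ C := fun n z => by
    by_cases hz : z ∈ s
    · simpa [hz] using hC _
    · simpa [hz] using (abs_nonneg _).trans (hC 0)
  have hint : ∀ (Φ : ℝ → ℝ), Measurable Φ → (∃ D, ∀ u, |Φ u| ≤ D) → (∀ u, Φ u ≠ 0 → |u| ≤ R) →
      Tendsto (fun n => ∫ u in Ioi (0 : ℝ), Φ u * f (a n * u)) atTop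
        (𝓝 (f 0 * ∫ u in Ioi (0 : ℝ), Φ u)) := by
    intro Φ hΦ hD hΦs
    obtain ⟨D, hD⟩ := hD
    refine tendsto_integral_scaled (Ψ := fun _ => Φ) (bound := fun u => |Φ u|) ha0
      hM.measurable_f hMf hM.continuousAt_f (fun _ => hΦ) ?_
      (Eventually.of_forall fun n u => le_rfl) (Eventually.of_forall fun u => tendsto_const_nhds)
    have : IntegrableOn Φ (Ioi 0) := integrableOn_of_bounded_of_support hΦ hD fun u hu => by
      by_contra hne
      exact absurd (hΦs u hne) (not_le.2 (hu.trans_le (le_abs_self u)))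
    exact this.norm
  refine tendstoInMeasure_rowMean (W := fun k ω => (Z k ω, Y k ω))
    (φ := fun n w => s.indicator (fun z => Ψ (z / a n)) w.1 / a n) hindep hident
    (fun n => ((hmeas n).comp measurable_fst).div_const _) ?_ ?_ ?_
  · refine Eventually.of_forall fun n => ?_
    refine MemLp.of_bound (((hmeas n).comp hZ).div_const _).aestronglyMeasurable (C / a n)
      (Eventually.of_forall fun ω => ?_)
    rw [Real.norm_eq_abs, abs_div, abs_of_pos (ha n)]
    exact div_le_div_of_nonneg_right (hbdd n _) (ha n).le
  · refine (hint Ψ hΨ ⟨C, hC⟩ hsupp).congr' ?_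
    filter_upwards [hsmall] with n hn
    rw [integral_div, hM.density _ (isLocalTest_scaled hsm (ha n) hn hΨ hC hsupp),
      integral_indicator_scaled hs hs' hsm (ha n), mul_div_cancel_left₀ _ (ha n).ne']
  · have hC2 : ∀ u, |Ψ u ^ 2| ≤ C ^ 2 := fun u => by
      rw [abs_pow]; exact pow_le_pow_left₀ (abs_nonneg _) (hC u) 2
    have hs2 : ∀ u, Ψ u ^ 2 ≠ 0 → |u| ≤ R := fun u hu => hsupp u fun h => hu (by rw [h]; ring)
    have h1 := (tendsto_inv_atTop_zero.comp han).mul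
      (hint (fun u => Ψ u ^ 2) (hΨ.pow_const 2) ⟨C ^ 2, hC2⟩ hs2)
    rw [zero_mul] at h1
    refine h1.congr' ?_
    filter_upwards [hsmall, eventually_gt_atTop 0] with n hn hn0
    have e : ∀ ω, (s.indicator (fun z => Ψ (z / a n)) (Z 0 ω) / a n) ^ 2 =
        s.indicator (fun z => Ψ (z / a n) ^ 2) (Z 0 ω) / a n ^ 2 := fun ω => by
      by_cases hz : Z 0 ω ∈ s <;> simp [hz, div_pow]
    simp only [e]
    rw [integral_div, hM.density _ (isLocalTest_scaled (Ψ := fun u => Ψ u ^ 2) hsm (ha n) hn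
      (hΨ.pow_const 2) hC2 hs2),
      integral_indicator_scaled (Ψ := fun u => Ψ u ^ 2) hs hs' hsm (ha n)]
    have := (ha n).ne'
    have hn0' : (n : ℝ) ≠ 0 := by positivity
    simp only [Function.comp_apply]
    field_simp

theorem tendstoInMeasure_weightedMean
    (hindep : iIndepFun (fun k ω => (Z k ω, Y k ω)) P)
    (hident : ∀ k, IdentDistrib (fun ω => (Z k ω, Y k ω)) (fun ω => (Z 0 ω, Y 0 ω)) P P)
    (hZ : Measurable (Z 0))
    (hs : Ioi 0 ⊆ s) (hs' : s ⊆ Ici 0) (hsm : MeasurableSet s)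
    (hM : OneSidedModel P (Z 0) (Y 0) s δ g f G) (hK : IsRDKernel K κ)
    {a : ℕ → ℝ} (ha : ∀ n, 0 < a n)
    (ha0 : Tendsto a atTop (𝓝 0)) (han : Tendsto (fun n : ℕ => (n : ℝ) * a n) atTop atTop)
    {A : ℝ → ℝ} (hA : Continuous A) :
    TendstoInMeasure P (fun (n : ℕ) ω =>
      (∑ k ∈ Finset.range n, weight s K (a n) (Z k ω) * A (Z k ω / a n)) / n) atTop
      (fun _ => f 0 * ∫ u in Ioi (0 : ℝ), K u * A u) := by
  obtain ⟨C, -, hC⟩ := hK.exists_bound hA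
  have h := tendstoInMeasure_kernelMean hindep hident hZ hs hs' hsm hM ha ha0 han
    (Ψ := fun u => K u * A u) (hK.measurable.mul hA.measurable) hC
    (fun u hu => hK.abs_le_of_ne_zero (left_ne_zero_of_mul hu))
  refine h.congr (fun n => Eventually.of_forall fun ω => ?_) (ae_eq_refl _)
  simp only
  congr 1
  refine Finset.sum_congr rfl fun k _ => ?_
  by_cases hz : Z k ω ∈ s
  · simp only [weight, indicator_of_mem hz]; ring
  · simp [weight, hz]

theorem continuousAt_matrix_inv_apply {m : ℕ} {A : Matrix (Fin m) (Fin m) ℝ} (hA : A.det ≠ 0)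
    (i j : Fin m) :
    ContinuousAt (fun B : Fin m → Fin m → ℝ => (Matrix.of B)⁻¹ i j) A := by
  have h1 : Continuous fun B : Fin m → Fin m → ℝ => (Matrix.of B).det :=
    Continuous.matrix_det continuous_id
  have h2 : Continuous fun B : Fin m → Fin m → ℝ => (Matrix.of B).adjugate i j :=
    (Continuous.matrix_adjugate continuous_id).matrix_elem i j
  simp only [matrix_inv_apply]
  exact (h1.continuousAt.inv₀ hA).mul h2.continuousAt

theorem tendstoInMeasure_gram
    (hindep : iIndepFun (fun k ω => (Z k ω, Y k ω)) P)
    (hident : ∀ k, IdentDistrib (fun ω => (Z k ω, Y k ω)) (fun ω => (Z 0 ω, Y 0 ω)) P P)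
    (hZ : Measurable (Z 0))
    (hs : Ioi 0 ⊆ s) (hs' : s ⊆ Ici 0) (hsm : MeasurableSet s)
    (hM : OneSidedModel P (Z 0) (Y 0) s δ g f G) (hK : IsRDKernel K κ)
    {a : ℕ → ℝ} (ha : ∀ n, 0 < a n)
    (ha0 : Tendsto a atTop (𝓝 0)) (han : Tendsto (fun n : ℕ => (n : ℝ) * a n) atTop atTop)
    (p : ℕ) :
    TendstoInMeasure (E := Fin (p + 1) → Fin (p + 1) → ℝ) P
      (fun (n : ℕ) ω => gram s K p (a n) n (fun k => Z k ω)) atTop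
      (fun _ => f 0 • limGram K p) := by
  have h : ∀ i j, TendstoInMeasure P
      (fun (n : ℕ) ω => gram s K p (a n) n (fun k => Z k ω) i j) atTop
      (fun _ => f 0 * limGram K p i j) := fun i j =>
    tendstoInMeasure_weightedMean (A := fun u => rvec p u i * rvec p u j) hindep hident hZ hs hs'
      hsm hM hK ha ha0 han ((continuous_rvec p i).mul (continuous_rvec p j))
  exact tendstoInMeasure_pi (E := Fin (p + 1) → ℝ) fun i => tendstoInMeasure_pi (E := ℝ) (h i)

theorem limGram_inv_smul (hK : IsRDKernel K κ) {c : ℝ} (hc : c ≠ 0) (p : ℕ) (i j : Fin (p + 1)) :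
    (c • limGram K p)⁻¹ i j = c⁻¹ * (limGram K p)⁻¹ i j := by
  have h1 : (c • limGram K p)⁻¹ = c⁻¹ • (limGram K p)⁻¹ := by
    refine Matrix.inv_eq_right_inv ?_
    rw [Matrix.smul_mul, Matrix.mul_smul, smul_smul, mul_inv_cancel₀ hc, one_smul,
      Matrix.mul_nonsing_inv _ (isUnit_iff_ne_zero.2 (limGram_det_ne_zero hK p))]
  rw [h1]; rfl

theorem det_smul_limGram_ne_zero (hK : IsRDKernel K κ) {c : ℝ} (hc : c ≠ 0) (p : ℕ) :
    (c • limGram K p).det ≠ 0 := by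
  rw [Matrix.det_smul]
  exact mul_ne_zero (pow_ne_zero _ hc) (limGram_det_ne_zero hK p)

theorem tendstoInMeasure_gram_inv
    (hindep : iIndepFun (fun k ω => (Z k ω, Y k ω)) P)
    (hident : ∀ k, IdentDistrib (fun ω => (Z k ω, Y k ω)) (fun ω => (Z 0 ω, Y 0 ω)) P P)
    (hZ : Measurable (Z 0))
    (hs : Ioi 0 ⊆ s) (hs' : s ⊆ Ici 0) (hsm : MeasurableSet s)
    (hM : OneSidedModel P (Z 0) (Y 0) s δ g f G) (hK : IsRDKernel K κ)
    {a : ℕ → ℝ} (ha : ∀ n, 0 < a n)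
    (ha0 : Tendsto a atTop (𝓝 0)) (han : Tendsto (fun n : ℕ => (n : ℝ) * a n) atTop atTop)
    (p : ℕ) (i j : Fin (p + 1)) :
    TendstoInMeasure P (fun (n : ℕ) ω => (gram s K p (a n) n (fun k => Z k ω))⁻¹ i j) atTop
      (fun _ => (f 0)⁻¹ * (limGram K p)⁻¹ i j) := by
  have h := TendstoInMeasure.comp_continuousAt (E := Fin (p + 1) → Fin (p + 1) → ℝ) (F := ℝ)
    (g := fun B : Fin (p + 1) → Fin (p + 1) → ℝ => (Matrix.of B)⁻¹ i j)
    (continuousAt_matrix_inv_apply (det_smul_limGram_ne_zero hK hM.f_pos.ne' p) i j)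
    (tendstoInMeasure_gram hindep hident hZ hs hs' hsm hM hK ha ha0 han p)
  rw [← limGram_inv_smul hK hM.f_pos.ne']
  exact h

/-- The estimators use the total inverse of a matrix, which is meaningless on singular samples. Such
samples become improbable because the determinant converges to a nonzero number. -/
theorem tendsto_prob_gram_singular
    (hindep : iIndepFun (fun k ω => (Z k ω, Y k ω)) P)
    (hident : ∀ k, IdentDistrib (fun ω => (Z k ω, Y k ω)) (fun ω => (Z 0 ω, Y 0 ω)) P P)
    (hZ : Measurable (Z 0))
    (hs : Ioi 0 ⊆ s) (hs' : s ⊆ Ici 0) (hsm : MeasurableSet s)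
    (hM : OneSidedModel P (Z 0) (Y 0) s δ g f G) (hK : IsRDKernel K κ)
    {a : ℕ → ℝ} (ha : ∀ n, 0 < a n)
    (ha0 : Tendsto a atTop (𝓝 0)) (han : Tendsto (fun n : ℕ => (n : ℝ) * a n) atTop atTop)
    (p : ℕ) :
    Tendsto (fun n : ℕ => P.real {ω | (gram s K p (a n) n (fun k => Z k ω)).det = 0}) atTop
      (𝓝 0) := by
  have hd := det_smul_limGram_ne_zero hK hM.f_pos.ne' p
  have hc : Continuous fun B : Fin (p + 1) → Fin (p + 1) → ℝ => (Matrix.of B).det :=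
    Continuous.matrix_det continuous_id
  have h := TendstoInMeasure.comp_continuousAt (E := Fin (p + 1) → Fin (p + 1) → ℝ) (F := ℝ)
    (g := fun B : Fin (p + 1) → Fin (p + 1) → ℝ => (Matrix.of B).det) hc.continuousAt
    (tendstoInMeasure_gram hindep hident hZ hs hs' hsm hM hK ha ha0 han p)
  -- A zero determinant deviates from its limit by the full absolute value of the limit.
  refine squeeze_zero (fun _ => measureReal_nonneg) (fun n => measureReal_mono ?_)
    (tendstoInMeasure_real_iff.1 h |(f 0 • limGram K p).det| (abs_pos.2 hd))
  intro ω hω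
  have hω' : (gram s K p (a n) n (fun k => Z k ω)).det = 0 := hω
  change |(f 0 • limGram K p).det| ≤
    |(gram s K p (a n) n (fun k => Z k ω)).det - (f 0 • limGram K p).det|
  rw [hω', zero_sub, abs_neg]

theorem tendstoInMeasure_biasFactor
    (hindep : iIndepFun (fun k ω => (Z k ω, Y k ω)) P)
    (hident : ∀ k, IdentDistrib (fun ω => (Z k ω, Y k ω)) (fun ω => (Z 0 ω, Y 0 ω)) P P)
    (hZ : Measurable (Z 0))
    (hs : Ioi 0 ⊆ s) (hs' : s ⊆ Ici 0) (hsm : MeasurableSet s)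
    (hM : OneSidedModel P (Z 0) (Y 0) s δ g f G) (hK : IsRDKernel K κ)
    {a : ℕ → ℝ} (ha : ∀ n, 0 < a n)
    (ha0 : Tendsto a atTop (𝓝 0)) (han : Tendsto (fun n : ℕ => (n : ℝ) * a n) atTop atTop)
    (p r : ℕ) :
    TendstoInMeasure P (fun (n : ℕ) ω => biasFactor s K p r (a n) n (fun k => Z k ω)) atTop
      (fun _ => limBiasFactor K p r) := by
  have h0 := Nat.succ_pos p
  have hm : ∀ i : Fin (p + 1), TendstoInMeasure P (fun (n : ℕ) ω =>
      wmoment s K p (a n) n (fun k => Z k ω) (fun k => (Z k ω / a n) ^ r) i) atTop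
      (fun _ => f 0 * limMoment K p r i) := fun i =>
    tendstoInMeasure_weightedMean (A := fun u => rvec p u i * u ^ r) hindep hident hZ hs hs'
      hsm hM hK ha ha0 han ((continuous_rvec p i).mul (continuous_pow r))
  have hprod := fun i => TendstoInMeasure.mul_const_limit (tendstoInMeasure_gram_inv hindep hident
    hZ hs hs' hsm hM hK ha ha0 han p ⟨0, h0⟩ i) (hm i)
  -- The density cancels: the Gram matrix and the moment are both proportional to f(0) in the limit.
  have hlim : limBiasFactor K p r = ∑ i : Fin (p + 1), (f 0)⁻¹ * (limGram K p)⁻¹ ⟨0, h0⟩ i *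
      (f 0 * limMoment K p r i) := by
    rw [limBiasFactor, evec_dotProduct h0, Matrix.mulVec, dotProduct]
    refine Finset.sum_congr rfl fun i _ => ?_
    have := hM.f_pos.ne'
    field_simp
  have hsum := TendstoInMeasure.comp_continuousAt (E := Fin (p + 1) → ℝ) (F := ℝ)
    (g := fun x : Fin (p + 1) → ℝ => ∑ i, x i)
    (by fun_prop)
    (tendstoInMeasure_pi (E := ℝ) hprod)
  rw [hlim]
  refine hsum.congr (fun n => Eventually.of_forall fun ω => ?_) (ae_eq_refl _)
  simp only [biasFactor, evec_dotProduct h0]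
  rfl

end OneSided

/-! ### Bandwidths -/

section Bandwidth

variable {p q : ℕ} {h b : ℕ → ℝ} {ρ : ℝ}

theorem BandwidthConditions.h_tendsto (H : BandwidthConditions p q h b ρ) :
    Tendsto h atTop (𝓝 0) :=
  squeeze_zero (fun n => (H.h_pos n).le) (fun _ => le_max_left _ _) H.max_tendsto

theorem BandwidthConditions.b_tendsto (H : BandwidthConditions p q h b ρ) :
    Tendsto b atTop (𝓝 0) :=
  squeeze_zero (fun n => (H.b_pos n).le) (fun _ => le_max_right _ _) H.max_tendsto

theorem BandwidthConditions.min_pos (H : BandwidthConditions p q h b ρ) (n : ℕ) :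
    0 < min (h n) (b n) := lt_min (H.h_pos n) (H.b_pos n)

theorem BandwidthConditions.nh_tendsto (H : BandwidthConditions p q h b ρ) :
    Tendsto (fun n : ℕ => (n : ℝ) * h n) atTop atTop :=
  tendsto_atTop_mono (fun n => mul_le_mul_of_nonneg_left (min_le_left _ _) n.cast_nonneg)
    H.min_tendsto

theorem BandwidthConditions.nb_tendsto (H : BandwidthConditions p q h b ρ) :
    Tendsto (fun n : ℕ => (n : ℝ) * b n) atTop atTop :=
  tendsto_atTop_mono (fun n => mul_le_mul_of_nonneg_left (min_le_right _ _) n.cast_nonneg)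
    H.min_tendsto

theorem BandwidthConditions.ratio_nonneg (H : BandwidthConditions p q h b ρ) (n : ℕ) :
    0 ≤ h n / b n := (div_pos (H.h_pos n) (H.b_pos n)).le

theorem BandwidthConditions.rho_nonneg (H : BandwidthConditions p q h b ρ) : 0 ≤ ρ :=
  ge_of_tendsto' H.ratio_tendsto H.ratio_nonneg

theorem BandwidthConditions.eventually_ratio_le (H : BandwidthConditions p q h b ρ) :
    ∀ᶠ n in atTop, h n / b n ≤ ρ + 1 :=
  (H.ratio_tendsto.eventually (gt_mem_nhds (lt_add_one ρ))).mono fun _ hn => le_of_lt hn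

theorem BandwidthConditions.min_div_tendsto (H : BandwidthConditions p q h b ρ) :
    Tendsto (fun n => min (h n) (b n) / h n) atTop (𝓝 (1 / max 1 ρ)) := by
  have h1 : Tendsto (fun n => 1 / max 1 (h n / b n)) atTop (𝓝 (1 / max 1 ρ)) :=
    tendsto_const_nhds.div (tendsto_const_nhds.max H.ratio_tendsto)
      (lt_max_of_lt_left one_pos).ne'
  refine h1.congr fun n => ?_
  have hh := H.h_pos n
  have hb := H.b_pos n
  rcases le_total (h n) (b n) with hle | hle
  · rw [min_eq_left hle, max_eq_left ((div_le_one hb).2 hle), div_self hh.ne', div_one]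
  · rw [min_eq_right hle, max_eq_right ((one_le_div hb).2 hle), one_div_div]

/-- Both bias terms, of orders `h^(p+2)` and `h^(p+1) b^(q-p)`, are negligible. -/
theorem BandwidthConditions.bias_sqrt_tendsto (H : BandwidthConditions p q h b ρ) {x : ℕ → ℝ}
    (hx0 : ∀ n, 0 ≤ x n) (hx : ∀ n, x n ^ 2 ≤ max (h n ^ 2) (b n ^ (2 * (q - p)))) :
    Tendsto (fun n : ℕ => √((n : ℝ) * min (h n) (b n)) * (h n ^ (p + 1) * x n)) atTop (𝓝 0) := by
  have hsq : Tendsto (fun n : ℕ => (n : ℝ) * min (h n) (b n) * (h n ^ (p + 1) * x n) ^ 2) atTop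
      (𝓝 0) := by
    have hR : 0 ≤ ρ + 1 := by linarith [H.rho_nonneg]
    have h1 := H.bias_tendsto.const_mul ((ρ + 1) ^ (2 * p + 2))
    rw [mul_zero] at h1
    refine tendsto_of_tendsto_of_tendsto_of_le_of_le' tendsto_const_nhds h1
      (Eventually.of_forall fun n => mul_nonneg (mul_nonneg n.cast_nonneg (H.min_pos n).le)
        (sq_nonneg _)) ?_
    filter_upwards [H.eventually_ratio_le] with n hn
    have hh := H.h_pos n
    have hb := H.b_pos n
    have hm := H.min_pos n
    set m := min (h n) (b n) with hmdef
    -- Because h/b is eventually at most ρ+1, powers of h can be replaced by powers of min{h,b}; the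
    -- bandwidth condition is stated for the latter.
    have hle : h n ≤ (ρ + 1) * m := by
      rw [hmdef, mul_min_of_nonneg _ _ hR]
      refine le_min ?_ ((div_le_iff₀ hb).1 hn)
      nlinarith [mul_nonneg H.rho_nonneg hh.le]
    have hmin : m ^ (2 * p + 3) ≤ min (h n ^ (2 * p + 3)) (b n ^ (2 * p + 3)) :=
      le_min (pow_le_pow_left₀ hm.le (min_le_left _ _) _)
        (pow_le_pow_left₀ hm.le (min_le_right _ _) _)
    calc (n : ℝ) * m * (h n ^ (p + 1) * x n) ^ 2
        = n * (m * h n ^ (2 * p + 2)) * x n ^ 2 := by ring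
      _ ≤ n * (m * ((ρ + 1) * m) ^ (2 * p + 2)) * max (h n ^ 2) (b n ^ (2 * (q - p))) := by
          gcongr
          exact hx n
      _ = (ρ + 1) ^ (2 * p + 2) *
          (n * m ^ (2 * p + 3) * max (h n ^ 2) (b n ^ (2 * (q - p)))) := by
          rw [mul_pow]; ring
      _ ≤ _ := by gcongr
  have h2 := (Real.continuous_sqrt.tendsto 0).comp hsq
  rw [Real.sqrt_zero] at h2
  refine h2.congr fun n => ?_
  rw [Function.comp_apply, Real.sqrt_mul (mul_nonneg n.cast_nonneg (H.min_pos n).le),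
    Real.sqrt_sq (mul_nonneg (pow_nonneg (H.h_pos n).le _) (hx0 n))]

end Bandwidth

/-! ### Linearisation of the one-sided estimator -/

/-- Contribution of an observation `(z, y)` to the linearisation of
`√(n min{h, b}) (Δμ̂_{p,q}(h,b) - Δμ)`. -/
def score (s : Set ℝ) (K : ℝ → ℝ) (p q : ℕ) (h b : ℝ) (n : ℕ) (g : ℝ → ℝ) (f₀ : ℝ)
    (w : ℝ × ℝ) : ℝ :=
  √(n * min h b) / (n * f₀ * h) *
    (s.indicator (fun z => bcKernel K p q (h / b) (z / h)) w.1 * (w.2 - g w.1))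

section OneSided

variable {Ω : Type*} [MeasurableSpace Ω] {P : Measure Ω}
  {Z Y : ℕ → Ω → ℝ} {s : Set ℝ} {δ : ℝ} {g f G : ℝ → ℝ} {K : ℝ → ℝ} {κ : ℝ}

/-- The second-moment axiom is an equality of integrals and gives no integrability. That comes from
the fourth-moment axiom, applied to ψ⁴. -/
theorem OneSidedModel.integrable_sq [IsProbabilityMeasure P] {Z Y : Ω → ℝ} (hM : OneSidedModel P Z Y s δ g f G)
    (hZ : Measurable Z) (hY : Measurable Y) {ψ : ℝ → ℝ} (hψ : IsLocalTest s δ ψ) :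
    Integrable (fun ω => ψ (Z ω) ^ 2 * (Y ω - g (Z ω)) ^ 2) P := by
  obtain ⟨C, hC⟩ := hM.fourth
  obtain ⟨D, hD⟩ := hψ.bounded
  have htest : IsLocalTest s δ fun z => ψ z ^ 4 :=
    { measurable := hψ.measurable.pow_const 4
      bounded := ⟨D ^ 4, fun z => by
        rw [abs_pow]; exact pow_le_pow_left₀ (abs_nonneg _) (hD z) 4⟩
      support := fun z hz => hψ.support z fun h => hz (by simp [h]) }
  have h4 := (hC _ htest fun z => by positivity).1
  refine (h4.add (integrable_const 1)).mono' (((hψ.measurable.comp hZ).pow_const 2).mul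
    ((hY.sub (hM.measurable_g.comp hZ)).pow_const 2)).aestronglyMeasurable
    (Eventually.of_forall fun ω => ?_)
  simp only [Real.norm_eq_abs, Pi.add_apply]
  rw [abs_of_nonneg (by positivity)]
  nlinarith [sq_nonneg (ψ (Z ω) ^ 2 * (Y ω - g (Z ω)) ^ 2 - 1)]

theorem measurable_score (hK : IsRDKernel K κ) (hsm : MeasurableSet s) (hg : Measurable g)
    (p q : ℕ) (h b : ℝ) (n : ℕ) (f₀ : ℝ) : Measurable (score s K p q h b n g f₀) :=
  (((((measurable_bcKernel hK p q _).comp (measurable_id.div_const h)).indicator hsm).comp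
    measurable_fst).mul (measurable_snd.sub (hg.comp measurable_fst))).const_mul _

theorem isLocalTest_bcKernel_pow (hK : IsRDKernel K κ) (hsm : MeasurableSet s) (p q : ℕ)
    {h b : ℝ} (hh : 0 < h) (hb : 0 < b) (hδ : κ * max h b < δ) {j : ℕ} (hj : j ≠ 0) :
    IsLocalTest s δ (s.indicator fun z => bcKernel K p q (h / b) (z / h) ^ j) := by
  obtain ⟨C, -, hC⟩ := exists_bound_bcKernel hK p q (h / b)
  have hκ := hK.pos
  -- In units of h the two parts of the kernel have support radii κ and κb/h; R is the larger one.
  refine isLocalTest_scaled (Ψ := fun u => bcKernel K p q (h / b) u ^ j) (C := C ^ j)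
    (R := κ * max h b / h) hsm hh ?_ ((measurable_bcKernel hK p q _).pow_const j) ?_ ?_
  · rwa [div_mul_cancel₀ _ hh.ne']
  · intro u
    rw [abs_pow]
    exact pow_le_pow_left₀ (abs_nonneg _) (hC _ (by positivity) le_rfl u) j
  · intro u hu
    by_contra hcon
    push Not at hcon
    rw [div_lt_iff₀ hh] at hcon
    apply hu
    rw [bcKernel_eq_zero hK, zero_pow hj]
    · have := mul_le_mul_of_nonneg_left (le_max_left h b) hκ.le
      exact lt_of_mul_lt_mul_right (this.trans_lt hcon) hh.le
    · have := mul_le_mul_of_nonneg_left (le_max_right h b) hκ.le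
      rw [abs_mul, abs_div, abs_of_pos hh, abs_of_pos hb, div_mul_eq_mul_div, lt_div_iff₀ hb,
        mul_comm h]
      exact this.trans_lt hcon

theorem indicator_pow {j : ℕ} (hj : j ≠ 0) (F : ℝ → ℝ) (z : ℝ) :
    s.indicator F z ^ j = s.indicator (fun z => F z ^ j) z := by
  by_cases hz : z ∈ s <;> simp [hz, hj]

theorem score_pow {p q n : ℕ} {h b f₀ : ℝ} {j : ℕ} (hj : j ≠ 0) (w : ℝ × ℝ) :
    score s K p q h b n g f₀ w ^ j = (√(n * min h b) / (n * f₀ * h)) ^ j *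
      (s.indicator (fun z => bcKernel K p q (h / b) (z / h) ^ j) w.1 * (w.2 - g w.1) ^ j) := by
  rw [score, mul_pow, mul_pow, indicator_pow hj]

variable {p q : ℕ} {h b : ℕ → ℝ} {ρ : ℝ}

theorem eventually_support_lt (H : BandwidthConditions p q h b ρ) (κ : ℝ) {δ : ℝ} (hδ : 0 < δ) :
    ∀ᶠ n in atTop, κ * max (h n) (b n) < δ := by
  have : Tendsto (fun n => κ * max (h n) (b n)) atTop (𝓝 0) := by
    simpa using H.max_tendsto.const_mul κ
  exact this.eventually (gt_mem_nhds hδ)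

theorem score_integral_eq_zero (hsm : MeasurableSet s)
    (hM : OneSidedModel P (Z 0) (Y 0) s δ g f G) (hK : IsRDKernel K κ)
    (H : BandwidthConditions p q h b ρ) :
    ∀ᶠ n in atTop, ∫ ω, score s K p q (h n) (b n) n g (f 0) (Z 0 ω, Y 0 ω) ∂P = 0 := by
  filter_upwards [eventually_support_lt H κ hM.δ_pos] with n hn
  have htest := isLocalTest_bcKernel_pow hK hsm p q (H.h_pos n) (H.b_pos n) hn one_ne_zero
  simp only [pow_one] at htest
  simp only [score]
  rw [integral_const_mul, hM.mean _ htest, mul_zero]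

/-- Rescaling by h leaves (min{h,b}/h) f(0)⁻² times the integral of the squared kernel against
G(hu). The first factor tends to 1/max{1,ρ}. As G is conditional variance times density, the
variance argument of `limVar` is G(0)/f(0). -/
theorem score_second_moment (hs : Ioi 0 ⊆ s) (hs' : s ⊆ Ici 0) (hsm : MeasurableSet s)
    (hM : OneSidedModel P (Z 0) (Y 0) s δ g f G) (hK : IsRDKernel K κ)
    (H : BandwidthConditions p q h b ρ) :
    Tendsto (fun n : ℕ => n * ∫ ω, score s K p q (h n) (b n) n g (f 0) (Z 0 ω, Y 0 ω) ^ 2 ∂P) atTop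
      (𝓝 (limVar K p q ρ (G 0 / f 0) (f 0))) := by
  obtain ⟨M, hMG⟩ := hM.bounded_G
  obtain ⟨C, -, hC⟩ := exists_bound_sq_bcKernel hK p q (ρ + 1)
  have h1 : Tendsto (fun n => ∫ u in Ioi (0 : ℝ), bcKernel K p q (h n / b n) u ^ 2 * G (h n * u))
      atTop (𝓝 (G 0 * ∫ u in Ioi (0 : ℝ), bcKernel K p q ρ u ^ 2)) := by
    refine tendsto_integral_scaled (Ψ := fun n u => bcKernel K p q (h n / b n) u ^ 2)
      (bound := fun u => C * (1 + u ^ 2)⁻¹) H.h_tendsto hM.measurable_G hMG hM.continuousAt_G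
      (fun n => (measurable_bcKernel hK p q _).pow_const 2)
      (integrable_inv_one_add_sq.const_mul C).integrableOn ?_ ?_
    · filter_upwards [H.eventually_ratio_le] with n hn
      intro u
      rw [abs_of_nonneg (sq_nonneg _)]
      exact hC _ (H.ratio_nonneg n) hn u
    · filter_upwards [tendsto_bcKernel hK p q H.ratio_nonneg H.ratio_tendsto] with u hu
      exact hu.pow 2
  have h2 := (H.min_div_tendsto.mul h1).mul_const ((f 0)⁻¹ ^ 2)
  have e : 1 / max 1 ρ * (G 0 * ∫ u in Ioi (0 : ℝ), bcKernel K p q ρ u ^ 2) * (f 0)⁻¹ ^ 2 =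
      limVar K p q ρ (G 0 / f 0) (f 0) := by
    rw [limVar]; ring
  rw [e] at h2
  refine h2.congr' ?_
  filter_upwards [eventually_support_lt H κ hM.δ_pos, eventually_gt_atTop 0] with n hn hn0
  have hh := H.h_pos n
  have hm := H.min_pos n
  have hn0' : (0 : ℝ) < n := by exact_mod_cast hn0
  have hf := hM.f_pos
  simp only [score_pow two_ne_zero]
  rw [integral_const_mul, hM.second _
    (isLocalTest_bcKernel_pow hK hsm p q hh (H.b_pos n) hn two_ne_zero),
    integral_indicator_scaled (Ψ := fun u => bcKernel K p q (h n / b n) u ^ 2) hs hs' hsm hh,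
    div_pow, Real.sq_sqrt (by positivity)]
  field_simp

/-- This is Lyapunov's condition. With m = min{h,b}, the scale to the fourth power, times n, times
the window h, is of order (nm)⁻¹(m/h)³ ≤ (nm)⁻¹. -/
theorem score_fourth_moment (hs : Ioi 0 ⊆ s) (hs' : s ⊆ Ici 0) (hsm : MeasurableSet s)
    (hM : OneSidedModel P (Z 0) (Y 0) s δ g f G) (hK : IsRDKernel K κ)
    (H : BandwidthConditions p q h b ρ) :
    (∀ᶠ n in atTop, Integrable
      (fun ω => score s K p q (h n) (b n) n g (f 0) (Z 0 ω, Y 0 ω) ^ 4) P) ∧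
    Tendsto (fun n : ℕ => n * ∫ ω, score s K p q (h n) (b n) n g (f 0) (Z 0 ω, Y 0 ω) ^ 4 ∂P) atTop
      (𝓝 0) := by
  obtain ⟨C₄, hC₄⟩ := hM.fourth
  have htest := fun n (hn : κ * max (h n) (b n) < δ) =>
    isLocalTest_bcKernel_pow hK hsm p q (H.h_pos n) (H.b_pos n) hn four_ne_zero
  have hnn : ∀ n z, 0 ≤ s.indicator (fun z => bcKernel K p q (h n / b n) (z / h n) ^ 4) z :=
    fun n z => indicator_nonneg (fun _ _ => by positivity) z
  constructor
  · filter_upwards [eventually_support_lt H κ hM.δ_pos] with n hn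
    simp only [score_pow four_ne_zero]
    exact ((hC₄ _ (htest n hn) (hnn n)).1).const_mul _
  · obtain ⟨C, hC0, hC⟩ := exists_bound_sq_bcKernel hK p q (ρ + 1)
    obtain ⟨D, hD0, hD⟩ := exists_bound_bcKernel hK p q (ρ + 1)
    set I := ∫ u in Ioi (0 : ℝ), D ^ 2 * (C * (1 + u ^ 2)⁻¹) with hI
    have hI0 : 0 ≤ I := integral_nonneg fun u => by positivity
    have h1 := (tendsto_inv_atTop_zero.comp H.min_tendsto).mul_const (((f 0)⁻¹) ^ 4 * (|C₄| * I))
    rw [zero_mul] at h1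
    refine tendsto_of_tendsto_of_tendsto_of_le_of_le' tendsto_const_nhds h1
      (Eventually.of_forall fun n => mul_nonneg n.cast_nonneg
        (integral_nonneg fun ω => by positivity)) ?_
    filter_upwards [eventually_support_lt H κ hM.δ_pos, eventually_gt_atTop 0,
      H.eventually_ratio_le] with n hn hn0 hr
    have hh := H.h_pos n
    have hm := H.min_pos n
    have hn0' : (0 : ℝ) < n := by exact_mod_cast hn0
    have hf := hM.f_pos
    have hint : ∫ z, s.indicator (fun z => bcKernel K p q (h n / b n) (z / h n) ^ 4) z ≤
        h n * I := by
      have e := integral_indicator_scaled (Ψ := fun u => bcKernel K p q (h n / b n) u ^ 4)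
        hs hs' hsm hh (fun _ => 1)
      simp only [mul_one] at e
      rw [e]
      gcongr
      refine integral_mono_of_nonneg (Eventually.of_forall fun u => by positivity)
        ((integrable_inv_one_add_sq.const_mul C).const_mul _).integrableOn
        (Eventually.of_forall fun u => ?_)
      simp only
      have e1 : bcKernel K p q (h n / b n) u ^ 2 ≤ D ^ 2 :=
        sq_le_sq' (abs_le.1 (hD _ (H.ratio_nonneg n) hr u)).1
          (abs_le.1 (hD _ (H.ratio_nonneg n) hr u)).2
      calc _ = bcKernel K p q (h n / b n) u ^ 2 * bcKernel K p q (h n / b n) u ^ 2 := by ring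
        _ ≤ _ := by
          gcongr
          exact hC _ (H.ratio_nonneg n) hr u
    have hbd : ∫ ω, s.indicator (fun z => bcKernel K p q (h n / b n) (z / h n) ^ 4) (Z 0 ω) *
        (Y 0 ω - g (Z 0 ω)) ^ 4 ∂P ≤ |C₄| * (h n * I) := by
      refine (hC₄ _ (htest n hn) (hnn n)).2.trans ?_
      exact mul_le_mul (le_abs_self _) hint (integral_nonneg (hnn n)) (abs_nonneg _)
    simp only [score_pow four_ne_zero]
    rw [integral_const_mul]
    set m := min (h n) (b n) with hmdef
    have hs4 : √(n * m) ^ 4 = (n * m) ^ 2 := by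
      rw [show 4 = 2 * 2 from rfl, pow_mul, Real.sq_sqrt (by positivity)]
    calc _ ≤ (n : ℝ) * ((√(n * m) / (n * f 0 * h n)) ^ 4 * (|C₄| * (h n * I))) := by
          gcongr
      _ = (n * m)⁻¹ * (m / h n) ^ 3 * ((f 0)⁻¹ ^ 4 * (|C₄| * I)) := by
          rw [div_pow, hs4]; field_simp
      _ ≤ (n * m)⁻¹ * 1 ^ 3 * ((f 0)⁻¹ ^ 4 * (|C₄| * I)) := by
          gcongr
          exact (div_le_one hh).2 (min_le_left _ _)
      _ = _ := by simp [hmdef]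

/-- The scaled noise moments are stochastically bounded. -/
theorem boundedInProb_noise [IsProbabilityMeasure P]
    (hindep : iIndepFun (fun k ω => (Z k ω, Y k ω)) P)
    (hident : ∀ k, IdentDistrib (fun ω => (Z k ω, Y k ω)) (fun ω => (Z 0 ω, Y 0 ω)) P P)
    (hZ : Measurable (Z 0)) (hY : Measurable (Y 0))
    (hs : Ioi 0 ⊆ s) (hs' : s ⊆ Ici 0) (hsm : MeasurableSet s)
    (hM : OneSidedModel P (Z 0) (Y 0) s δ g f G) (hK : IsRDKernel K κ)
    {a m : ℕ → ℝ} (ha : ∀ n, 0 < a n) (ha0 : Tendsto a atTop (𝓝 0)) (hm : ∀ n, 0 < m n)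
    (hma : ∀ n, m n ≤ a n) (p : ℕ) (i : Fin (p + 1)) :
    BoundedInProb P (fun (n : ℕ) ω => √(n * m n) *
      wmoment s K p (a n) n (fun k => Z k ω) (fun k => Y k ω - g (Z k ω)) i) := by
  obtain ⟨M, hMG⟩ := hM.bounded_G
  obtain ⟨C, hC0, hC⟩ := hK.exists_bound (continuous_rvec p i)
  have hΨm : Measurable fun u => K u * rvec p u i :=
    hK.measurable.mul (continuous_rvec p i).measurable
  have hsupp : ∀ u, K u * rvec p u i ≠ 0 → |u| ≤ κ := fun u hu =>
    hK.abs_le_of_ne_zero (left_ne_zero_of_mul hu)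
  have hΨ2 : IntegrableOn (fun u => (K u * rvec p u i) ^ 2) (Ioi 0) :=
    integrableOn_of_bounded_of_support (hΨm.pow_const 2) (C := C ^ 2) (R := κ)
      (fun u => by rw [abs_pow]; exact pow_le_pow_left₀ (abs_nonneg _) (hC u) 2)
      fun u hu => by rw [hK.support u (hu.trans_le (le_abs_self u))]; ring
  have hsmall : ∀ᶠ n in atTop, κ * a n < δ := by
    have : Tendsto (fun n => κ * a n) atTop (𝓝 0) := by simpa using ha0.const_mul κ
    exact this.eventually (gt_mem_nhds hM.δ_pos)
  have htest : ∀ n, κ * a n < δ →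
      IsLocalTest s δ (s.indicator fun z => K (z / a n) * rvec p (z / a n) i) := fun n hn =>
    isLocalTest_scaled (Ψ := fun u => K u * rvec p u i) hsm (ha n) hn hΨm hC hsupp
  -- The contribution of one observation. Its second moment, times n, is at most m/a ≤ 1 times a
  -- constant, so Chebyshev applies to the row sum.
  let φ : ℕ → ℝ × ℝ → ℝ := fun n w => √(n * m n) / (n * a n) *
    (s.indicator (fun z => K (z / a n) * rvec p (z / a n) i) w.1 * (w.2 - g w.1))
  have hφm : ∀ n, Measurable (φ n) := fun n =>
    ((((hΨm.comp (measurable_id.div_const (a n))).indicator hsm).comp measurable_fst).mul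
      (measurable_snd.sub (hM.measurable_g.comp measurable_fst))).const_mul _
  have hφ2 : ∀ n w, φ n w ^ 2 = (√(n * m n) / (n * a n)) ^ 2 *
      (s.indicator (fun z => (K (z / a n) * rvec p (z / a n) i)) w.1 ^ 2 *
        (w.2 - g w.1) ^ 2) := fun n w => by
    simp only [φ, mul_pow]
  have key : BoundedInProb P (fun (n : ℕ) ω => ∑ k ∈ Finset.range n, φ n (Z k ω, Y k ω)) := by
    refine boundedInProb_rowSum (W := fun k ω => (Z k ω, Y k ω)) hindep hident hφm ?_ ?_
      (C := M * ∫ u in Ioi (0 : ℝ), (K u * rvec p u i) ^ 2) ?_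
    · filter_upwards [hsmall] with n hn
      refine (memLp_two_iff_integrable_sq ((hφm n).comp (hZ.prodMk hY)).aestronglyMeasurable).2 ?_
      simp only [Function.comp_apply, hφ2]
      exact (hM.integrable_sq hZ hY (htest n hn)).const_mul _
    · filter_upwards [hsmall] with n hn
      simp only [φ]
      rw [integral_const_mul, hM.mean _ (htest n hn), mul_zero]
    · filter_upwards [hsmall, eventually_gt_atTop 0] with n hn hn0
      have hn0' : (0 : ℝ) < n := by exact_mod_cast hn0
      have han := ha n
      have hmn := hm n
      simp only [hφ2, indicator_pow (two_ne_zero)]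
      rw [integral_const_mul, hM.second _ (isLocalTest_scaled (C := C ^ 2)
        (Ψ := fun u => (K u * rvec p u i) ^ 2) hsm han hn (hΨm.pow_const 2)
        (fun u => by rw [abs_pow]; exact pow_le_pow_left₀ (abs_nonneg _) (hC u) 2)
        (fun u hu => hsupp u fun h => hu (by rw [h]; ring))),
        integral_indicator_scaled (Ψ := fun u => (K u * rvec p u i) ^ 2) hs hs' hsm han,
        div_pow, Real.sq_sqrt (by positivity)]
      have hI : ∫ u in Ioi (0 : ℝ), (K u * rvec p u i) ^ 2 * G (a n * u) ≤
          M * ∫ u in Ioi (0 : ℝ), (K u * rvec p u i) ^ 2 := by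
        rw [← integral_const_mul]
        refine (Real.le_norm_self _).trans (norm_integral_le_of_norm_le (hΨ2.const_mul M)
          (Eventually.of_forall fun u => ?_))
        rw [norm_mul, Real.norm_eq_abs, abs_of_nonneg (sq_nonneg _), mul_comm]
        exact mul_le_mul_of_nonneg_right (hMG _) (sq_nonneg _)
      calc _ = (m n / a n) * ∫ u in Ioi (0 : ℝ), (K u * rvec p u i) ^ 2 * G (a n * u) := by
            field_simp
        _ ≤ (m n / a n) * (M * ∫ u in Ioi (0 : ℝ), (K u * rvec p u i) ^ 2) := by gcongr
        _ ≤ 1 * (M * ∫ u in Ioi (0 : ℝ), (K u * rvec p u i) ^ 2) := by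
            have hM0 : 0 ≤ M := (abs_nonneg _).trans (hMG 0)
            have : 0 ≤ ∫ u in Ioi (0 : ℝ), (K u * rvec p u i) ^ 2 :=
              integral_nonneg fun u => sq_nonneg _
            gcongr
            exact (div_le_one han).2 (hma n)
        _ = _ := one_mul _
  have hfun : (fun (n : ℕ) ω => ∑ k ∈ Finset.range n, φ n (Z k ω, Y k ω)) =
      fun (n : ℕ) ω => √(n * m n) *
        wmoment s K p (a n) n (fun k => Z k ω) (fun k => Y k ω - g (Z k ω)) i := by
    ext n ω
    rw [wmoment, Finset.sum_div, Finset.mul_sum]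
    refine Finset.sum_congr rfl fun k _ => ?_
    by_cases hz : Z k ω ∈ s
    · simp only [φ, weight, indicator_of_mem hz]
      rw [div_mul_eq_mul_div, ← div_div, div_right_comm]
      ring
    · simp [φ, weight, hz]
  rwa [hfun] at key

end OneSided

/-! ### Taylor remainders and asymptotic linearity -/

section Linearisation

variable {Ω : Type*} [MeasurableSpace Ω] {P : Measure Ω} [IsProbabilityMeasure P]
  {Z Y : ℕ → Ω → ℝ} {s : Set ℝ} {δ : ℝ} {g f G : ℝ → ℝ} {K : ℝ → ℝ} {κ : ℝ}
  {p q : ℕ} {h b : ℕ → ℝ} {ρ : ℝ}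

/-- Where the weight is nonzero, |z| ≤ κa, so the remainder is at most D(κa)^N. What is left is the
average weight, which converges in probability. -/
theorem abs_wmoment_le (hK : IsRDKernel K κ) {a δ D : ℝ} (ha : 0 < a) (haδ : κ * a < δ)
    (hD : 0 ≤ D) {N : ℕ} {R : ℝ → ℝ} (hR : ∀ z ∈ s, |z| < δ → |R z| ≤ D * |z| ^ N) (n r : ℕ)
    (z : ℕ → ℝ) (i : Fin (r + 1)) :
    |wmoment s K r a n z (fun k => R (z k)) i| ≤
      (κ ^ (i : ℕ) * D * κ ^ N * a ^ N) *
        ((∑ k ∈ Finset.range n, weight s K a (z k) * 1) / n) := by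
  have hκ := hK.pos
  rw [wmoment, abs_div, Nat.abs_cast, ← mul_div_assoc, Finset.mul_sum]
  refine div_le_div_of_nonneg_right ((Finset.abs_sum_le_sum_abs _ _).trans
    (Finset.sum_le_sum fun k _ => ?_)) n.cast_nonneg
  by_cases hz : z k ∈ s
  swap
  · simp [weight, hz]
  have hw : weight s K a (z k) = K (z k / a) / a := by simp [weight, hz]
  by_cases hk : K (z k / a) = 0
  · simp [hw, hk]
  have h1 := hK.abs_le_of_ne_zero hk
  have h2 : |z k| ≤ κ * a := by rwa [abs_div, abs_of_pos ha, div_le_iff₀ ha] at h1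
  have hw0 : 0 ≤ weight s K a (z k) := by rw [hw]; exact div_nonneg (hK.nonneg _) ha.le
  rw [abs_mul, abs_mul, abs_of_nonneg hw0, mul_one, mul_comm _ (weight s K a (z k))]
  refine mul_le_mul_of_nonneg_left ?_ hw0
  have h3 : |rvec r (z k / a) i| ≤ κ ^ (i : ℕ) := by
    rw [rvec, abs_pow]; exact pow_le_pow_left₀ (abs_nonneg _) h1 _
  have h4 : |R (z k)| ≤ D * (κ * a) ^ N :=
    (hR _ hz (h2.trans_lt haδ)).trans (by gcongr)
  calc _ ≤ κ ^ (i : ℕ) * (D * (κ * a) ^ N) := by gcongr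
    _ = _ := by rw [mul_pow]; ring

theorem tendstoInMeasure_remainder
    (hindep : iIndepFun (fun k ω => (Z k ω, Y k ω)) P)
    (hident : ∀ k, IdentDistrib (fun ω => (Z k ω, Y k ω)) (fun ω => (Z 0 ω, Y 0 ω)) P P)
    (hZ : Measurable (Z 0))
    (hs : Ioi 0 ⊆ s) (hs' : s ⊆ Ici 0) (hsm : MeasurableSet s)
    (hM : OneSidedModel P (Z 0) (Y 0) s δ g f G) (hK : IsRDKernel K κ)
    {a : ℕ → ℝ} (ha : ∀ n, 0 < a n)
    (ha0 : Tendsto a atTop (𝓝 0)) (han : Tendsto (fun n : ℕ => (n : ℝ) * a n) atTop atTop)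
    {D : ℝ} (hD : 0 ≤ D) {N : ℕ} {R : ℝ → ℝ} (hR : ∀ z ∈ s, |z| < δ → |R z| ≤ D * |z| ^ N)
    {t : ℕ → ℝ} (ht0 : ∀ n, 0 ≤ t n) (ht : Tendsto (fun n => t n * a n ^ N) atTop (𝓝 0))
    (r : ℕ) (i : Fin (r + 1)) :
    TendstoInMeasure P (fun (n : ℕ) ω => t n *
      wmoment s K r (a n) n (fun k => Z k ω) (fun k => R (Z k ω)) i) atTop
      (fun _ => (0 : ℝ)) := by
  have h1 := tendstoInMeasure_weightedMean (A := fun _ => 1) hindep hident hZ hs hs' hsm hM hK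
    ha ha0 han continuous_const
  have h2 : Tendsto (fun n => κ ^ (i : ℕ) * D * κ ^ N * (t n * a n ^ N)) atTop (𝓝 0) := by
    simpa using ht.const_mul (κ ^ (i : ℕ) * D * κ ^ N)
  have h3 := (BoundedInProb.of_tendstoInMeasure h1).mul_tendsto_zero
    (tendstoInMeasure_of_tendsto_const (P := P) h2)
  refine TendstoInMeasure.of_abs_le h3 ?_
  have hsmall : ∀ᶠ n in atTop, κ * a n < δ := by
    have : Tendsto (fun n => κ * a n) atTop (𝓝 0) := by simpa using ha0.const_mul κ
    exact this.eventually (gt_mem_nhds hM.δ_pos)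
  filter_upwards [hsmall] with n hn ω
  rw [abs_mul, abs_of_nonneg (ht0 n)]
  refine (mul_le_mul_of_nonneg_left (abs_wmoment_le hK (ha n) hn hD hR n r (fun k => Z k ω) i)
    (ht0 n)).trans (le_trans (le_of_eq ?_) (le_abs_self _))
  ring

theorem sum_inv_mul_wmoment {r j : ℕ} (hj : j < r + 1) (a : ℝ) (n : ℕ) (z e : ℕ → ℝ) :
    ∑ i, (limGram K r)⁻¹ ⟨j, hj⟩ i * wmoment s K r a n z e i =
      (∑ k ∈ Finset.range n,
        s.indicator (fun z => equivKernel K r j (z / a)) (z k) / a * e k) / n := by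
  simp only [wmoment, ← mul_div_assoc, ← Finset.sum_div, Finset.mul_sum]
  rw [Finset.sum_comm]
  congr 1
  refine Finset.sum_congr rfl fun k _ => ?_
  by_cases hz : z k ∈ s
  · simp only [weight, indicator_of_mem hz]
    rw [equivKernel_eq hj, Finset.mul_sum, Finset.sum_div, Finset.sum_mul]
    refine Finset.sum_congr rfl fun i _ => ?_
    rw [rvec]; ring
  · simp [weight, hz]

/-- Both noise moments are merged into one kernel on the scale h, using z/b = (h/b)(z/h).
Normalising by 1/h instead of 1/b costs another factor h/b, which is why the exponent is p+1 here
and p+2 in `bcKernel`. -/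
theorem sum_score_eq (hpq : p < q) {h b : ℝ} (hh : h ≠ 0) (hb : b ≠ 0) (n : ℕ) (f₀ : ℝ)
    (z y : ℕ → ℝ) :
    ∑ k ∈ Finset.range n, score s K p q h b n g f₀ (z k, y k) =
      ∑ i, f₀⁻¹ * (limGram K p)⁻¹ ⟨0, Nat.succ_pos p⟩ i *
        (√(n * min h b) * wmoment s K p h n z (fun k => y k - g (z k)) i) -
      ∑ i, (h / b) ^ (p + 1) * (limBiasFactor K p (p + 1) *
        (f₀⁻¹ * (limGram K q)⁻¹ ⟨p + 1, by omega⟩ i)) *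
        (√(n * min h b) * wmoment s K q b n z (fun k => y k - g (z k)) i) := by
  have h1 : ∑ i, f₀⁻¹ * (limGram K p)⁻¹ ⟨0, Nat.succ_pos p⟩ i *
        (√(n * min h b) * wmoment s K p h n z (fun k => y k - g (z k)) i) =
      f₀⁻¹ * √(n * min h b) * ∑ i, (limGram K p)⁻¹ ⟨0, Nat.succ_pos p⟩ i *
        wmoment s K p h n z (fun k => y k - g (z k)) i := by
    rw [Finset.mul_sum]; exact Finset.sum_congr rfl fun i _ => by ring
  have h2 : ∑ i, (h / b) ^ (p + 1) * (limBiasFactor K p (p + 1) *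
        (f₀⁻¹ * (limGram K q)⁻¹ ⟨p + 1, by omega⟩ i)) *
        (√(n * min h b) * wmoment s K q b n z (fun k => y k - g (z k)) i) =
      (h / b) ^ (p + 1) * limBiasFactor K p (p + 1) * f₀⁻¹ * √(n * min h b) *
        ∑ i, (limGram K q)⁻¹ ⟨p + 1, by omega⟩ i *
          wmoment s K q b n z (fun k => y k - g (z k)) i := by
    rw [Finset.mul_sum]; exact Finset.sum_congr rfl fun i _ => by ring
  rw [h1, h2, sum_inv_mul_wmoment, sum_inv_mul_wmoment, Finset.sum_div, Finset.sum_div,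
    Finset.mul_sum, Finset.mul_sum, ← Finset.sum_sub_distrib]
  refine Finset.sum_congr rfl fun k _ => ?_
  rw [score]
  by_cases hz : z k ∈ s
  · simp only [indicator_of_mem hz, bcKernel]
    have e : h / b * (z k / h) = z k / b := by field_simp
    rw [e, pow_succ (h / b) (p + 1)]
    simp only [div_eq_mul_inv, mul_inv]
    have e2 : h * h⁻¹ = 1 := mul_inv_cancel₀ hh
    linear_combination (-(√(n * min h b) * (n : ℝ)⁻¹ * f₀⁻¹ * (h * b⁻¹) ^ (p + 1) * b⁻¹ *
      limBiasFactor K p (p + 1) * equivKernel K q (p + 1) (z k * b⁻¹) * (y k - g (z k)))) * e2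
  · simp [hz]

/-- Here A stands for random weights and α for their limits, R for Taylor remainders, E for noise, B
for the bias factor and B₀ for its limit; primes mark the order-q fit. Each sum on the right is a
bounded factor times a vanishing one. -/
theorem linearisation_error_eq {m l : ℕ} (A R E α : Fin m → ℝ) (A' R' E' α' : Fin l → ℝ)
    (t r B B₀ : ℝ) :
    t * (∑ i, A i * R i + ∑ i, A i * E i - r * B * (∑ i, A' i * R' i + ∑ i, A' i * E' i)) -
      (∑ i, α i * (t * E i) - ∑ i, r * (B₀ * α' i) * (t * E' i)) =
    ∑ i, A i * (t * R i) + ∑ i, t * E i * (A i - α i) + -∑ i, B * A' i * (t * r * R' i) +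
      -∑ i, t * E' i * (r * (B * A' i - B₀ * α' i)) := by
  have e1 : ∑ i, A i * (t * R i) = t * ∑ i, A i * R i := by
    rw [Finset.mul_sum]; exact Finset.sum_congr rfl fun i _ => by ring
  have e2 : ∑ i, t * E i * (A i - α i) = t * ∑ i, A i * E i - ∑ i, α i * (t * E i) := by
    rw [Finset.mul_sum, ← Finset.sum_sub_distrib]
    exact Finset.sum_congr rfl fun i _ => by ring
  have e3 : ∑ i, B * A' i * (t * r * R' i) = t * r * B * ∑ i, A' i * R' i := by
    rw [Finset.mul_sum]; exact Finset.sum_congr rfl fun i _ => by ring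
  have e4 : ∑ i, t * E' i * (r * (B * A' i - B₀ * α' i)) =
      t * r * B * ∑ i, A' i * E' i - ∑ i, r * (B₀ * α' i) * (t * E' i) := by
    rw [Finset.mul_sum, ← Finset.sum_sub_distrib]
    exact Finset.sum_congr rfl fun i _ => by ring
  rw [e1, e2, e3, e4]
  ring

/-- Asymptotic linearity of the one-sided bias-corrected local polynomial estimator. -/
theorem bcEst_asymptotically_linear
    (hindep : iIndepFun (fun k ω => (Z k ω, Y k ω)) P)
    (hident : ∀ k, IdentDistrib (fun ω => (Z k ω, Y k ω)) (fun ω => (Z 0 ω, Y 0 ω)) P P)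
    (hZ : Measurable (Z 0)) (hY : Measurable (Y 0))
    (hs : Ioi 0 ⊆ s) (hs' : s ⊆ Ici 0) (hsm : MeasurableSet s)
    (hM : OneSidedModel P (Z 0) (Y 0) s δ g f G) (hK : IsRDKernel K κ)
    (hpq : p < q) (H : BandwidthConditions p q h b ρ) (c : ℕ → ℝ) {D : ℝ} (hD : 0 ≤ D)
    (hTp : ∀ z ∈ s, |z| < δ →
      |g z - ∑ j ∈ Finset.range (p + 2), c j * z ^ j| ≤ D * |z| ^ (p + 2))
    (hTq : ∀ z ∈ s, |z| < δ →
      |g z - ∑ j ∈ Finset.range (q + 1), c j * z ^ j| ≤ D * |z| ^ (q + 1)) :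
    TendstoInMeasure P (fun (n : ℕ) ω =>
      √(n * min (h n) (b n)) *
        (bcEst s K p q (h n) (b n) n (fun k => Z k ω) (fun k => Y k ω) - c 0) -
      ∑ k ∈ Finset.range n, score s K p q (h n) (b n) n g (f 0) (Z k ω, Y k ω)) atTop
      (fun _ => (0 : ℝ)) := by
  have hp0 : 0 < p + 1 := Nat.succ_pos p
  have hq1 : p + 1 < q + 1 := by omega
  set rt : ℕ → ℝ := fun n => √(n * min (h n) (b n)) with hrt
  have hrt0 : ∀ n, 0 ≤ rt n := fun n => Real.sqrt_nonneg _
  have hgp := tendstoInMeasure_gram_inv hindep hident hZ hs hs' hsm hM hK H.h_pos H.h_tendsto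
    H.nh_tendsto p
  have hgq := tendstoInMeasure_gram_inv hindep hident hZ hs hs' hsm hM hK H.b_pos H.b_tendsto
    H.nb_tendsto q
  have hB := tendstoInMeasure_biasFactor hindep hident hZ hs hs' hsm hM hK H.h_pos H.h_tendsto
    H.nh_tendsto p (p + 1)
  have hratio : TendstoInMeasure P (fun (n : ℕ) (_ : Ω) => (h n / b n) ^ (p + 1)) atTop
      (fun _ => ρ ^ (p + 1)) := tendstoInMeasure_of_tendsto_const (H.ratio_tendsto.pow _)
  have hnp := boundedInProb_noise hindep hident hZ hY hs hs' hsm hM hK H.h_pos H.h_tendsto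
    H.min_pos (fun n => min_le_left _ _) p
  have hnq := boundedInProb_noise hindep hident hZ hY hs hs' hsm hM hK H.b_pos H.b_tendsto
    H.min_pos (fun n => min_le_right _ _) q
  -- The remainder has order p+2, not p+1, since the degree p+1 term belongs to the bias correction.
  have hRp := tendstoInMeasure_remainder hindep hident hZ hs hs' hsm hM hK H.h_pos H.h_tendsto
    H.nh_tendsto hD hTp hrt0 (by
      refine (H.bias_sqrt_tendsto (x := h) (fun n => (H.h_pos n).le)
        (fun n => le_max_left _ _)).congr fun n => ?_
      rw [pow_succ (h n) (p + 1)]) p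
  -- The factor (h/b)^(p+1) is absorbed into t: together with b^(q+1) it gives h^(p+1) b^(q-p).
  have hRq := tendstoInMeasure_remainder hindep hident hZ hs hs' hsm hM hK H.b_pos H.b_tendsto
    H.nb_tendsto hD hTq (t := fun n => rt n * (h n / b n) ^ (p + 1))
    (fun n => mul_nonneg (hrt0 n) (pow_nonneg (H.ratio_nonneg n) _)) (by
      refine (H.bias_sqrt_tendsto (x := fun n => b n ^ (q - p)) (fun n => pow_nonneg (H.b_pos n).le _)
        (fun n => by rw [← pow_mul, mul_comm]; exact le_max_right _ _)).congr fun n => ?_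
      have hb := (H.b_pos n).ne'
      have e : b n ^ (q + 1) = b n ^ (p + 1) * b n ^ (q - p) := by
        rw [← pow_add]; congr 1; omega
      rw [div_pow, e]
      field_simp
      exact mul_comm _ _) q
  -- the four negligible terms
  have T1 : TendstoInMeasure P (fun (n : ℕ) ω => ∑ i,
      (gram s K p (h n) n (fun k => Z k ω))⁻¹ ⟨0, hp0⟩ i *
      (rt n * wmoment s K p (h n) n (fun k => Z k ω)
        (fun k => g (Z k ω) - ∑ j ∈ Finset.range (p + 2), c j * Z k ω ^ j) i)) atTop
      (fun _ => (0 : ℝ)) :=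
    TendstoInMeasure.finset_sum_zero _ fun i _ =>
      (BoundedInProb.of_tendstoInMeasure (hgp ⟨0, hp0⟩ i)).mul_tendsto_zero (hRp i)
  have T2 : TendstoInMeasure P (fun (n : ℕ) ω => ∑ i,
      (biasFactor s K p (p + 1) (h n) n (fun k => Z k ω) *
        (gram s K q (b n) n (fun k => Z k ω))⁻¹ ⟨p + 1, hq1⟩ i) *
      (rt n * (h n / b n) ^ (p + 1) * wmoment s K q (b n) n (fun k => Z k ω)
        (fun k => g (Z k ω) - ∑ j ∈ Finset.range (q + 1), c j * Z k ω ^ j) i)) atTop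
      (fun _ => (0 : ℝ)) :=
    TendstoInMeasure.finset_sum_zero _ fun i _ =>
      (BoundedInProb.of_tendstoInMeasure (hB.mul_const_limit (hgq ⟨p + 1, hq1⟩ i))).mul_tendsto_zero
        (hRq i)
  have hsub : ∀ {X : ℕ → Ω → ℝ} {x : ℝ}, TendstoInMeasure P X atTop (fun _ => x) →
      TendstoInMeasure P (fun n ω => X n ω - x) atTop (fun _ => (0 : ℝ)) := by
    intro X x hX
    have := TendstoInMeasure.add_const hX
      (tendstoInMeasure_of_tendsto_const (P := P) (tendsto_const_nhds (x := -x)))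
    simpa [sub_eq_add_neg] using this
  have T3 : TendstoInMeasure P (fun (n : ℕ) ω => ∑ i,
      (rt n * wmoment s K p (h n) n (fun k => Z k ω) (fun k => Y k ω - g (Z k ω)) i) *
      ((gram s K p (h n) n (fun k => Z k ω))⁻¹ ⟨0, hp0⟩ i -
        (f 0)⁻¹ * (limGram K p)⁻¹ ⟨0, hp0⟩ i)) atTop (fun _ => (0 : ℝ)) :=
    TendstoInMeasure.finset_sum_zero _ fun i _ => (hnp i).mul_tendsto_zero (hsub (hgp _ i))
  have T4 : TendstoInMeasure P (fun (n : ℕ) ω => ∑ i,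
      (rt n * wmoment s K q (b n) n (fun k => Z k ω) (fun k => Y k ω - g (Z k ω)) i) *
      ((h n / b n) ^ (p + 1) * (biasFactor s K p (p + 1) (h n) n (fun k => Z k ω) *
        (gram s K q (b n) n (fun k => Z k ω))⁻¹ ⟨p + 1, hq1⟩ i -
        limBiasFactor K p (p + 1) * ((f 0)⁻¹ * (limGram K q)⁻¹ ⟨p + 1, hq1⟩ i)))) atTop
      (fun _ => (0 : ℝ)) := by
    refine TendstoInMeasure.finset_sum_zero _ fun i _ => (hnq i).mul_tendsto_zero ?_
    have := hratio.mul_const_limit (hsub (hB.mul_const_limit (hgq ⟨p + 1, hq1⟩ i)))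
    rwa [mul_zero] at this
  have hneg : ∀ {X : ℕ → Ω → ℝ}, TendstoInMeasure P X atTop (fun _ => (0 : ℝ)) →
      TendstoInMeasure P (fun n ω => -X n ω) atTop (fun _ => (0 : ℝ)) := fun hX =>
    TendstoInMeasure.of_abs_le hX (Eventually.of_forall fun n ω => (abs_neg _).le)
  have Tsum := ((T1.add_const T3).add_const (hneg T2)).add_const (hneg T4)
  simp only [add_zero] at Tsum
  have hsing := (tendsto_prob_gram_singular hindep hident hZ hs hs' hsm hM hK H.h_pos H.h_tendsto
    H.nh_tendsto p).add (tendsto_prob_gram_singular hindep hident hZ hs hs' hsm hM hK H.b_pos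
    H.b_tendsto H.nb_tendsto q)
  rw [add_zero] at hsing
  -- Where both Gram matrices are invertible, the error equals the sum of the four terms exactly.
  refine TendstoInMeasure.congr_eventually (A := fun n =>
    {ω | (gram s K p (h n) n (fun k => Z k ω)).det = 0} ∪
    {ω | (gram s K q (b n) n (fun k => Z k ω)).det = 0}) Tsum
    (squeeze_zero (fun _ => measureReal_nonneg) (fun n => measureReal_union_le _ _) hsing)
    (Eventually.of_forall fun n ω hω => ?_)
  simp only [mem_union, mem_ofPred_eq, not_or] at hω
  have hy : (fun k => Y k ω) = fun k => g (Z k ω) + (Y k ω - g (Z k ω)) := by ext k; ring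
  rw [sum_score_eq hpq (H.h_pos n).ne' (H.b_pos n).ne']
  conv_lhs => rw [hy]
  rw [bcEst_sub_eq hpq (H.h_pos n).ne' (H.b_pos n).ne' (fun k => Z k ω) c (fun k => g (Z k ω))
    (fun k => Y k ω - g (Z k ω)) (isUnit_iff_ne_zero.2 hω.1) (isUnit_iff_ne_zero.2 hω.2)]
  exact linearisation_error_eq _ _ _ _ _ _ _ _ _ _ _ _

end Linearisation

/-! ### From regression functions to the one-sided model -/

section Regression

variable {Ω : Type*} [MeasurableSpace Ω] {P : Measure Ω} [IsProbabilityMeasure P]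

/-- Iterated expectations. -/
theorem IsRegressionOn.integral_mul {Z X : Ω → ℝ} {g : ℝ → ℝ} {U : Set ℝ}
    (hreg : IsRegressionOn P Z X g U) (hZ : Measurable Z) (hU : MeasurableSet U) {ψ : ℝ → ℝ}
    (hψ : Measurable ψ) {C : ℝ} (hC : ∀ z, |ψ z| ≤ C) (hψU : ∀ z, ψ z ≠ 0 → z ∈ U) :
    Integrable (fun ω => ψ (Z ω) * X ω) P ∧ Integrable (fun ω => ψ (Z ω) * g (Z ω)) P ∧
    ∫ ω, ψ (Z ω) * X ω ∂P = ∫ ω, ψ (Z ω) * g (Z ω) ∂P := by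
  have hZU : MeasurableSet (Z ⁻¹' U) := hZ hU
  set μ := P.restrict (Z ⁻¹' U) with hμ
  have hm : MeasurableSpace.comap Z inferInstance ≤ (inferInstance : MeasurableSpace Ω) :=
    hZ.comap_le
  have hzero : ∀ (X' : Ω → ℝ) ω, ω ∉ Z ⁻¹' U → ψ (Z ω) * X' ω = 0 := fun X' ω hω => by
    have : ψ (Z ω) = 0 := by
      by_contra hne
      exact hω (hψU _ hne)
    rw [this, zero_mul]
  have hX : Integrable X μ := hreg.integrableOn
  have hψZ : StronglyMeasurable[MeasurableSpace.comap Z inferInstance] fun ω => ψ (Z ω) :=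
    (hψ.comp (comap_measurable Z)).stronglyMeasurable
  have hbd : ∀ {X' : Ω → ℝ}, Integrable X' μ → Integrable (fun ω => ψ (Z ω) * X' ω) μ :=
    fun hX' => hX'.bdd_mul (hψ.comp hZ).aestronglyMeasurable
      (Eventually.of_forall fun ω => hC _)
  have hgZ : Integrable (fun ω => g (Z ω)) μ := integrable_condExp.congr hreg.condExp_eq
  have hon : ∀ {X' : Ω → ℝ}, Integrable X' μ → Integrable (fun ω => ψ (Z ω) * X' ω) P :=
    fun {X'} hX' => integrableOn_iff_integrable_of_support_subset (s := Z ⁻¹' U) (fun ω hω => by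
      by_contra hcon
      exact hω (hzero X' ω hcon)) |>.1 (hbd hX')
  refine ⟨hon hX, hon hgZ, ?_⟩
  rw [← setIntegral_eq_integral_of_forall_compl_eq_zero (hzero X),
    ← setIntegral_eq_integral_of_forall_compl_eq_zero (hzero fun ω => g (Z ω))]
  have h1 := condExp_mul_of_stronglyMeasurable_left hψZ (hbd hX) hX
  calc ∫ ω, ψ (Z ω) * X ω ∂μ
      = ∫ ω, (μ[(fun ω => ψ (Z ω)) * X | MeasurableSpace.comap Z inferInstance]) ω ∂μ :=
        (integral_condExp hm).symm
    _ = ∫ ω, ψ (Z ω) * g (Z ω) ∂μ := by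
        refine integral_congr_ae ?_
        filter_upwards [h1, hreg.condExp_eq] with ω hω hω'
        rw [hω, Pi.mul_apply, hω']

omit [IsProbabilityMeasure P] in
theorem integral_comp_eq_of_density {Z : Ω → ℝ} (hZ : Measurable Z) {f : ℝ → ℝ} {U : Set ℝ}
    (hU : MeasurableSet U)
    (hdens : (P.map Z).restrict U = (volume.restrict U).withDensity fun z => ENNReal.ofReal (f z))
    (hf : AEMeasurable f (volume.restrict U)) (hf0 : ∀ z ∈ U, 0 ≤ f z) {F : ℝ → ℝ}
    (hF : Measurable F) (hFU : ∀ z, F z ≠ 0 → z ∈ U) :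
    ∫ ω, F (Z ω) ∂P = ∫ z, F z * f z := by
  have hz : ∀ z, z ∉ U → F z = 0 := fun z hz => by
    by_contra hne
    exact hz (hFU z hne)
  rw [← integral_map hZ.aemeasurable hF.aestronglyMeasurable,
    ← setIntegral_eq_integral_of_forall_compl_eq_zero hz, hdens,
    integral_withDensity_eq_integral_toReal_smul₀ hf.ennreal_ofReal
      (Eventually.of_forall fun _ => ENNReal.ofReal_lt_top),
    ← setIntegral_eq_integral_of_forall_compl_eq_zero (s := U) (f := fun z => F z * f z)
      (fun z h => by rw [hz z h, zero_mul])]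
  refine setIntegral_congr_fun hU fun z hzU => ?_
  simp only [smul_eq_mul]
  rw [ENNReal.toReal_ofReal (hf0 z hzU), mul_comm]

theorem measurable_indicator_of_continuousOn {f : ℝ → ℝ} {U V : Set ℝ} (hf : ContinuousOn f U)
    (hVU : V ⊆ U) (hV : MeasurableSet V) : Measurable (V.indicator f) := by
  classical
  rw [← piecewise_eq_indicator]
  exact (hf.mono hVU).measurable_piecewise continuousOn_const hV

/-- Halving the radius places the window inside a compact subset of the neighbourhood, where
continuous functions are bounded. Truncating f and vf to the window makes them globally measurable
and bounded, and test functions do not see the difference. -/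
theorem OneSidedModel.of_regression {Z Y X₁ X₀ : Ω → ℝ} {m₁ m₀ v f g₄ : ℝ → ℝ} {s : Set ℝ}
    {κ₀ M : ℝ} (hκ₀ : 0 < κ₀) (hZ : Measurable Z)
    (h₁ : IsRegressionOn P Z X₁ m₁ (nbhd κ₀)) (h₀ : IsRegressionOn P Z X₀ m₀ (nbhd κ₀))
    (hY : ∀ᵐ ω ∂P, Z ω ∈ nbhd κ₀ → Z ω ∈ s → Y ω = X₁ ω - X₀ ω) (hYm : Measurable Y)
    (hv : IsRegressionOn P Z (fun ω => (X₁ ω - X₀ ω - (m₁ (Z ω) - m₀ (Z ω))) ^ 2) v (nbhd κ₀))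
    (h₄ : IsRegressionOn P Z (fun ω => Y ω ^ 4) g₄ (nbhd κ₀)) (hM : ∀ z ∈ nbhd κ₀, g₄ z ≤ M)
    (hdens : (P.map Z).restrict (nbhd κ₀) =
      (volume.restrict (nbhd κ₀)).withDensity fun z => ENNReal.ofReal (f z))
    (hf : ContinuousOn f (nbhd κ₀)) (hfpos : ∃ a > 0, ∀ z ∈ nbhd κ₀, a ≤ f z)
    (hvc : ContinuousOn v (nbhd κ₀)) (hg : ContinuousOn (fun z => m₁ z - m₀ z) (nbhd κ₀)) :
    OneSidedModel P Z Y s (κ₀ / 2) (fun z => m₁ z - m₀ z)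
      ((Ioo (-(κ₀ / 2)) (κ₀ / 2)).indicator f)
      ((Ioo (-(κ₀ / 2)) (κ₀ / 2)).indicator fun z => v z * f z) := by
  set V := Ioo (-(κ₀ / 2)) (κ₀ / 2) with hVdef
  have hUm : MeasurableSet (nbhd κ₀) := measurableSet_Ioo
  have hVm : MeasurableSet V := measurableSet_Ioo
  have hcompact : Icc (-(κ₀ / 2)) (κ₀ / 2) ⊆ nbhd κ₀ := fun z hz =>
    ⟨by linarith [hz.1], by linarith [hz.2]⟩
  have hVU : V ⊆ nbhd κ₀ := Ioo_subset_Icc_self.trans hcompact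
  have hV0 : V ∈ 𝓝 (0 : ℝ) := Ioo_mem_nhds (by linarith) (by linarith)
  have hU0 : nbhd κ₀ ∈ 𝓝 (0 : ℝ) := Ioo_mem_nhds (by linarith) (by linarith)
  have h0V : (0 : ℝ) ∈ V := mem_of_mem_nhds hV0
  obtain ⟨a, ha, hfa⟩ := hfpos
  have hbounded : ∀ {F : ℝ → ℝ}, ContinuousOn F (nbhd κ₀) →
      ∃ C, 0 ≤ C ∧ (∀ z ∈ V, |F z| ≤ C) ∧ ∀ z, |V.indicator F z| ≤ C := by
    intro F hF
    obtain ⟨C, hC⟩ := isCompact_Icc.exists_bound_of_continuousOn (hF.mono hcompact)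
    have h1 : ∀ z ∈ V, |F z| ≤ |C| := fun z hz =>
      (hC z (Ioo_subset_Icc_self hz)).trans (le_abs_self C)
    refine ⟨|C|, abs_nonneg C, h1, fun z => ?_⟩
    by_cases hz : z ∈ V
    · rw [indicator_of_mem hz]; exact h1 z hz
    · rw [indicator_of_notMem hz, abs_zero]; exact abs_nonneg C
  have hcont : ∀ {F : ℝ → ℝ}, ContinuousOn F (nbhd κ₀) → ContinuousAt (V.indicator F) 0 := by
    intro F hF
    refine (hF.continuousAt hU0).congr ?_
    filter_upwards [hV0] with z hz
    rw [indicator_of_mem hz]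
  have htV : ∀ {ψ : ℝ → ℝ}, IsLocalTest s (κ₀ / 2) ψ → ∀ z, ψ z ≠ 0 → z ∈ V := fun hψ z hz =>
    abs_lt.1 (hψ.support z hz).2
  have hind : ∀ {ψ : ℝ → ℝ} (F : ℝ → ℝ), IsLocalTest s (κ₀ / 2) ψ →
      ∀ z, ψ z * V.indicator F z = ψ z * F z := by
    intro ψ F hψ z
    by_cases hz : ψ z = 0
    · simp [hz]
    · rw [indicator_of_mem (htV hψ z hz)]
  have hfm : AEMeasurable f (volume.restrict (nbhd κ₀)) := hf.aemeasurable hUm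
  have hdensity : ∀ {F : ℝ → ℝ}, Measurable F → (∀ z, F z ≠ 0 → z ∈ V) →
      ∫ ω, F (Z ω) ∂P = ∫ z, F z * f z := fun hF hFV =>
    integral_comp_eq_of_density hZ hUm hdens hfm (fun z hz => ha.le.trans (hfa z hz)) hF
      fun z hz => hVU (hFV z hz)
  have hYtest : ∀ {ψ : ℝ → ℝ}, IsLocalTest s (κ₀ / 2) ψ →
      ∀ᵐ ω ∂P, ψ (Z ω) ≠ 0 → Y ω = X₁ ω - X₀ ω := by
    intro ψ hψ
    filter_upwards [hY] with ω hω hne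
    exact hω (hVU (htV hψ _ hne)) (hψ.support _ hne).1
  obtain ⟨Cf, hCf0, hCf, hCf'⟩ := hbounded hf
  obtain ⟨Cg, hCg0, hCg, -⟩ := hbounded hg
  have hdens' : ∀ ψ, IsLocalTest s (κ₀ / 2) ψ → ∫ ω, ψ (Z ω) ∂P = ∫ z, ψ z * V.indicator f z := by
    intro ψ hψ
    simp only [hind f hψ]
    exact hdensity hψ.measurable (htV hψ)
  refine
    { δ_pos := half_pos hκ₀
      measurable_g := h₁.measurable.sub h₀.measurable
      measurable_f := measurable_indicator_of_continuousOn hf hVU hVm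
      measurable_G := measurable_indicator_of_continuousOn (hvc.mul hf) hVU hVm
      bounded_f := ⟨Cf, hCf'⟩
      bounded_G := (hbounded (hvc.mul hf)).imp fun C hC => hC.2.2
      continuousAt_f := hcont hf
      continuousAt_G := hcont (hvc.mul hf)
      f_pos := by rw [indicator_of_mem h0V]; exact ha.trans_le (hfa 0 (hVU h0V))
      density := hdens'
      mean := ?_
      second := ?_
      fourth := ?_ }
  · intro ψ hψ
    obtain ⟨C, hC⟩ := hψ.bounded
    have hψU : ∀ z, ψ z ≠ 0 → z ∈ nbhd κ₀ := fun z hz => hVU (htV hψ z hz)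
    obtain ⟨a1, a2, a3⟩ := h₁.integral_mul hZ hUm hψ.measurable hC hψU
    obtain ⟨b1, b2, b3⟩ := h₀.integral_mul hZ hUm hψ.measurable hC hψU
    have e : ∫ ω, ψ (Z ω) * (Y ω - (m₁ (Z ω) - m₀ (Z ω))) ∂P =
        ∫ ω, (ψ (Z ω) * X₁ ω - ψ (Z ω) * X₀ ω) - (ψ (Z ω) * m₁ (Z ω) - ψ (Z ω) * m₀ (Z ω)) ∂P := by
      refine integral_congr_ae ?_
      filter_upwards [hYtest hψ] with ω hω
      by_cases hz : ψ (Z ω) = 0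
      · simp [hz]
      · rw [hω hz]; ring
    have ab₁ : Integrable (fun ω => ψ (Z ω) * X₁ ω - ψ (Z ω) * X₀ ω) P := a1.sub b1
    have ab₂ : Integrable (fun ω => ψ (Z ω) * m₁ (Z ω) - ψ (Z ω) * m₀ (Z ω)) P := a2.sub b2
    rw [e, integral_sub ab₁ ab₂, integral_sub a1 b1, integral_sub a2 b2, a3, b3,
      sub_self]
  · intro ψ hψ
    obtain ⟨C, hC⟩ := hψ.bounded
    have hψU : ∀ z, ψ z ≠ 0 → z ∈ nbhd κ₀ := fun z hz => hVU (htV hψ z hz)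
    obtain ⟨-, -, a3⟩ := hv.integral_mul hZ hUm hψ.measurable hC hψU
    have e : ∫ ω, ψ (Z ω) * (Y ω - (m₁ (Z ω) - m₀ (Z ω))) ^ 2 ∂P =
        ∫ ω, ψ (Z ω) * (X₁ ω - X₀ ω - (m₁ (Z ω) - m₀ (Z ω))) ^ 2 ∂P := by
      refine integral_congr_ae ?_
      filter_upwards [hYtest hψ] with ω hω
      by_cases hz : ψ (Z ω) = 0
      · simp [hz]
      · rw [hω hz]
    rw [e, a3]
    simp only [hind (fun z => v z * f z) hψ]
    rw [hdensity (F := fun z => ψ z * v z) (hψ.measurable.mul hv.measurable)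
      fun z hz => htV hψ z (left_ne_zero_of_mul hz)]
    exact integral_congr_ae (Eventually.of_forall fun z => by simp only; ring)
  -- The moment assumption concerns Y, not the error. The constant comes from (y-x)⁴ ≤ 8y⁴ + 8x⁴
  -- with |x| ≤ Cg, and Cf bounds the density when passing to Lebesgue measure.
  · refine ⟨(8 * |M| + 8 * Cg ^ 4) * Cf, fun ψ hψ hψ0 => ?_⟩
    obtain ⟨C, hC⟩ := hψ.bounded
    have hψU : ∀ z, ψ z ≠ 0 → z ∈ nbhd κ₀ := fun z hz => hVU (htV hψ z hz)
    obtain ⟨a1, a2, a3⟩ := h₄.integral_mul hZ hUm hψ.measurable hC hψU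
    have hψint : Integrable (fun ω => ψ (Z ω)) P :=
      Integrable.of_bound (hψ.measurable.comp hZ).aestronglyMeasurable C
        (Eventually.of_forall fun ω => hC _)
    have hpt : ∀ ω, ψ (Z ω) * (Y ω - (m₁ (Z ω) - m₀ (Z ω))) ^ 4 ≤
        8 * (ψ (Z ω) * Y ω ^ 4) + 8 * Cg ^ 4 * ψ (Z ω) := by
      intro ω
      by_cases hz : ψ (Z ω) = 0
      · simp [hz]
      have h1 := hCg _ (htV hψ _ hz)
      set x := m₁ (Z ω) - m₀ (Z ω)
      have h2 : x ^ 4 ≤ Cg ^ 4 := by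
        rw [← Even.pow_abs (by decide : Even 4) x]; exact pow_le_pow_left₀ (abs_nonneg _) h1 4
      have h3 : (Y ω - x) ^ 4 ≤ 8 * Y ω ^ 4 + 8 * x ^ 4 := by
        nlinarith [sq_nonneg (Y ω + x), sq_nonneg (Y ω ^ 2 - x ^ 2), sq_nonneg ((Y ω + x) ^ 2),
          sq_nonneg (Y ω * (Y ω + x)), sq_nonneg (x * (Y ω + x)), sq_nonneg (Y ω ^ 2 + x ^ 2),
          sq_nonneg (Y ω - x), mul_nonneg (sq_nonneg (Y ω + x)) (sq_nonneg (Y ω - x))]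
      calc _ ≤ ψ (Z ω) * (8 * Y ω ^ 4 + 8 * Cg ^ 4) :=
            mul_le_mul_of_nonneg_left (by linarith) (hψ0 _)
        _ = _ := by ring
    have hdom := (a1.const_mul 8).add (hψint.const_mul (8 * Cg ^ 4))
    have hint : Integrable (fun ω => ψ (Z ω) * (Y ω - (m₁ (Z ω) - m₀ (Z ω))) ^ 4) P := by
      refine hdom.mono' ((hψ.measurable.comp hZ).mul ((hYm.sub ((h₁.measurable.comp hZ).sub
        (h₀.measurable.comp hZ))).pow_const 4)).aestronglyMeasurable
        (Eventually.of_forall fun ω => ?_)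
      rw [Real.norm_eq_abs, abs_of_nonneg (mul_nonneg (hψ0 _) (by positivity))]
      exact hpt ω
    refine ⟨hint, (integral_mono hint hdom hpt).trans ?_⟩
    simp only [Pi.add_apply]
    rw [integral_add (a1.const_mul 8) (hψint.const_mul _), integral_const_mul, integral_const_mul,
      a3]
    have h5 : ∫ ω, ψ (Z ω) * g₄ (Z ω) ∂P ≤ |M| * ∫ ω, ψ (Z ω) ∂P := by
      rw [← integral_const_mul]
      refine integral_mono a2 (hψint.const_mul _) fun ω => ?_
      simp only
      by_cases hz : ψ (Z ω) = 0
      · simp [hz]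
      · rw [mul_comm |M|]
        exact mul_le_mul_of_nonneg_left ((hM _ (hψU _ hz)).trans (le_abs_self M)) (hψ0 _)
    have hψvol : Integrable ψ := by
      have h6 : IntegrableOn ψ V :=
        Integrable.of_bound hψ.measurable.aestronglyMeasurable C (Eventually.of_forall hC)
      exact (integrableOn_iff_integrable_of_support_subset fun z hz => htV hψ z hz).1 h6
    have h7 : ∫ ω, ψ (Z ω) ∂P ≤ Cf * ∫ z, ψ z := by
      rw [hdens' ψ hψ, ← integral_const_mul]
      refine integral_mono_of_nonneg (Eventually.of_forall fun z => ?_) (hψvol.const_mul _)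
        (Eventually.of_forall fun z => ?_)
      · refine mul_nonneg (hψ0 z) (indicator_nonneg (fun z hz => ha.le.trans (hfa z (hVU hz))) z)
      · simp only
        rw [mul_comm Cf]
        exact mul_le_mul_of_nonneg_left ((le_abs_self _).trans (hCf' z)) (hψ0 z)
    calc _ ≤ 8 * (|M| * ∫ ω, ψ (Z ω) ∂P) + 8 * Cg ^ 4 * ∫ ω, ψ (Z ω) ∂P := by gcongr
      _ = (8 * |M| + 8 * Cg ^ 4) * ∫ ω, ψ (Z ω) ∂P := by ring
      _ ≤ (8 * |M| + 8 * Cg ^ 4) * (Cf * ∫ z, ψ z) := by gcongr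
      _ = _ := by ring

omit [IsProbabilityMeasure P] in
/-- Reflection of the running variable at the cutoff. -/
theorem OneSidedModel.neg {Z Y : Ω → ℝ} {s s' : Set ℝ} {δ : ℝ} {g f G : ℝ → ℝ}
    (hM : OneSidedModel P Z Y s δ g f G) (hs : ∀ z, z ∈ s' ↔ -z ∈ s) :
    OneSidedModel P (fun ω => -Z ω) Y s' δ (fun z => g (-z)) (fun z => f (-z))
      (fun z => G (-z)) := by
  have htest : ∀ {ψ : ℝ → ℝ}, IsLocalTest s' δ ψ → IsLocalTest s δ fun z => ψ (-z) := fun hψ =>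
    { measurable := hψ.measurable.comp measurable_neg
      bounded := hψ.bounded.imp fun C hC z => hC _
      support := fun z hz => by
        have := hψ.support _ hz
        rw [hs, neg_neg, abs_neg] at this
        exact this }
  have hneg : ∀ (ψ F : ℝ → ℝ), ∫ z, ψ (-z) * F z = ∫ z, ψ z * F (-z) := fun ψ F => by
    rw [← integral_neg_eq_self]
    simp
  have hcont : ∀ {F : ℝ → ℝ}, ContinuousAt F 0 → ContinuousAt (fun z => F (-z)) 0 := fun hF =>
    ContinuousAt.comp (g := _) (f := fun z : ℝ => -z) (by simpa using hF) continuous_neg.continuousAt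
  obtain ⟨C, hC⟩ := hM.fourth
  exact
    { δ_pos := hM.δ_pos
      measurable_g := hM.measurable_g.comp measurable_neg
      measurable_f := hM.measurable_f.comp measurable_neg
      measurable_G := hM.measurable_G.comp measurable_neg
      bounded_f := hM.bounded_f.imp fun C hC z => hC _
      bounded_G := hM.bounded_G.imp fun C hC z => hC _
      continuousAt_f := hcont hM.continuousAt_f
      continuousAt_G := hcont hM.continuousAt_G
      f_pos := by simpa using hM.f_pos
      density := fun ψ hψ => by rw [← hneg]; exact hM.density _ (htest hψ)
      mean := fun ψ hψ => by simpa using hM.mean _ (htest hψ)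
      second := fun ψ hψ => by rw [← hneg]; simpa using hM.second _ (htest hψ)
      fourth := ⟨C, fun ψ hψ h0 => by
        have := hC _ (htest hψ) fun z => h0 _
        rw [integral_neg_eq_self (fun z => ψ z)] at this
        simpa using this⟩ }

end Regression

/-- One-sided Taylor expansions at the cutoff, with common coefficients. -/
theorem exists_taylor_bound {g : ℝ → ℝ} {κ₀ : ℝ} (hκ₀ : 0 < κ₀) {N : ℕ}
    (hg : ContDiffOn ℝ N g (nbhd κ₀)) :
    ∃ c : ℕ → ℝ, c 0 = g 0 ∧ ∀ M < N, ∃ D, 0 ≤ D ∧ ∀ z ∈ Icc 0 (κ₀ / 2),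
      |g z - ∑ j ∈ Finset.range (M + 1), c j * z ^ j| ≤ D * |z| ^ (M + 1) := by
  have hsub : Icc 0 (κ₀ / 2) ⊆ nbhd κ₀ := fun z hz => ⟨by linarith [hz.1], by linarith [hz.2]⟩
  -- These coefficients do not depend on the order M, so the order-q fit estimates the same
  -- coefficient of degree p+1 that biases the order-p fit.
  refine ⟨fun j => (j.factorial : ℝ)⁻¹ * iteratedDerivWithin j g (Icc 0 (κ₀ / 2)) 0, by simp,
    fun M hM => ?_⟩
  have hg' : ContDiffOn ℝ (M + 1) g (Icc 0 (κ₀ / 2)) := by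
    refine (hg.mono hsub).of_le ?_
    exact_mod_cast hM
  obtain ⟨D, hD⟩ := exists_taylor_mean_remainder_bound (by linarith) hg'
  refine ⟨|D|, abs_nonneg D, fun z hz => ?_⟩
  have h1 := hD z hz
  rw [taylor_within_apply, Real.norm_eq_abs] at h1
  have h2 : ∑ k ∈ Finset.range (M + 1), ((k.factorial : ℝ)⁻¹ * (z - 0) ^ k) •
      iteratedDerivWithin k g (Icc 0 (κ₀ / 2)) 0 = ∑ j ∈ Finset.range (M + 1),
      (j.factorial : ℝ)⁻¹ * iteratedDerivWithin j g (Icc 0 (κ₀ / 2)) 0 * z ^ j :=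
    Finset.sum_congr rfl fun j _ => by rw [sub_zero, smul_eq_mul]; ring
  rw [h2, sub_zero] at h1
  refine h1.trans ?_
  rw [abs_of_nonneg hz.1]
  exact mul_le_mul_of_nonneg_right (le_abs_self D) (pow_nonneg hz.1 _)

/-! ### Identification -/

section Identification

variable {Ω : Type*} [MeasurableSpace Ω] {P : Measure Ω}

theorem IsRegressionOn.sub {Z X X' : Ω → ℝ} {g g' : ℝ → ℝ} {U : Set ℝ}
    (h : IsRegressionOn P Z X g U) (h' : IsRegressionOn P Z X' g' U) :
    IsRegressionOn P Z (fun ω => X ω - X' ω) (fun z => g z - g' z) U where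
  measurable := h.measurable.sub h'.measurable
  integrableOn := h.integrableOn.sub h'.integrableOn
  condExp_eq := (condExp_sub h.integrableOn h'.integrableOn _).trans (h.condExp_eq.sub h'.condExp_eq)

variable [IsProbabilityMeasure P]

/-- Two variables that agree on `{Z ∈ U ∩ s}` have the same regression function there. -/
theorem IsRegressionOn.ae_eq {Z X X' : Ω → ℝ} {g g' : ℝ → ℝ} {U s : Set ℝ}
    (h : IsRegressionOn P Z X g U) (h' : IsRegressionOn P Z X' g' U) (hZ : Measurable Z)
    (hU : MeasurableSet U) (hs : MeasurableSet s)
    (hX : ∀ᵐ ω ∂P, Z ω ∈ U → Z ω ∈ s → X ω = X' ω) :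
    ∀ᵐ ω ∂P, Z ω ∈ U → Z ω ∈ s → g (Z ω) = g' (Z ω) := by
  set d : ℝ → ℝ := fun z => g z - g' z with hd
  have hdm : Measurable d := h.measurable.sub h'.measurable
  -- Testing against d itself would be natural, but d may be unbounded. Division by 1+|d| bounds it
  -- and still makes the integrand d²/(1+|d|), nonnegative and zero only where d is.
  set ψ : ℝ → ℝ := (U ∩ s).indicator fun z => d z / (1 + |d z|) with hψ
  have hψm : Measurable ψ := (hdm.div (measurable_const.add hdm.abs)).indicator (hU.inter hs)
  have hψb : ∀ z, |ψ z| ≤ 1 := fun z => by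
    by_cases hz : z ∈ U ∩ s
    · rw [hψ, indicator_of_mem hz, abs_div, abs_of_pos (a := 1 + |d z|) (by positivity)]
      exact div_le_one_of_le₀ (by linarith) (by positivity)
    · rw [hψ, indicator_of_notMem hz, abs_zero]; exact zero_le_one
  have hψU : ∀ z, ψ z ≠ 0 → z ∈ U ∩ s := fun z hz => by
    by_contra hcon
    exact hz (indicator_of_notMem hcon _)
  obtain ⟨-, a2, a3⟩ := h.integral_mul hZ hU hψm hψb fun z hz => (hψU z hz).1
  obtain ⟨-, b2, b3⟩ := h'.integral_mul hZ hU hψm hψb fun z hz => (hψU z hz).1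
  have e : ∫ ω, ψ (Z ω) * X ω ∂P = ∫ ω, ψ (Z ω) * X' ω ∂P := by
    refine integral_congr_ae ?_
    filter_upwards [hX] with ω hω
    by_cases hz : ψ (Z ω) = 0
    · simp [hz]
    · rw [hω (hψU _ hz).1 (hψU _ hz).2]
  have e0 : ∫ ω, (ψ (Z ω) * g (Z ω) - ψ (Z ω) * g' (Z ω)) ∂P = 0 := by
    rw [integral_sub a2 b2, ← a3, ← b3, e, sub_self]
  have hval : ∀ ω, Z ω ∈ U ∩ s → ψ (Z ω) * g (Z ω) - ψ (Z ω) * g' (Z ω) =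
      d (Z ω) ^ 2 / (1 + |d (Z ω)|) := fun ω hω => by
    rw [hψ, indicator_of_mem hω, ← mul_sub]
    change d (Z ω) / (1 + |d (Z ω)|) * d (Z ω) = _
    ring
  have hnonneg : ∀ ω, 0 ≤ ψ (Z ω) * g (Z ω) - ψ (Z ω) * g' (Z ω) := fun ω => by
    by_cases hz : Z ω ∈ U ∩ s
    · rw [hval ω hz]; positivity
    · rw [hψ, indicator_of_notMem hz]; simp
  filter_upwards [(integral_eq_zero_iff_of_nonneg hnonneg (a2.sub b2)).1 e0] with ω hω h1 h2
  have h3 : d (Z ω) ^ 2 / (1 + |d (Z ω)|) = 0 := (hval ω ⟨h1, h2⟩).symm.trans hω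
  rw [div_eq_zero_iff] at h3
  rcases h3 with h3 | h3
  · exact sub_eq_zero.1 (pow_eq_zero_iff two_ne_zero |>.1 h3)
  · have : 0 < 1 + |d (Z ω)| := by positivity
    exact absurd h3 this.ne'

omit [IsProbabilityMeasure P] in
/-- A running variable with a density that is bounded away from zero visits every interval. -/
theorem frequently_mem_Ioo_of_density {Z : Ω → ℝ} (hZ : Measurable Z) {f : ℝ → ℝ} {κ₀ : ℝ}
    (hdens : (P.map Z).restrict (nbhd κ₀) =
      (volume.restrict (nbhd κ₀)).withDensity fun z => ENNReal.ofReal (f z))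
    (hf : ContinuousOn f (nbhd κ₀)) (hfpos : ∃ a > 0, ∀ z ∈ nbhd κ₀, a ≤ f z) {x y : ℝ}
    (hxy : x < y) (hx : -κ₀ < x) (hy : y < κ₀) : ∃ᵐ ω ∂P, Z ω ∈ Ioo x y := by
  obtain ⟨a, ha, hfa⟩ := hfpos
  have hsub : Icc x y ⊆ nbhd κ₀ := fun z hz => ⟨hx.trans_le hz.1, hz.2.trans_lt hy⟩
  intro hcon
  have h1 := integral_comp_eq_of_density (P := P) hZ measurableSet_Ioo hdens
    (hf.aemeasurable measurableSet_Ioo) (fun z hz => ha.le.trans (hfa z hz))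
    (F := (Ioo x y).indicator 1) (measurable_one.indicator measurableSet_Ioo) (fun z hz => by
      by_contra hc
      exact hz (indicator_of_notMem (fun h => hc (hsub (Ioo_subset_Icc_self h))) _))
  have h2 : ∫ ω, (Ioo x y).indicator (1 : ℝ → ℝ) (Z ω) ∂P = 0 :=
    integral_eq_zero_of_ae (hcon.mono fun ω hω => indicator_of_notMem hω _)
  have h3 : ∫ z, (Ioo x y).indicator (1 : ℝ → ℝ) z * f z = ∫ z in Ioo x y, f z := by
    rw [← integral_indicator measurableSet_Ioo]
    congr 1
    ext z
    by_cases hz : z ∈ Ioo x y <;> simp [hz]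
  have h4 : a * (y - x) ≤ ∫ z in Ioo x y, f z := by
    have h5 : IntegrableOn f (Ioo x y) :=
      ((hf.mono hsub).integrableOn_compact isCompact_Icc).mono_set Ioo_subset_Icc_self
    calc a * (y - x) = ∫ _ in Ioo x y, a := by
          rw [setIntegral_const, Real.volume_real_Ioo_of_le hxy.le, smul_eq_mul, mul_comm]
      _ ≤ _ := setIntegral_mono_on (integrableOn_const (by simp)) h5 measurableSet_Ioo
        fun z hz => hfa z (hsub (Ioo_subset_Icc_self hz))
  rw [h2, h3] at h1
  nlinarith

end Identification

/-! ### The observed pairs as an i.i.d. sample -/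

namespace IsRandomSample

variable {Ω : Type*} [MeasurableSpace Ω] {P : Measure Ω} {S : Panel Ω}

theorem measurable_Z (hS : IsRandomSample P S) (k : ℕ) : Measurable (S.Z k) :=
  measurable_fst.comp (hS.measurable k)

end IsRandomSample

/-- The observed change of the outcome, as a function of all the variables of a unit. -/
def unitDelta (u : ℝ × (Bool × Bool) × (Fin 2 → Bool → Bool → ℝ)) : ℝ :=
  u.2.2 1 u.2.1.1 u.2.1.2 - u.2.2 0 u.2.1.1 false

theorem measurable_unitDelta : Measurable unitDelta := by
  have e : unitDelta = fun u => (if u.2.1.1 = true then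
      (if u.2.1.2 = true then u.2.2 1 true true else u.2.2 1 true false) - u.2.2 0 true false else
      (if u.2.1.2 = true then u.2.2 1 false true else u.2.2 1 false false) -
        u.2.2 0 false false) := by
    funext ⟨z, ⟨d0, d1⟩, y⟩
    cases d0 <;> cases d1 <;> rfl
  have h1 : MeasurableSet {u : ℝ × (Bool × Bool) × (Fin 2 → Bool → Bool → ℝ) | u.2.1.1 = true} :=
    (measurable_fst.comp (measurable_fst.comp measurable_snd)) (measurableSet_singleton true)
  have h2 : MeasurableSet {u : ℝ × (Bool × Bool) × (Fin 2 → Bool → Bool → ℝ) | u.2.1.2 = true} :=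
    (measurable_snd.comp (measurable_fst.comp measurable_snd)) (measurableSet_singleton true)
  have h3 : ∀ t d0 d1, Measurable
      fun u : ℝ × (Bool × Bool) × (Fin 2 → Bool → Bool → ℝ) => u.2.2 t d0 d1 := fun t d0 d1 => by
    fun_prop
  rw [e]
  exact Measurable.ite h1 ((Measurable.ite h2 (h3 _ _ _) (h3 _ _ _)).sub (h3 _ _ _))
    ((Measurable.ite h2 (h3 _ _ _) (h3 _ _ _)).sub (h3 _ _ _))

namespace IsRandomSample

variable {Ω : Type*} [MeasurableSpace Ω] {P : Measure Ω} {S : Panel Ω}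

theorem measurable_deltaY (hS : IsRandomSample P S) (k : ℕ) : Measurable (S.deltaY k) :=
  measurable_unitDelta.comp (hS.measurable k)

theorem indep_pair (hS : IsRandomSample P S) :
    iIndepFun (fun k ω => (S.Z k ω, S.deltaY k ω)) P :=
  hS.indep.comp (fun _ u => (u.1, unitDelta u)) fun _ => measurable_fst.prodMk measurable_unitDelta

theorem ident_pair (hS : IsRandomSample P S) (k : ℕ) :
    IdentDistrib (fun ω => (S.Z k ω, S.deltaY k ω)) (fun ω => (S.Z 0 ω, S.deltaY 0 ω)) P P :=
  (hS.ident k).comp (u := fun u => (u.1, unitDelta u)) (measurable_fst.prodMk measurable_unitDelta)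

end IsRandomSample

namespace SharpDiscontinuity

variable {Ω : Type*} [MeasurableSpace Ω] {P : Measure Ω} {S : Panel Ω} {κ₀ : ℝ}

theorem deltaY_right (h : SharpDiscontinuity P S κ₀) :
    ∀ᵐ ω ∂P, S.Z 0 ω ∈ nbhd κ₀ → S.Z 0 ω ∈ Ici (0 : ℝ) →
      S.deltaY 0 ω = S.Y 0 1 true true ω - S.Y 0 0 true false ω := by
  filter_upwards [h 0] with ω hω hU hs
  obtain ⟨h0, h1⟩ := hω hU
  rw [Panel.deltaY, Panel.obs1, Panel.obs0, h0.2 hs, h1.2 hs]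

theorem deltaY_left (h : SharpDiscontinuity P S κ₀) :
    ∀ᵐ ω ∂P, S.Z 0 ω ∈ nbhd κ₀ → S.Z 0 ω ∈ Iio (0 : ℝ) →
      S.deltaY 0 ω = S.Y 0 1 false false ω - S.Y 0 0 false false ω := by
  filter_upwards [h 0] with ω hω hU hs
  obtain ⟨h0, h1⟩ := hω hU
  have hn : ¬ 0 ≤ S.Z 0 ω := not_le.2 hs
  rw [Panel.deltaY, Panel.obs1, Panel.obs0, Bool.eq_false_iff.2 (mt h0.1 hn),
    Bool.eq_false_iff.2 (mt h1.1 hn)]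

end SharpDiscontinuity

/-! ### Identification of the one-sided limits -/

section OneSidedLimits

variable {Ω : Type*} [MeasurableSpace Ω] {P : Measure Ω} [IsProbabilityMeasure P] {S : Panel Ω}
  {κ₀ : ℝ} {N : ℕ} {m : Fin 2 → Bool → Bool → ℝ → ℝ} {f vp vm Δμ : ℝ → ℝ}

/-- A regression function is determined only at almost every value of Z, so Δμ cannot be compared
with the continuous version pointwise. Both agree at some point of every interval (0,u), since Z
charges it, and that suffices to identify the limits. -/
theorem right_limit_eq (hκ₀ : 0 < κ₀) (hS : IsRandomSample P S)
    (hcont : ContinuityAtCutoff P S κ₀ m) (hsharp : SharpDiscontinuity P S κ₀)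
    (hmodel : SharpModel P S κ₀ N m f vp vm)
    (hΔμ : IsRegressionOn P (S.Z 0) (S.deltaY 0) Δμ (nbhd κ₀)) {θ : ℝ}
    (hθ : Tendsto Δμ (𝓝[>] 0) (𝓝 θ)) : θ = m 1 true true 0 - m 0 true false 0 := by
  have h1 := hΔμ.ae_eq ((hcont.regression 1 true true).sub (hcont.regression 0 true false))
    (hS.measurable_Z 0) measurableSet_Ioo measurableSet_Ici hsharp.deltaY_right
  have h2 : Tendsto (fun z => m 1 true true z - m 0 true false z) (𝓝[>] 0)
      (𝓝 (m 1 true true 0 - m 0 true false 0)) :=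
    ((hcont.continuousAt _ _ _).sub (hcont.continuousAt _ _ _)).tendsto.mono_left nhdsWithin_le_nhds
  refine tendsto_nhds_unique_of_frequently_eq hθ h2 fun hcon => ?_
  obtain ⟨u, hu, hsub⟩ := mem_nhdsGT_iff_exists_Ioo_subset.1 hcon
  have hu' : 0 < u := hu
  obtain ⟨ω, hω, hω'⟩ := ((frequently_mem_Ioo_of_density (hS.measurable_Z 0) hmodel.density
    hmodel.density_continuous hmodel.density_pos (x := 0) (y := min u (κ₀ / 2))
    (lt_min hu' (by linarith)) (by linarith)
    ((min_le_right _ _).trans_lt (by linarith))).and_eventually h1).exists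
  have hlt := lt_min_iff.1 hω.2
  exact hsub ⟨hω.1, hlt.1⟩ (hω' ⟨by linarith [hω.1], by linarith [hlt.2]⟩ hω.1.le)

theorem left_limit_eq (hκ₀ : 0 < κ₀) (hS : IsRandomSample P S)
    (hcont : ContinuityAtCutoff P S κ₀ m) (hsharp : SharpDiscontinuity P S κ₀)
    (hmodel : SharpModel P S κ₀ N m f vp vm)
    (hΔμ : IsRegressionOn P (S.Z 0) (S.deltaY 0) Δμ (nbhd κ₀)) {θ : ℝ}
    (hθ : Tendsto Δμ (𝓝[<] 0) (𝓝 θ)) : θ = m 1 false false 0 - m 0 false false 0 := by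
  have h1 := hΔμ.ae_eq ((hcont.regression 1 false false).sub (hcont.regression 0 false false))
    (hS.measurable_Z 0) measurableSet_Ioo measurableSet_Iio hsharp.deltaY_left
  have h2 : Tendsto (fun z => m 1 false false z - m 0 false false z) (𝓝[<] 0)
      (𝓝 (m 1 false false 0 - m 0 false false 0)) :=
    ((hcont.continuousAt _ _ _).sub (hcont.continuousAt _ _ _)).tendsto.mono_left nhdsWithin_le_nhds
  refine tendsto_nhds_unique_of_frequently_eq hθ h2 fun hcon => ?_
  obtain ⟨u, hu, hsub⟩ := mem_nhdsLT_iff_exists_Ioo_subset.1 hcon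
  have hu' : u < 0 := hu
  obtain ⟨ω, hω, hω'⟩ := ((frequently_mem_Ioo_of_density (hS.measurable_Z 0) hmodel.density
    hmodel.density_continuous hmodel.density_pos (x := max u (-(κ₀ / 2))) (y := 0)
    (max_lt hu' (by linarith)) (lt_of_lt_of_le (by linarith) (le_max_right _ _))
    hκ₀).and_eventually h1).exists
  have hlt := max_lt_iff.1 hω.1
  exact hsub ⟨hlt.1, hω.2⟩ (hω' ⟨by linarith [hlt.2], by linarith [hω.2]⟩ hω.2)

end OneSidedLimits

/-- The bounds contain the effect under bounded variations. -/
theorem tauC_mem_Icc {m : Fin 2 → Bool → Bool → ℝ → ℝ} {θ c : ℝ × ℝ}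
    (h₁ : θ.1 = m 1 true true 0 - m 0 true false 0)
    (h₂ : θ.2 = m 1 false false 0 - m 0 false false 0) (hc : BoundedVariations m c) :
    tauC m ∈ Icc (lowerBound θ c) (upperBound θ c) := by
  obtain ⟨a, b⟩ := hc
  obtain ⟨a1, a2⟩ := abs_le.1 a
  obtain ⟨b1, b2⟩ := abs_le.1 b
  rw [tauC, lowerBound, upperBound, h₁, h₂]
  exact ⟨max_le (by linarith) (by linarith), le_min (by linarith) (by linarith)⟩

/-! ### Bivariate central limit theorem -/

section Bivariate

variable {Ω E : Type*} [MeasurableSpace Ω] [MeasurableSpace E] {P : Measure Ω}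
  [IsProbabilityMeasure P] {W : ℕ → Ω → E}

theorem integrable_pow_of_integrable_pow_four {X : Ω → ℝ} (hX : AEStronglyMeasurable X P)
    (h : Integrable (fun ω => X ω ^ 4) P) {j : ℕ} (hj : j ≤ 4) :
    Integrable (fun ω => X ω ^ j) P := by
  refine ((integrable_const (1 : ℝ)).add h).mono' (hX.pow j) (Eventually.of_forall fun ω => ?_)
  rw [Real.norm_eq_abs, abs_pow, Pi.add_apply, ← Even.pow_abs (by decide : Even 4) (X ω)]
  rcases le_total |X ω| 1 with h1 | h1
  · exact (pow_le_one₀ (abs_nonneg _) h1).trans (by linarith [pow_nonneg (abs_nonneg (X ω)) 4])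
  · exact (pow_le_pow_right₀ h1 hj).trans (by linarith)

theorem charFun_gaussianReal_toNNReal {v : ℝ} (hv : 0 ≤ v) (t : ℝ) :
    charFun (gaussianReal 0 v.toNNReal) t = Complex.exp (-(v * t ^ 2 / 2 : ℝ)) := by
  rw [charFun_gaussianReal]
  simp [hv]

/-- Central limit theorem for rows of i.i.d. pairs with orthogonal coordinates. -/
theorem tendstoInDistribution_rowSum_prod (hindep : iIndepFun W P)
    (hident : ∀ i, IdentDistrib (W i) (W 0) P P) {φ ψ : ℕ → E → ℝ} (hφ : ∀ n, Measurable (φ n))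
    (hψ : ∀ n, Measurable (ψ n)) (hφψ : ∀ n w, φ n w = 0 ∨ ψ n w = 0)
    (hφ4 : ∀ᶠ n in atTop, Integrable (fun ω => φ n (W 0 ω) ^ 4) P)
    (hψ4 : ∀ᶠ n in atTop, Integrable (fun ω => ψ n (W 0 ω) ^ 4) P)
    (hφm : ∀ᶠ n in atTop, ∫ ω, φ n (W 0 ω) ∂P = 0) (hψm : ∀ᶠ n in atTop, ∫ ω, ψ n (W 0 ω) ∂P = 0)
    {v v' : ℝ} (hφv : Tendsto (fun n : ℕ => n * ∫ ω, φ n (W 0 ω) ^ 2 ∂P) atTop (𝓝 v))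
    (hψv : Tendsto (fun n : ℕ => n * ∫ ω, ψ n (W 0 ω) ^ 2 ∂P) atTop (𝓝 v'))
    (hφf : Tendsto (fun n : ℕ => n * ∫ ω, φ n (W 0 ω) ^ 4 ∂P) atTop (𝓝 0))
    (hψf : Tendsto (fun n : ℕ => n * ∫ ω, ψ n (W 0 ω) ^ 4 ∂P) atTop (𝓝 0)) :
    TendstoInDistribution (fun (n : ℕ) ω =>
        (∑ k ∈ Finset.range n, φ n (W k ω), ∑ k ∈ Finset.range n, ψ n (W k ω)))
      atTop id (fun _ => P)
      ((gaussianReal 0 v.toNNReal).prod (gaussianReal 0 v'.toNNReal)) := by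
  have hv : 0 ≤ v := ge_of_tendsto' hφv fun n =>
    mul_nonneg n.cast_nonneg (integral_nonneg fun ω => sq_nonneg _)
  have hv' : 0 ≤ v' := ge_of_tendsto' hψv fun n =>
    mul_nonneg n.cast_nonneg (integral_nonneg fun ω => sq_nonneg _)
  have hW : ∀ k, AEMeasurable (W k) P := fun k => (hident k).aemeasurable_fst
  have hsum : ∀ {χ : E → ℝ}, Measurable χ → ∀ n : ℕ,
      AEMeasurable (fun ω => ∑ k ∈ Finset.range n, χ (W k ω)) P := fun hχ n =>
    Finset.aemeasurable_fun_sum _ fun k _ => hχ.comp_aemeasurable (hW k)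
  -- Characteristic functions require an inner product, hence the detour through the Euclidean
  -- plane; the last line returns to the product space by continuity.
  have hpair : ∀ n : ℕ, AEMeasurable (fun ω => WithLp.toLp 2
      (∑ k ∈ Finset.range n, φ n (W k ω), ∑ k ∈ Finset.range n, ψ n (W k ω))) P := fun n =>
    (WithLp.measurable_toLp 2 (ℝ × ℝ)).comp_aemeasurable ((hsum (hφ n) n).prodMk (hsum (hψ n) n))
  have key : TendstoInDistribution (fun (n : ℕ) ω => WithLp.toLp 2
        (∑ k ∈ Finset.range n, φ n (W k ω), ∑ k ∈ Finset.range n, ψ n (W k ω)))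
      atTop (WithLp.toLp 2) (fun _ => P)
      ((gaussianReal 0 v.toNNReal).prod (gaussianReal 0 v'.toNNReal)) := by
    refine ⟨hpair, (WithLp.measurable_toLp 2 (ℝ × ℝ)).aemeasurable, ?_⟩
    refine ProbabilityMeasure.tendsto_of_tendsto_charFun fun t => ?_
    simp only [ProbabilityMeasure.coe_mk]
    rw [charFun_prod, charFun_gaussianReal_toNNReal hv, charFun_gaussianReal_toNNReal hv',
      ← Complex.exp_add]
    set x := (WithLp.ofLp t).1
    set y := (WithLp.ofLp t).2
    set χ : ℕ → E → ℝ := fun n w => x * φ n w + y * ψ n w with hχdef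
    have hχ : ∀ n, Measurable (χ n) := fun n => ((hφ n).const_mul x).add ((hψ n).const_mul y)
    -- As one of the two scores is always zero, all mixed terms of the binomial expansion vanish.
    -- This yields independence in the limit without any joint moments.
    have hpow : ∀ {j : ℕ}, j ≠ 0 → ∀ n w, χ n w ^ j = x ^ j * φ n w ^ j + y ^ j * ψ n w ^ j := by
      intro j hj n w
      rcases hφψ n w with h | h <;> simp [hχdef, h, hj, mul_pow]
    have hφi : ∀ᶠ n in atTop, ∀ j ≤ 4, Integrable (fun ω => φ n (W 0 ω) ^ j) P :=
      hφ4.mono fun n hn j hj => integrable_pow_of_integrable_pow_four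
        ((hφ n).comp_aemeasurable (hW 0)).aestronglyMeasurable hn hj
    have hψi : ∀ᶠ n in atTop, ∀ j ≤ 4, Integrable (fun ω => ψ n (W 0 ω) ^ j) P :=
      hψ4.mono fun n hn j hj => integrable_pow_of_integrable_pow_four
        ((hψ n).comp_aemeasurable (hW 0)).aestronglyMeasurable hn hj
    have hint : ∀ {j : ℕ}, j ≠ 0 → j ≤ 4 → ∀ᶠ n in atTop, ∫ ω, χ n (W 0 ω) ^ j ∂P =
        x ^ j * ∫ ω, φ n (W 0 ω) ^ j ∂P + y ^ j * ∫ ω, ψ n (W 0 ω) ^ j ∂P := by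
      intro j hj hj4
      filter_upwards [hφi, hψi] with n h1 h2
      simp only [hpow hj]
      rw [integral_add ((h1 j hj4).const_mul _) ((h2 j hj4).const_mul _), integral_const_mul,
        integral_const_mul]
    have hlim : ∀ {j : ℕ} {a a' : ℝ}, j ≠ 0 → j ≤ 4 →
        Tendsto (fun n : ℕ => n * ∫ ω, φ n (W 0 ω) ^ j ∂P) atTop (𝓝 a) →
        Tendsto (fun n : ℕ => n * ∫ ω, ψ n (W 0 ω) ^ j ∂P) atTop (𝓝 a') →
        Tendsto (fun n : ℕ => n * ∫ ω, χ n (W 0 ω) ^ j ∂P) atTop (𝓝 (x ^ j * a + y ^ j * a')) := by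
      intro j a a' hj hj4 h1 h2
      refine ((h1.const_mul (x ^ j)).add (h2.const_mul (y ^ j))).congr' ?_
      filter_upwards [hint hj hj4] with n hn
      rw [hn]; ring
    have hclt := tendsto_charFun_rowSum hindep hident hχ ?_ ?_
      (hlim two_ne_zero (by norm_num) hφv hψv)
      (by simpa using hlim four_ne_zero le_rfl hφf hψf)
    · have e : -(((x ^ 2 * v + y ^ 2 * v') / 2 : ℝ) : ℂ) =
          -((v * x ^ 2 / 2 : ℝ) : ℂ) + -((v' * y ^ 2 / 2 : ℝ) : ℂ) := by
        push_cast; ring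
      rw [e] at hclt
      refine hclt.congr fun n => ?_
      rw [charFun_apply, charFun_apply, integral_map (hpair n) (by fun_prop),
        integral_map (hsum (hχ n) n) (by fun_prop)]
      refine integral_congr_ae (Eventually.of_forall fun ω => ?_)
      simp only [hχdef, WithLp.prod_inner_apply, Finset.sum_add_distrib, ← Finset.mul_sum]
      simp [x, y]
    · filter_upwards [hφi, hψi] with n h1 h2
      simp only [hpow four_ne_zero]
      exact ((h1 4 le_rfl).const_mul _).add ((h2 4 le_rfl).const_mul _)
    · filter_upwards [hint one_ne_zero (by norm_num), hφm, hψm] with n h1 h2 h3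
      simp only [pow_one] at h1
      rw [h1, h2, h3]; simp
  exact key.continuous_comp (WithLp.prod_continuous_ofLp 2 ℝ ℝ)

end Bivariate

/-! ### Asymptotic normality of the one-sided estimators -/

section Normality

variable {Ω : Type*} [MeasurableSpace Ω] {P : Measure Ω} [IsProbabilityMeasure P] {S : Panel Ω}
  {κ₀ : ℝ} {m : Fin 2 → Bool → Bool → ℝ → ℝ} {f vp vm : ℝ → ℝ} {K : ℝ → ℝ} {κ : ℝ} {p q : ℕ}
  {h b : ℕ → ℝ} {ρ : ℝ}

theorem limVar_pos (hK : IsRDKernel K κ) (hpq : p < q) (hρ : 0 ≤ ρ) {v f₀ : ℝ} (hv : 0 < v)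
    (hf : 0 < f₀) : 0 < limVar K p q ρ v f₀ := by
  have := integral_sq_bcKernel_pos hK hpq hρ
  unfold limVar
  have h1 : 0 < max 1 ρ := lt_max_of_lt_left one_pos
  positivity

/-- The Taylor coefficients at the cutoff serve both polynomial orders. -/
theorem exists_taylor_bound_pair {g : ℝ → ℝ} (hκ₀ : 0 < κ₀) (hpq : p < q)
    (hg : ContDiffOn ℝ (q + 1 : ℕ) g (nbhd κ₀)) :
    ∃ (c : ℕ → ℝ) (D : ℝ), c 0 = g 0 ∧ 0 ≤ D ∧ ∀ z, 0 ≤ z → |z| < κ₀ / 2 →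
      |g z - ∑ j ∈ Finset.range (p + 2), c j * z ^ j| ≤ D * |z| ^ (p + 2) ∧
      |g z - ∑ j ∈ Finset.range (q + 1), c j * z ^ j| ≤ D * |z| ^ (q + 1) := by
  obtain ⟨c, hc0, hc⟩ := exists_taylor_bound hκ₀ hg
  obtain ⟨D₁, hD₁, h₁⟩ := hc (p + 1) (by omega)
  obtain ⟨D₂, hD₂, h₂⟩ := hc q (by omega)
  refine ⟨c, max D₁ D₂, hc0, le_max_of_le_left hD₁, fun z hz hzκ => ?_⟩
  have hmem : z ∈ Icc 0 (κ₀ / 2) := ⟨hz, (le_abs_self z).trans hzκ.le⟩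
  exact ⟨(h₁ z hmem).trans (mul_le_mul_of_nonneg_right (le_max_left _ _) (by positivity)),
    (h₂ z hmem).trans (mul_le_mul_of_nonneg_right (le_max_right _ _) (by positivity))⟩

omit [IsProbabilityMeasure P] in
theorem measurable_thetaHat (hS : IsRandomSample P S) (hK : IsRDKernel K κ) (hpq : p < q)
    (h b : ℝ) (n : ℕ) : Measurable (thetaHat S K p q h b n) :=
  (measurable_bcEst measurableSet_Ici hK.measurable hpq h b n hS.measurable_Z
    hS.measurable_deltaY).prodMk
    (measurable_bcEst measurableSet_Iio hK.measurable hpq h b n hS.measurable_Z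
      hS.measurable_deltaY)

theorem oneSidedModel_right (hκ₀ : 0 < κ₀) (hS : IsRandomSample P S)
    (hcont : ContinuityAtCutoff P S κ₀ m) (hsharp : SharpDiscontinuity P S κ₀)
    (hmodel : SharpModel P S κ₀ (q + 1) m f vp vm) :
    OneSidedModel P (S.Z 0) (S.deltaY 0) (Ici 0) (κ₀ / 2)
      (fun z => m 1 true true z - m 0 true false z)
      ((Ioo (-(κ₀ / 2)) (κ₀ / 2)).indicator f)
      ((Ioo (-(κ₀ / 2)) (κ₀ / 2)).indicator fun z => vp z * f z) := by
  obtain ⟨g₄, h₄, M, hM⟩ := hmodel.fourth_moment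
  exact .of_regression hκ₀ (hS.measurable_Z 0) (hcont.regression 1 true true)
    (hcont.regression 0 true false) hsharp.deltaY_right (hS.measurable_deltaY 0)
    hmodel.variance_right h₄ hM hmodel.density hmodel.density_continuous hmodel.density_pos
    hmodel.variance_right_continuous hmodel.smooth_right.continuousOn

/-- Stated for -Z, so that everything proved on the right of the cutoff applies verbatim. -/
theorem oneSidedModel_left (hκ₀ : 0 < κ₀) (hS : IsRandomSample P S)
    (hcont : ContinuityAtCutoff P S κ₀ m) (hsharp : SharpDiscontinuity P S κ₀)
    (hmodel : SharpModel P S κ₀ (q + 1) m f vp vm) :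
    OneSidedModel P (fun ω => -S.Z 0 ω) (S.deltaY 0) (Ioi 0) (κ₀ / 2)
      (fun z => m 1 false false (-z) - m 0 false false (-z))
      (fun z => (Ioo (-(κ₀ / 2)) (κ₀ / 2)).indicator f (-z))
      (fun z => (Ioo (-(κ₀ / 2)) (κ₀ / 2)).indicator (fun z => vm z * f z) (-z)) := by
  obtain ⟨g₄, h₄, M, hM⟩ := hmodel.fourth_moment
  have hleft : OneSidedModel P (S.Z 0) (S.deltaY 0) (Iio 0) (κ₀ / 2)
      (fun z => m 1 false false z - m 0 false false z)
      ((Ioo (-(κ₀ / 2)) (κ₀ / 2)).indicator f)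
      ((Ioo (-(κ₀ / 2)) (κ₀ / 2)).indicator fun z => vm z * f z) :=
    .of_regression hκ₀ (hS.measurable_Z 0) (hcont.regression 1 false false)
      (hcont.regression 0 false false) hsharp.deltaY_left (hS.measurable_deltaY 0)
      hmodel.variance_left h₄ hM hmodel.density hmodel.density_continuous hmodel.density_pos
      hmodel.variance_left_continuous hmodel.smooth_left.continuousOn
  exact hleft.neg fun z => by simp

theorem tendstoInDistribution_thetaHat (hκ₀ : 0 < κ₀) (hS : IsRandomSample P S)
    (hcont : ContinuityAtCutoff P S κ₀ m) (hsharp : SharpDiscontinuity P S κ₀) (hpq : p < q)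
    (hmodel : SharpModel P S κ₀ (q + 1) m f vp vm) (hK : IsRDKernel K κ)
    (H : BandwidthConditions p q h b ρ) {θ₀ : ℝ × ℝ}
    (hθ₁ : θ₀.1 = m 1 true true 0 - m 0 true false 0)
    (hθ₂ : θ₀.2 = m 1 false false 0 - m 0 false false 0) :
    TendstoInDistribution
      (fun (n : ℕ) ω => √((n : ℝ) * min (h n) (b n)) • (thetaHat S K p q (h n) (b n) n ω - θ₀))
      atTop id (fun _ => P) (gaussianLimit K p q ρ (vp 0) (vm 0) (f 0)) := by
  have hindep := hS.indep_pair
  have hident := hS.ident_pair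
  have hrefl : Measurable fun w : ℝ × ℝ => (-w.1, w.2) := by fun_prop
  have hindep' : iIndepFun (fun k ω => (-S.Z k ω, S.deltaY k ω)) P :=
    hindep.comp (fun _ w => (-w.1, w.2)) fun _ => hrefl
  have hident' : ∀ k, IdentDistrib (fun ω => (-S.Z k ω, S.deltaY k ω))
      (fun ω => (-S.Z 0 ω, S.deltaY 0 ω)) P P := fun k => (hident k).comp hrefl
  have hM₁ := oneSidedModel_right hκ₀ hS hcont hsharp hmodel
  have hM₂ := oneSidedModel_left hκ₀ hS hcont hsharp hmodel
  obtain ⟨a, ha, hfa⟩ := hmodel.density_pos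
  have hf0 : f 0 ≠ 0 := (ha.trans_le (hfa 0 ⟨by linarith, hκ₀⟩)).ne'
  have h0 : (0 : ℝ) ∈ Ioo (-(κ₀ / 2)) (κ₀ / 2) := ⟨by linarith, by linarith⟩
  set g₁ : ℝ → ℝ := fun z => m 1 true true z - m 0 true false z with hg₁
  set g₂ : ℝ → ℝ := fun z => m 1 false false (-z) - m 0 false false (-z) with hg₂
  have hsmooth₂ : ContDiffOn ℝ (q + 1 : ℕ) g₂ (nbhd κ₀) :=
    hmodel.smooth_left.comp contDiff_neg.contDiffOn fun z hz =>
      ⟨by linarith [hz.2], by linarith [hz.1]⟩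
  obtain ⟨c₁, D₁, hc₁, hD₁, hT₁⟩ := exists_taylor_bound_pair hκ₀ hpq hmodel.smooth_right
  obtain ⟨c₂, D₂, hc₂, hD₂, hT₂⟩ := exists_taylor_bound_pair hκ₀ hpq hsmooth₂
  have hlin₁ := bcEst_asymptotically_linear hindep hident (hS.measurable_Z 0)
    (hS.measurable_deltaY 0) Ioi_subset_Ici_self Subset.rfl measurableSet_Ici hM₁ hK hpq H c₁ hD₁
    (fun z hz hzκ => (hT₁ z hz hzκ).1) (fun z hz hzκ => (hT₁ z hz hzκ).2)
  have hlin₂ := bcEst_asymptotically_linear (Z := fun k ω => -S.Z k ω) hindep' hident'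
    (hS.measurable_Z 0).neg (hS.measurable_deltaY 0) Subset.rfl Ioi_subset_Ici_self
    measurableSet_Ioi hM₂ hK hpq H c₂ hD₂ (fun z hz hzκ => (hT₂ z (le_of_lt hz) hzκ).1)
    (fun z hz hzκ => (hT₂ z (le_of_lt hz) hzκ).2)
  have hφ4 := score_fourth_moment (Z := S.Z) (Y := S.deltaY) Ioi_subset_Ici_self Subset.rfl
    measurableSet_Ici hM₁ hK H
  have hψ4 := score_fourth_moment (Z := fun k ω => -S.Z k ω) (Y := S.deltaY) Subset.rfl
    Ioi_subset_Ici_self measurableSet_Ioi hM₂ hK H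
  have hφ2 := score_second_moment (Z := S.Z) (Y := S.deltaY) Ioi_subset_Ici_self Subset.rfl
    measurableSet_Ici hM₁ hK H
  have hψ2 := score_second_moment (Z := fun k ω => -S.Z k ω) (Y := S.deltaY) Subset.rfl
    Ioi_subset_Ici_self measurableSet_Ioi hM₂ hK H
  have hφ1 := score_integral_eq_zero (Z := S.Z) (Y := S.deltaY) measurableSet_Ici hM₁ hK H
  have hψ1 := score_integral_eq_zero (Z := fun k ω => -S.Z k ω) (Y := S.deltaY)
    measurableSet_Ioi hM₂ hK H
  simp only [neg_zero, indicator_of_mem h0, mul_div_cancel_right₀ _ hf0]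
    at hφ1 hφ2 hφ4 hψ1 hψ2 hψ4 hlin₁ hlin₂
  have hclt := tendstoInDistribution_rowSum_prod hindep hident
    (φ := fun n w => score (Ici 0) K p q (h n) (b n) n g₁ (f 0) w)
    (ψ := fun n w => score (Ioi 0) K p q (h n) (b n) n g₂ (f 0) (-w.1, w.2))
    (fun n => measurable_score hK measurableSet_Ici hM₁.measurable_g p q _ _ n _)
    (fun n => (measurable_score hK measurableSet_Ioi hM₂.measurable_g p q _ _ n _).comp hrefl)
    -- The right score includes z = 0 and the reflected left score excludes it, so the two supports
    -- are disjoint.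
    (fun n w => by
      rcases le_or_gt 0 w.1 with hw | hw
      · right; simp [score, hw]
      · left; simp [score, hw])
    hφ4.1 hψ4.1 hφ1 hψ1 hφ2 hψ2 hφ4.2 hψ4.2
  refine tendstoInDistribution_of_tendstoInMeasure_sub _ _ hclt ?_ fun n =>
    (((measurable_thetaHat hS hK hpq (h n) (b n) n).sub_const θ₀).const_smul
      (√((n : ℝ) * min (h n) (b n)))).aemeasurable
  refine (tendstoInMeasure_prodMk hlin₁ hlin₂).congr (fun n => Eventually.of_forall fun ω => ?_)
    (ae_of_all _ fun ω => rfl)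
  have e := bcEst_Iio (h := h n) (b := b n) (n := n) hK.symmetric hpq (fun k => S.Z k ω)
    (fun k => S.deltaY k ω)
  ext
  · simp [thetaHat, hc₁, hθ₁, hg₁]
  · simp [thetaHat, hc₂, hθ₂, hg₂, e]

end Normality

/-! ### Hadamard directional derivatives and the delta method -/

/-- A strict inequality persists under small perturbations, so one branch is eventually active. At a
tie, translation invariance and positive homogeneity of `max` make the quotient exactly the maximum
of the directions. -/
theorem tendsto_maxDeriv {t x y : ℕ → ℝ} {a₁ a₂ x₀ y₀ : ℝ} (ht : ∀ n, 0 < t n)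
    (ht0 : Tendsto t atTop (𝓝 0)) (hx : Tendsto x atTop (𝓝 x₀)) (hy : Tendsto y atTop (𝓝 y₀)) :
    Tendsto (fun n => (t n)⁻¹ * (max (a₁ + t n * x n) (a₂ + t n * y n) - max a₁ a₂)) atTop
      (𝓝 (maxDeriv a₁ a₂ x₀ y₀)) := by
  have hx' : Tendsto (fun n => a₁ + t n * x n) atTop (𝓝 a₁) := by
    simpa using (ht0.mul hx).const_add a₁
  have hy' : Tendsto (fun n => a₂ + t n * y n) atTop (𝓝 a₂) := by
    simpa using (ht0.mul hy).const_add a₂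
  rcases lt_trichotomy a₁ a₂ with h | h | h
  · rw [maxDeriv, if_pos h]
    refine hy.congr' ?_
    filter_upwards [hx'.eventually_lt hy' h] with n hn
    rw [max_eq_right hn.le, max_eq_right h.le, add_sub_cancel_left, inv_mul_cancel_left₀ (ht n).ne']
  · subst h
    rw [maxDeriv, if_neg (lt_irrefl _), if_neg (lt_irrefl _)]
    refine (hx.max hy).congr fun n => ?_
    rw [max_add_add_left, max_self, add_sub_cancel_left, ← mul_max_of_nonneg _ _ (ht n).le,
      inv_mul_cancel_left₀ (ht n).ne']
  · rw [maxDeriv, if_neg h.not_gt, if_pos h]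
    refine hx.congr' ?_
    filter_upwards [hy'.eventually_lt hx' h] with n hn
    rw [max_eq_left hn.le, max_eq_left h.le, add_sub_cancel_left, inv_mul_cancel_left₀ (ht n).ne']

theorem minDeriv_eq_neg_maxDeriv (a₁ a₂ x y : ℝ) :
    minDeriv a₁ a₂ x y = -maxDeriv (-a₁) (-a₂) (-x) (-y) := by
  rcases lt_trichotomy a₁ a₂ with h | h | h
  · simp [minDeriv, maxDeriv, h, h.not_gt]
  · simp [minDeriv, maxDeriv, h, max_neg_neg]
  · simp [minDeriv, maxDeriv, h, h.not_gt]

theorem tendsto_minDeriv {t x y : ℕ → ℝ} {a₁ a₂ x₀ y₀ : ℝ} (ht : ∀ n, 0 < t n)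
    (ht0 : Tendsto t atTop (𝓝 0)) (hx : Tendsto x atTop (𝓝 x₀)) (hy : Tendsto y atTop (𝓝 y₀)) :
    Tendsto (fun n => (t n)⁻¹ * (min (a₁ + t n * x n) (a₂ + t n * y n) - min a₁ a₂)) atTop
      (𝓝 (minDeriv a₁ a₂ x₀ y₀)) := by
  rw [minDeriv_eq_neg_maxDeriv]
  refine (tendsto_maxDeriv ht ht0 hx.neg hy.neg).neg.congr fun n => ?_
  have e₁ : -a₁ + t n * -x n = -(a₁ + t n * x n) := by ring
  have e₂ : -a₂ + t n * -y n = -(a₂ + t n * y n) := by ring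
  rw [e₁, e₂, max_neg_neg, max_neg_neg]
  ring

theorem continuous_boundMap (𝒞 : Finset (ℝ × ℝ)) : Continuous (boundMap 𝒞) := by
  unfold boundMap lowerBound upperBound
  fun_prop

theorem continuous_boundDeriv (𝒞 : Finset (ℝ × ℝ)) (θ : ℝ × ℝ) : Continuous (boundDeriv 𝒞 θ) := by
  refine continuous_pi fun c => Continuous.prodMk ?_ ?_
  · unfold maxDeriv
    split_ifs <;> fun_prop
  · unfold minDeriv
    split_ifs <;> fun_prop

theorem hasHadamardDirDerivAt_boundMap (𝒞 : Finset (ℝ × ℝ)) (θ : ℝ × ℝ) :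
    HasHadamardDirDerivAt (boundMap 𝒞) (boundDeriv 𝒞 θ) θ := by
  refine ⟨continuous_boundDeriv 𝒞 θ, fun t k k₀ ht ht0 hk => tendsto_pi_nhds.2 fun c => ?_⟩
  have h₁ : Tendsto (fun n => (k n).1) atTop (𝓝 k₀.1) := (continuous_fst.tendsto k₀).comp hk
  have h₂ : Tendsto (fun n => (k n).2) atTop (𝓝 k₀.2) := (continuous_snd.tendsto k₀).comp hk
  refine ((tendsto_maxDeriv (a₁ := θ.1 - c.1.1) (a₂ := θ.1 - θ.2 - c.1.2) ht ht0 h₁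
    (h₁.sub h₂)).prodMk_nhds (tendsto_minDeriv (a₁ := θ.1 + c.1.1) (a₂ := θ.1 - θ.2 + c.1.2) ht ht0
    h₁ (h₁.sub h₂))).congr fun n => ?_
  have e₁ : θ.1 - c.1.1 + t n * (k n).1 = θ.1 + t n * (k n).1 - c.1.1 := by ring
  have e₂ : θ.1 - θ.2 - c.1.2 + t n * ((k n).1 - (k n).2) =
      θ.1 + t n * (k n).1 - (θ.2 + t n * (k n).2) - c.1.2 := by ring
  have e₃ : θ.1 + c.1.1 + t n * (k n).1 = θ.1 + t n * (k n).1 + c.1.1 := by ring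
  have e₄ : θ.1 - θ.2 + c.1.2 + t n * ((k n).1 - (k n).2) =
      θ.1 + t n * (k n).1 - (θ.2 + t n * (k n).2) + c.1.2 := by ring
  rw [e₁, e₂, e₃, e₄]
  rfl

section DeltaMethod

variable {E F : Type*} [NormedAddCommGroup E] [NormedSpace ℝ E] [NormedAddCommGroup F]
  [NormedSpace ℝ F] {φ φ' : E → F} {θ : E}

theorem HasHadamardDirDerivAt.map_zero (h : HasHadamardDirDerivAt φ φ' θ) : φ' 0 = 0 := by
  have h1 := h.2 (fun n => 1 / ((n : ℝ) + 1)) (fun _ => 0) 0 (fun n => by positivity)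
    tendsto_one_div_add_atTop_nhds_zero_nat tendsto_const_nhds
  refine tendsto_nhds_unique h1 ?_
  simp

open Classical in
/-- Difference quotients, continuously extended to step size `0`. -/
def diffQuotient (φ φ' : E → F) (θ : E) (w : E × ℝ) : F :=
  if w.2 = 0 then φ' w.1 else |w.2|⁻¹ • (φ (θ + |w.2| • w.1) - φ θ)

/-- The only delicate points have step size 0. Within that hyperplane continuity is that of φ';
along nonzero steps it is the definition of the Hadamard derivative, read sequentially. -/
theorem HasHadamardDirDerivAt.continuous_diffQuotient (h : HasHadamardDirDerivAt φ φ' θ)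
    (hφ : Continuous φ) : Continuous (diffQuotient φ φ' θ) := by
  rw [continuous_iff_continuousAt]
  rintro ⟨x, s⟩
  rcases eq_or_ne s 0 with rfl | hs
  · have hval : diffQuotient φ φ' θ (x, 0) = φ' x := if_pos rfl
    rw [ContinuousAt, hval]
    have hcover : {w : E × ℝ | w.2 = 0} ∪ {w | w.2 ≠ 0} = univ := by
      ext w; simp [em]
    rw [← nhdsWithin_univ, ← hcover, nhdsWithin_union]
    refine Tendsto.sup ?_ ?_
    · refine (((h.1.comp continuous_fst).tendsto (x, (0 : ℝ))).mono_left
        nhdsWithin_le_nhds).congr' ?_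
      filter_upwards [self_mem_nhdsWithin] with w hw
      exact (if_pos hw).symm
    · refine tendsto_of_seq_tendsto fun w hw => ?_
      obtain ⟨hw1, hw2⟩ := tendsto_nhdsWithin_iff.1 hw
      have hfst : Tendsto (fun n => (w n).1) atTop (𝓝 x) := (continuous_fst.tendsto _).comp hw1
      have hsnd : Tendsto (fun n => (w n).2) atTop (𝓝 0) := (continuous_snd.tendsto _).comp hw1
      -- The definition demands positive step sizes for all indices, so finitely many terms are
      -- dropped.
      obtain ⟨N, hN⟩ := eventually_atTop.1 hw2
      rw [← tendsto_add_atTop_iff_nat N]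
      have h1 := h.2 (fun n => |(w (n + N)).2|) (fun n => (w (n + N)).1) x
        (fun n => abs_pos.2 (hN _ (Nat.le_add_left _ _)))
        (by simpa using ((tendsto_add_atTop_iff_nat N).2 hsnd).abs)
        ((tendsto_add_atTop_iff_nat N).2 hfst)
      refine h1.congr fun n => ?_
      exact (if_neg (hN _ (Nat.le_add_left _ _))).symm
  · have h1 : ContinuousAt (fun w : E × ℝ => |w.2|⁻¹ • (φ (θ + |w.2| • w.1) - φ θ)) (x, s) := by
      have h2 : ContinuousAt (fun w : E × ℝ => |w.2|⁻¹) (x, s) :=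
        ContinuousAt.inv₀ (by fun_prop) (abs_ne_zero.2 hs)
      exact h2.smul (by fun_prop)
    refine h1.congr ?_
    filter_upwards [(continuous_snd.tendsto (x, s)).eventually_ne hs] with w hw
    exact (if_neg hw).symm

/-- Delta method for Hadamard directionally differentiable maps. -/
theorem HasHadamardDirDerivAt.tendstoInDistribution {Ω Ω' : Type*} [MeasurableSpace Ω]
    [MeasurableSpace Ω'] {P : Measure Ω} [IsProbabilityMeasure P] {Q : Measure Ω'}
    [IsProbabilityMeasure Q] [MeasurableSpace E] [BorelSpace E] [SecondCountableTopology E]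
    [MeasurableSpace F] [BorelSpace F] (h : HasHadamardDirDerivAt φ φ' θ) (hφ : Continuous φ)
    {r : ℕ → ℝ} (hr : ∀ n, 0 ≤ r n) (hr' : Tendsto r atTop atTop) {T : ℕ → Ω → E} {G : Ω' → E}
    (hT : TendstoInDistribution (fun n ω => r n • (T n ω - θ)) atTop G (fun _ => P) Q) :
    TendstoInDistribution (fun n ω => r n • (φ (T n ω) - φ θ)) atTop (fun ω => φ' (G ω))
      (fun _ => P) Q := by
  have h1 := hT.continuous_comp_prodMk_of_tendstoInMeasure_const
    (h.continuous_diffQuotient hφ) (Y := fun n _ => (r n)⁻¹) (c := (0 : ℝ))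
    (tendstoInMeasure_of_tendsto_const hr'.inv_tendsto_atTop) (fun _ => aemeasurable_const)
  have e : (fun n ω => diffQuotient φ φ' θ (r n • (T n ω - θ), (r n)⁻¹)) =
      fun n ω => r n • (φ (T n ω) - φ θ) := by
    funext n ω
    rcases eq_or_ne (r n) 0 with h0 | h0
    -- For rate 0 the inverse is 0 by convention; both sides are then zero since φ'(0) = 0.
    · simp [diffQuotient, h0, h.map_zero]
    · simp [diffQuotient, h0, abs_of_nonneg (hr n)]
  rw [e] at h1
  simpa [diffQuotient] using h1

end DeltaMethod

/-! ### Gaussianity of the limit of the bounds -/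

/-- A Gaussian variable plus an independent nonnegative variable, positive with probability
strictly between `0` and `1`, is not Gaussian. -/
theorem map_add_ne_gaussianReal {v₁ v : ℝ≥0} {a μ : ℝ} {ν : Measure ℝ} [IsProbabilityMeasure ν]
    {r : ℝ → ℝ} (hr : Measurable r) (hr0 : ∀ y, 0 ≤ r y) (hz : ν {y | r y = 0} ≠ 0)
    (hpos : ν {y | 0 < r y} ≠ 0) :
    ((gaussianReal 0 v₁).prod ν).map (fun w => a * w.1 + r w.2) ≠ gaussianReal μ v := by
  intro hcon
  set M : ℝ → ℝ := fun t => ∫ y, Real.exp (t * r y) ∂ν with hM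
  have hint : ∀ t ≤ 0, Integrable (fun y => Real.exp (t * r y)) ν := fun t ht =>
    Integrable.of_bound (by fun_prop) 1 (Eventually.of_forall fun y => by
      rw [Real.norm_eq_abs, Real.abs_exp, Real.exp_le_one_iff]
      exact mul_nonpos_of_nonpos_of_nonneg ht (hr0 y))
  -- By independence the Gaussian factor divides out of the moment generating function of the sum.
  have hMt : ∀ t, M t = Real.exp (μ * t + (v - v₁ * a ^ 2) / 2 * t ^ 2) := by
    intro t
    have h1 := mgf_gaussianReal hcon t
    have h2 : mgf (fun w : ℝ × ℝ => a * w.1 + r w.2) ((gaussianReal 0 v₁).prod ν) t =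
        Real.exp (v₁ * (t * a) ^ 2 / 2) * M t := by
      have h3 := congrFun (mgf_id_gaussianReal (μ := 0) (v := v₁)) (t * a)
      rw [zero_mul, zero_add] at h3
      rw [← h3, mgf, mgf, hM, ← integral_prod_mul]
      refine integral_congr_ae (Eventually.of_forall fun w => ?_)
      simp only [id, ← Real.exp_add]
      ring_nf
    rw [h1] at h2
    rw [← mul_right_inj' (Real.exp_pos (v₁ * (t * a) ^ 2 / 2)).ne', ← h2, ← Real.exp_add]
    ring_nf
  set c : ℝ := (v - v₁ * a ^ 2) / 2
  set π : ℝ := ν.real {y | r y = 0} with hπ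
  have hπ0 : 0 < π := ENNReal.toReal_pos hz (measure_ne_top _ _)
  have hlow : ∀ t ≤ 0, π ≤ M t := by
    intro t ht
    have hms : MeasurableSet {y | r y = 0} := hr (measurableSet_singleton 0)
    rw [hπ, ← integral_indicator_one hms]
    refine integral_mono ((integrable_const 1).indicator hms) (hint t ht) fun y => ?_
    by_cases hy : r y = 0
    · rw [indicator_of_mem (show y ∈ {y | r y = 0} from hy)]; simp [hy]
    · rw [indicator_of_notMem (show y ∉ {y | r y = 0} from hy)]; positivity
  have hup : ∀ t ≤ 0, M t ≤ 1 := by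
    intro t ht
    calc M t ≤ ∫ _, 1 ∂ν := integral_mono (hint t ht) (integrable_const 1) fun y =>
          Real.exp_le_one_iff.2 (mul_nonpos_of_nonpos_of_nonneg ht (hr0 y))
      _ = 1 := by simp
  have hquad : ∀ t ≤ 0, Real.log π ≤ μ * t + c * t ^ 2 ∧ μ * t + c * t ^ 2 ≤ 0 := by
    intro t ht
    have h1 := hlow t ht
    have h2 := hup t ht
    rw [hMt] at h1 h2
    exact ⟨(Real.log_le_iff_le_exp hπ0).2 h1, Real.exp_le_one_iff.1 h2⟩
  have hconst : μ = 0 ∧ c = 0 := by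
    set L := -Real.log π with hL
    have hL0 : 0 ≤ L := by have := hquad 0 le_rfl; simp at this; linarith
    have hx : ∀ x, 0 ≤ x → -L ≤ -μ * x + c * x ^ 2 ∧ -μ * x + c * x ^ 2 ≤ 0 := fun x hx => by
      have := hquad (-x) (by linarith)
      constructor <;> nlinarith [this.1, this.2]
    -- Combining the bounds at x and 2x isolates the linear and the quadratic term; 5L is generous.
    -- As x is arbitrary, both coefficients must vanish.
    have hlin : ∀ x, 0 ≤ x → |μ| * x ≤ 5 * L ∧ |c| * x ^ 2 ≤ 5 * L := by
      intro x h0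
      obtain ⟨a1, a2⟩ := hx x h0
      obtain ⟨b1, b2⟩ := hx (2 * x) (by linarith)
      constructor
      · rcases abs_cases μ with ⟨h, -⟩ | ⟨h, -⟩ <;> rw [h] <;> nlinarith
      · rcases abs_cases c with ⟨h, -⟩ | ⟨h, -⟩ <;> rw [h] <;> nlinarith
    constructor
    · by_contra hne
      have hpos := abs_pos.2 hne
      have := (hlin ((5 * L + 1) / |μ|) (by positivity)).1
      rw [mul_div_cancel₀ _ hpos.ne'] at this
      linarith
    · by_contra hne
      have hpos := abs_pos.2 hne
      have h1 := (hlin (√((5 * L + 1) / |c|)) (by positivity)).2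
      rw [Real.sq_sqrt (by positivity), mul_div_cancel₀ _ hpos.ne'] at h1
      linarith
  -- The mean of exp(-r) is 1 although exp(-r) ≤ 1, hence r = 0 almost surely, contradicting `hpos`.
  have h1 : M (-1) = 1 := by rw [hMt, hconst.1, hconst.2]; simp
  have h2 : ∫ y, (1 - Real.exp (-1 * r y)) ∂ν = 0 := by
    rw [integral_sub (integrable_const 1) (hint _ (by norm_num))]
    simp only [integral_const, probReal_univ, one_smul]
    exact sub_eq_zero.2 h1.symm
  have hdiff : Integrable (fun y => 1 - Real.exp (-1 * r y)) ν :=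
    (integrable_const 1).sub (hint _ (by norm_num))
  have h3 := (integral_eq_zero_iff_of_nonneg (fun y => sub_nonneg.2
    (Real.exp_le_one_iff.2 (by linarith [hr0 y]))) hdiff).1 h2
  refine hpos (measure_mono_null (fun y hy => ?_) (ae_iff.1 h3))
  have hy' : 0 < r y := hy
  have hexp : Real.exp (-1 * r y) < 1 := Real.exp_lt_one_iff.2 (by linarith)
  exact (sub_pos.2 hexp).ne'

/-- Lebesgue measure is absolutely continuous with respect to a nondegenerate Gaussian. -/
theorem gaussianReal_ne_zero_of_halfline_subset {v : ℝ≥0} (hv : v ≠ 0) {A : Set ℝ}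
    (hA : Ioi 0 ⊆ A ∨ Iio 0 ⊆ A) : gaussianReal 0 v A ≠ 0 := by
  intro h0
  have h1 : volume A = 0 := gaussianReal_absolutelyContinuous' 0 hv h0
  rcases hA with hA | hA <;> simpa using measure_mono_null hA h1

theorem maxDeriv_of_eq {a₁ a₂ : ℝ} (h : a₁ = a₂) (x y : ℝ) : maxDeriv a₁ a₂ x y = max x y := by
  simp [maxDeriv, h]

theorem minDeriv_of_eq {a₁ a₂ : ℝ} (h : a₁ = a₂) (x y : ℝ) : minDeriv a₁ a₂ x y = min x y := by
  simp [minDeriv, h]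

/-- The limit of the bounds is Gaussian if and only if there are no ties. -/
theorem isGaussian_map_boundDeriv_iff {v₁ v₂ : ℝ≥0} (hv₂ : v₂ ≠ 0) (𝒞 : Finset (ℝ × ℝ))
    (θ : ℝ × ℝ) :
    IsGaussian (((gaussianReal 0 v₁).prod (gaussianReal 0 v₂)).map (boundDeriv 𝒞 θ)) ↔
      ∀ c ∈ 𝒞, θ.1 - c.1 ≠ θ.1 - θ.2 - c.2 ∧ θ.1 + c.1 ≠ θ.1 - θ.2 + c.2 := by
  set μ := (gaussianReal 0 v₁).prod (gaussianReal 0 v₂)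
  have hcont := continuous_boundDeriv 𝒞 θ
  have hproj : ∀ L : (𝒞 → ℝ × ℝ) →L[ℝ] ℝ, IsGaussian (μ.map (boundDeriv 𝒞 θ)) →
      ∃ m v, μ.map (fun w => L (boundDeriv 𝒞 θ w)) = gaussianReal m v := fun L hG => by
    have := hG.map_eq_gaussianReal L
    rw [Measure.map_map (by fun_prop) (by fun_prop)] at this
    exact ⟨_, _, this⟩
  constructor
  · intro hG c hc
    constructor
    · intro htie
      obtain ⟨m, v, hmv⟩ := hproj
        ((ContinuousLinearMap.fst ℝ ℝ ℝ).comp (ContinuousLinearMap.proj ⟨c, hc⟩)) hG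
      -- At a tie, max{x, x-y} = x + max{0,-y}, with independent summands.
      refine map_add_ne_gaussianReal (v₁ := v₁) (v := v) (a := 1) (μ := m)
        (ν := gaussianReal 0 v₂) (r := fun y => max 0 (-y)) (by fun_prop)
        (fun y => le_max_left _ _)
        (gaussianReal_ne_zero_of_halfline_subset hv₂ (.inl fun y hy => ?_))
        (gaussianReal_ne_zero_of_halfline_subset hv₂ (.inr fun y hy => ?_)) ?_
      · exact max_eq_left (neg_nonpos.2 (le_of_lt hy))
      · exact lt_max_of_lt_right (neg_pos.2 (mem_Iio.1 hy))
      · rw [← hmv]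
        congr 1
        funext w
        simp only [ContinuousLinearMap.comp_apply, ContinuousLinearMap.proj_apply,
          ContinuousLinearMap.coe_fst', boundDeriv]
        rw [maxDeriv_of_eq htie, sub_eq_add_neg, one_mul, ← max_add_add_left, add_zero]
    · intro htie
      obtain ⟨m, v, hmv⟩ := hproj
        (-((ContinuousLinearMap.snd ℝ ℝ ℝ).comp (ContinuousLinearMap.proj ⟨c, hc⟩))) hG
      -- The sign is changed to obtain a nonnegative summand: -min{x, x-y} = -x + max{0,y}.
      refine map_add_ne_gaussianReal (v₁ := v₁) (v := v) (a := -1) (μ := m)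
        (ν := gaussianReal 0 v₂) (r := fun y => max 0 y) (by fun_prop)
        (fun y => le_max_left _ _)
        (gaussianReal_ne_zero_of_halfline_subset hv₂ (.inr fun y hy => ?_))
        (gaussianReal_ne_zero_of_halfline_subset hv₂ (.inl fun y hy => ?_)) ?_
      · exact max_eq_left (le_of_lt hy)
      · exact lt_max_of_lt_right (mem_Ioi.1 hy)
      · rw [← hmv]
        congr 1
        funext w
        simp only [_root_.neg_apply, ContinuousLinearMap.comp_apply,
          ContinuousLinearMap.proj_apply, ContinuousLinearMap.coe_snd', boundDeriv]
        rw [minDeriv_of_eq htie, ← max_neg_neg, ← max_add_add_left]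
        ring_nf
  · intro hno
    set A : (ℝ × ℝ) →L[ℝ] ℝ := ContinuousLinearMap.fst ℝ ℝ ℝ
    set B : (ℝ × ℝ) →L[ℝ] ℝ := ContinuousLinearMap.fst ℝ ℝ ℝ - ContinuousLinearMap.snd ℝ ℝ ℝ
    -- Without ties every entry selects one fixed linear functional, and a linear image of a
    -- Gaussian law is Gaussian.
    let L : (ℝ × ℝ) →L[ℝ] (𝒞 → ℝ × ℝ) := ContinuousLinearMap.pi fun c =>
      (if θ.1 - c.1.1 < θ.1 - θ.2 - c.1.2 then B else A).prod
        (if θ.1 + c.1.1 < θ.1 - θ.2 + c.1.2 then A else B)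
    have hL : boundDeriv 𝒞 θ = L := by
      funext k c
      obtain ⟨h₁, h₂⟩ := hno c.1 c.2
      simp only [boundDeriv, maxDeriv, minDeriv, L, ContinuousLinearMap.pi_apply,
        ContinuousLinearMap.prod_apply, Prod.mk.injEq]
      constructor
      · rcases lt_or_gt_of_ne h₁ with h | h
        · rw [if_pos h, if_pos h]; rfl
        · rw [if_neg h.not_gt, if_pos h, if_neg h.not_gt]; rfl
      · rcases lt_or_gt_of_ne h₂ with h | h
        · rw [if_pos h, if_pos h]; rfl
        · rw [if_neg h.not_gt, if_pos h, if_neg h.not_gt]; rfl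
    rw [hL]
    infer_instance

/-! ### Main theorem -/

theorem theorem2 {Ω : Type*} [MeasurableSpace Ω] (P : Measure Ω) [IsProbabilityMeasure P]
    (S : Panel Ω) (hS : IsRandomSample P S)
    (κ₀ : ℝ) (hκ₀ : 0 < κ₀)
    (m : Fin 2 → Bool → Bool → ℝ → ℝ) (hcont : ContinuityAtCutoff P S κ₀ m)
    (hsharp : SharpDiscontinuity P S κ₀)
    (p q : ℕ) (hpq : p < q)
    (f vp vm : ℝ → ℝ) (hmodel : SharpModel P S κ₀ (q + 1) m f vp vm)
    (K : ℝ → ℝ) (κ : ℝ) (hK : IsRDKernel K κ)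
    (h b : ℕ → ℝ) (ρ : ℝ) (hbw : BandwidthConditions p q h b ρ)
    -- `θ₀ = (Δμ₊, Δμ₋)`: the one-sided limits of `Δμ(z) = E[ΔY | Z = z]` at the cutoff
    (Δμ : ℝ → ℝ) (hΔμ : IsRegressionOn P (S.Z 0) (S.deltaY 0) Δμ (nbhd κ₀))
    (θ₀ : ℝ × ℝ) (hright : Tendsto Δμ (𝓝[>] 0) (𝓝 θ₀.1)) (hleft : Tendsto Δμ (𝓝[<] 0) (𝓝 θ₀.2))
    (𝒞 : Finset (ℝ × ℝ)) :
    -- the bounds are bounds for `τ_c` under bounded variations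
    (∀ c ∈ 𝒞, BoundedVariations m c → tauC m ∈ Icc (lowerBound θ₀ c) (upperBound θ₀ c)) ∧
    -- Gaussian limit of the one-sided estimators
    TendstoInDistribution
      (fun (n : ℕ) ω => √((n : ℝ) * min (h n) (b n)) • (thetaHat S K p q (h n) (b n) n ω - θ₀))
      atTop id (fun _ => P) (gaussianLimit K p q ρ (vp 0) (vm 0) (f 0)) ∧
    -- Hadamard directional derivative of the max/min map
    HasHadamardDirDerivAt (boundMap 𝒞) (boundDeriv 𝒞 θ₀) θ₀ ∧
    -- limit of the estimators of the bounds
    TendstoInDistribution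
      (fun (n : ℕ) ω => √((n : ℝ) * min (h n) (b n)) •
        (boundMap 𝒞 (thetaHat S K p q (h n) (b n) n ω) - boundMap 𝒞 θ₀))
      atTop (boundDeriv 𝒞 θ₀) (fun _ => P) (gaussianLimit K p q ρ (vp 0) (vm 0) (f 0)) ∧
    -- the limit is tight, and it is Gaussian only if no max or min has a tie
    IsTightMeasureSet
      {(gaussianLimit K p q ρ (vp 0) (vm 0) (f 0)).map (boundDeriv 𝒞 θ₀)} ∧
    (IsGaussian ((gaussianLimit K p q ρ (vp 0) (vm 0) (f 0)).map (boundDeriv 𝒞 θ₀)) ↔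
      ∀ c ∈ 𝒞, θ₀.1 - c.1 ≠ θ₀.1 - θ₀.2 - c.2 ∧ θ₀.1 + c.1 ≠ θ₀.1 - θ₀.2 + c.2) := by

  have hθ₁ := right_limit_eq hκ₀ hS hcont hsharp hmodel hΔμ hright
  have hθ₂ := left_limit_eq hκ₀ hS hcont hsharp hmodel hΔμ hleft
  have hclt := tendstoInDistribution_thetaHat hκ₀ hS hcont hsharp hpq hmodel hK hbw hθ₁ hθ₂
  have hhad := hasHadamardDirDerivAt_boundMap 𝒞 θ₀
  have h0 : (0 : ℝ) ∈ nbhd κ₀ := ⟨by linarith, hκ₀⟩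
  obtain ⟨a, ha, hfa⟩ := hmodel.density_pos
  obtain ⟨a', ha', hva⟩ := hmodel.variance_left_pos
  -- Only the left variance matters for the Gaussianity criterion: the kink at a tie is in the
  -- second coordinate.
  have hvar : 0 < limVar K p q ρ (vm 0) (f 0) :=
    limVar_pos hK hpq hbw.rho_nonneg (ha'.trans_le (hva 0 h0)) (ha.trans_le (hfa 0 h0))
  have hmap : IsProbabilityMeasure
      ((gaussianLimit K p q ρ (vp 0) (vm 0) (f 0)).map (boundDeriv 𝒞 θ₀)) :=
    Measure.isProbabilityMeasure_map hhad.1.aemeasurable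
  exact ⟨fun c _ hc => tauC_mem_Icc hθ₁ hθ₂ hc, hclt, hhad,
    hhad.tendstoInDistribution (continuous_boundMap 𝒞) (fun _ => Real.sqrt_nonneg _)
      (Real.tendsto_sqrt_atTop.comp hbw.min_tendsto) hclt,
    isTightMeasureSet_singleton,
    isGaussian_map_boundDeriv_iff (Real.toNNReal_pos.2 hvar).ne' 𝒞 θ₀⟩

end
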